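/- **Setting.** Let $\Omega\subset\mathbb R^n$ be open, let $w\in L^1_{loc}(\Omega)$ satisfy $w>0$ a.e. on $\Omega$, and let $dm=w\,dX$ on $\Omega$. Assume: - (H4, doubling) there is $C_4\ge 1$ such that $m(B(X,2r)\cap\Omega)\le C_4\,m(B(X,r)\cap\Omega)$ for all $X\in\overline\Omega$ and $r>0$; - (H6) (i) if $D$ is open with $\overline D$ a compact subset of $\Omega$, $u_i\in C^\infty(\overline D)$, $v\in L^2(D,m)$ is vector valued, $\int_D|u_i|\,dm\to0$ and $\int_D|\nabla u_i-v|^2\,dm\to0$, then $v=0$ $m$-a.e. on $D$; (ii) there is $C_6>0$ such that for every ball $B$ of radius $r$ with $2B\subset\Omega$ and every $u\in C^\infty(\overline B)$, with $u_B=\frac1{m(B)}\int_B u\,dm$, $$\frac1{m(B)}\int_B|u-u_B|\,dm\le C_6\,r\left(\frac1{m(B)}\int_B|\nabla u|^2\,dm\right)^{1/2}.$$ Let $A$ be a measurable $n\times n$ real matrix field on $\Omega$ (not necessarily symmetric) such that, for some $C_A>0$ and a.e. $X\in\Omega$, $A(X)\xi\cdot\xi\ge C_A^{-1}w(X)|\xi|^2$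 and $A(X)\xi\cdot\zeta\le C_A\,w(X)|\xi||\zeta|$ for all $\xi,\zeta\in\mathbb R^n$. Put $L=-\operatorname{div}A\nabla$. **Function spaces.** $W$ is the set of $u\in L^1_{loc}(\Omega,m)$ for which there are $v\in L^2(\Omega,m)$ and smooth $\varphi_i\in C^\infty(\overline\Omega)$ with $\int_\Omega|\nabla\varphi_i|^2dm<\infty$, $\int_B|\varphi_i-u|\,dm\to0$ for every ball $B$ with $2B\subset\Omega$, and $\int_\Omega|\nabla\varphi_i-v|^2dm\to0$; by (H6)(i) $v$ is unique $m$-a.e. and is denoted $\nabla u$. For an open set $E\subset\Omega$, $W_r(E)$ is the set of $u\in L^1_{loc}(E,m)$ such that $\varphi u\in W$ for all $\varphi\in C_0^\infty(E)$; the gradient $\nabla u$ on $E$ is the (a.e. unique) vector field that coincides a.e. with $\nabla(\varphi u)$ on each open set where $\varphi=1$, $\varphi\in C_0^\infty(E)$. A function $u\in W_r(E)$ is a (weak) solution of $Lu=0$ in $E$ if $\int_E A\nabla u\cdot\nabla\varphi\,dX=0$ for all $\varphi\in C_0^\infty(E)$. **Lemma (interior Harnack inequality).** There is a constant $C>0$,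 depending only on $n$, $C_4$, $C_6$ and $C_A$, such that for every ball $B$ with $2B\subset\Omega$ and every $u\in W_r(2B)$ that is a solution of $Lu=0$ in $2B$ and is non-negative a.e. in $2B$, $$\sup_B u\le C\,\inf_B u,$$ where $\sup$ and $\inf$ are the essential supremum and infimum. -/

import Mathlib

open MeasureTheory Filter Topology Metric
open scoped ENNReal ContDiff Matrix

namespace DegElliptic

/-- The measure `dm = w dX` on `Ω`, extended by zero outside of `Ω`. -/
noncomputable def weightMeasure {n : ℕ} (Ω : Set (EuclideanSpace ℝ (Fin n)))
    (w : EuclideanSpace ℝ (Fin n) → ℝ) : Measure (EuclideanSpace ℝ (Fin n)) :=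
  (volume.restrict Ω).withDensity (fun X => ENNReal.ofReal (w X))

/-- The weight `w` is locally integrable on `Ω`, positive almost everywhere on `Ω`, and the measure
`dm = w dX` is doubling on `Ω` with constant `C₄` (balls centred on the closure of `Ω`, all
radii). -/
structure DoublingWeight {n : ℕ} (Ω : Set (EuclideanSpace ℝ (Fin n)))
    (w : EuclideanSpace ℝ (Fin n) → ℝ) (C₄ : ℝ) : Prop where
  locallyIntegrable : LocallyIntegrableOn w Ω volume
  pos : ∀ᵐ X ∂(volume.restrict Ω), 0 < w X
  doubling : ∀ X ∈ closure Ω, ∀ r : ℝ, 0 < r →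
    weightMeasure Ω w (ball X (2 * r) ∩ Ω) ≤
      ENNReal.ofReal C₄ * weightMeasure Ω w (ball X r ∩ Ω)

/-- Uniqueness of the limit gradient: if `D` is open and relatively compact in `Ω`, `uᵢ` is smooth
up to the boundary of `D`, `uᵢ → 0` in `L¹(D, m)` and `∇ uᵢ → v` in `L²(D, m)`, then `v = 0`
almost everywhere on `D`. (Smooth functions on a closed set are restrictions of smooth functions on
the whole space.) -/
def UniqueGradientLimits {n : ℕ} (Ω : Set (EuclideanSpace ℝ (Fin n)))
    (m : Measure (EuclideanSpace ℝ (Fin n))) : Prop :=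
  ∀ D : Set (EuclideanSpace ℝ (Fin n)), IsOpen D → IsCompact (closure D) → closure D ⊆ Ω →
    ∀ (φ : ℕ → EuclideanSpace ℝ (Fin n) → ℝ)
      (v : EuclideanSpace ℝ (Fin n) → EuclideanSpace ℝ (Fin n)),
      (∀ i, ContDiff ℝ ∞ (φ i)) → MemLp v 2 (m.restrict D) →
      Tendsto (fun i => ∫⁻ X in D, ‖φ i X‖ₑ ∂m) atTop (𝓝 0) →
      Tendsto (fun i => ∫⁻ X in D, ‖gradient (φ i) X - v X‖ₑ ^ 2 ∂m) atTop (𝓝 0) →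
      v =ᵐ[m.restrict D] 0

/-- The weak Poincaré inequality with constant `C₆`, on all balls `B` with `2B ⊆ Ω`. -/
def WeakPoincare {n : ℕ} (Ω : Set (EuclideanSpace ℝ (Fin n)))
    (m : Measure (EuclideanSpace ℝ (Fin n))) (C₆ : ℝ) : Prop :=
  ∀ (x : EuclideanSpace ℝ (Fin n)) (r : ℝ), 0 < r → ball x (2 * r) ⊆ Ω →
    ∀ φ : EuclideanSpace ℝ (Fin n) → ℝ, ContDiff ℝ ∞ φ →
      ⨍ X in ball x r, |φ X - ⨍ Y in ball x r, φ Y ∂m| ∂m ≤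
        C₆ * r * Real.sqrt (⨍ X in ball x r, ‖gradient φ X‖ ^ 2 ∂m)

/-- `A` is a measurable matrix field such that `w⁻¹ A` is bounded and elliptic on `Ω`, with
constant `C_A`. -/
structure EllipticMatrix {n : ℕ} (Ω : Set (EuclideanSpace ℝ (Fin n)))
    (w : EuclideanSpace ℝ (Fin n) → ℝ)
    (A : EuclideanSpace ℝ (Fin n) → Matrix (Fin n) (Fin n) ℝ) (C_A : ℝ) : Prop where
  measurable : ∀ i j, AEMeasurable (fun X => A X i j) (volume.restrict Ω)
  elliptic : ∀ᵐ X ∂(volume.restrict Ω), ∀ ξ : EuclideanSpace ℝ (Fin n),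
    C_A⁻¹ * w X * ‖ξ‖ ^ 2 ≤ (A X *ᵥ ξ.ofLp) ⬝ᵥ ξ.ofLp
  bounded : ∀ᵐ X ∂(volume.restrict Ω), ∀ ξ ζ : EuclideanSpace ℝ (Fin n),
    (A X *ᵥ ξ.ofLp) ⬝ᵥ ζ.ofLp ≤ C_A * w X * ‖ξ‖ * ‖ζ‖

/-- `φ ∈ C₀^∞(E)`. -/
structure IsTestFunction {n : ℕ} (E : Set (EuclideanSpace ℝ (Fin n)))
    (φ : EuclideanSpace ℝ (Fin n) → ℝ) : Prop where
  contDiff : ContDiff ℝ ∞ φ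
  hasCompactSupport : HasCompactSupport φ
  tsupport_subset : tsupport φ ⊆ E

/-- `u` belongs to the energy space `W` and `v` is a `W`-gradient of `u`: `u ∈ L¹_loc(Ω, m)`,
`v ∈ L²(Ω, m)`, and some sequence of smooth functions `φᵢ` with `∇ φᵢ ∈ L²(Ω, m)` converges to `u`
in `L¹(B, m)` for each ball `B` with `2B ⊆ Ω`, while `∇ φᵢ` converges to `v` in `L²(Ω, m)`.
(This need not be the distributional gradient.) -/
structure HasWGradient {n : ℕ} (Ω : Set (EuclideanSpace ℝ (Fin n)))
    (m : Measure (EuclideanSpace ℝ (Fin n))) (u : EuclideanSpace ℝ (Fin n) → ℝ)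
    (v : EuclideanSpace ℝ (Fin n) → EuclideanSpace ℝ (Fin n)) : Prop where
  locallyIntegrable : LocallyIntegrableOn u Ω m
  memLp : MemLp v 2 (m.restrict Ω)
  approx : ∃ φ : ℕ → EuclideanSpace ℝ (Fin n) → ℝ,
    (∀ i, ContDiff ℝ ∞ (φ i)) ∧
    (∀ i, ∫⁻ X in Ω, ‖gradient (φ i) X‖ₑ ^ 2 ∂m < ⊤) ∧
    (∀ (x : EuclideanSpace ℝ (Fin n)) (r : ℝ), 0 < r → ball x (2 * r) ⊆ Ω →
      Tendsto (fun i => ∫⁻ X in ball x r, ‖φ i X - u X‖ₑ ∂m) atTop (𝓝 0)) ∧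
    Tendsto (fun i => ∫⁻ X in Ω, ‖gradient (φ i) X - v X‖ₑ ^ 2 ∂m) atTop (𝓝 0)

/-- The energy space `W`. -/
def MemW {n : ℕ} (Ω : Set (EuclideanSpace ℝ (Fin n)))
    (m : Measure (EuclideanSpace ℝ (Fin n))) (u : EuclideanSpace ℝ (Fin n) → ℝ) : Prop :=
  ∃ v, HasWGradient Ω m u v

/-- The local energy space `W_r(E)`: `u ∈ L¹_loc(E ∩ Ω, m)`, and `φ u ∈ W` for all
`φ ∈ C₀^∞(E)`. -/
structure MemWr {n : ℕ} (Ω : Set (EuclideanSpace ℝ (Fin n)))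
    (m : Measure (EuclideanSpace ℝ (Fin n))) (E : Set (EuclideanSpace ℝ (Fin n)))
    (u : EuclideanSpace ℝ (Fin n) → ℝ) : Prop where
  locallyIntegrable : LocallyIntegrableOn u (E ∩ Ω) m
  memW : ∀ φ, IsTestFunction E φ → MemW Ω m (fun X => φ X * u X)

/-- `G` is the gradient on `E` of `u ∈ W_r(E)`: it is given, on each open set where a cut-off
`φ ∈ C₀^∞(E)` equals one, by the `W`-gradient of `φ u`. -/
def HasLocalWGradient {n : ℕ} (Ω : Set (EuclideanSpace ℝ (Fin n)))
    (m : Measure (EuclideanSpace ℝ (Fin n))) (E : Set (EuclideanSpace ℝ (Fin n)))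
    (u : EuclideanSpace ℝ (Fin n) → ℝ)
    (G : EuclideanSpace ℝ (Fin n) → EuclideanSpace ℝ (Fin n)) : Prop :=
  ∀ φ, IsTestFunction E φ → ∀ U : Set (EuclideanSpace ℝ (Fin n)), IsOpen U →
    (∀ X ∈ U, φ X = 1) →
    ∃ v, HasWGradient Ω m (fun X => φ X * u X) v ∧ v =ᵐ[m.restrict U] G

/-- `u ∈ W_r(E)` is a weak solution of `- div A ∇ u = 0` in the open set `E ⊆ Ω`. The gradient `G`
of `u` on `E` is unique almost everywhere as soon as `UniqueGradientLimits` holds. -/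
structure IsWeakSolution {n : ℕ} (Ω : Set (EuclideanSpace ℝ (Fin n)))
    (w : EuclideanSpace ℝ (Fin n) → ℝ)
    (A : EuclideanSpace ℝ (Fin n) → Matrix (Fin n) (Fin n) ℝ)
    (E : Set (EuclideanSpace ℝ (Fin n))) (u : EuclideanSpace ℝ (Fin n) → ℝ) : Prop where
  memWr : MemWr Ω (weightMeasure Ω w) E u
  weak_eq : ∃ G, HasLocalWGradient Ω (weightMeasure Ω w) E u G ∧
    ∀ φ, IsTestFunction E φ →
      ∫ X in E, (A X *ᵥ (G X).ofLp) ⬝ᵥ (gradient φ X).ofLp = 0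

end DegElliptic

/-! The proof is Moser's iteration for the measure `m = w dX`, with the Bombieri–Giusti lemma in
place of the John–Nirenberg inequality. Of `m` it uses doubling, the weak Poincaré inequality, and
the positivity and finiteness of the measures of balls centred in `Ω`. Telescoping averages over
dyadic balls turns these into a Sobolev inequality with a gain of integrability κ > 1 depending on
`C₄` (`sobolev_smooth`).

Testing the equation with η² times a truncated power of u gives a Caccioppoli inequality for each
power u^p with p ≠ 1 (`LocalSolution.caccioppoli`). Together with Sobolev it yields a reverse Hölder
inequality from exponent p to κp on shrinking balls (`LocalSolution.moser_step`). Iterating it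
bounds the essential supremum of u^p by its mean (`sup_estimate`), uniformly over all p < 0 and over
a sequence of positive p tending to 0 whose iterates stay away from the singular exponent 1.

The case p = 0 of Caccioppoli controls the gradient of log u at the natural scale, so by Poincaré
log u - c is bounded in mean for some constant c (`log_estimate`). Applied to both signs of log u -
c, `bombieri_giusti` combines this with the supremum estimates into |log u - c| ≤ A on a smaller
ball (`local_harnack`). Exponentiating gives Harnack on small balls, and chains of overlapping balls
carry it to B (`essSup_le_mul_essInf_of_chain`).

Two devices make the calculus legitimate. The gradient in W is a limit of smooth gradients and need
not be distributional, so chain rules and inequalities are proved for smooth functions and passed to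
the limit along an `ApproxPair`. And u is replaced by u + ε, on whose range powers and the logarithm
are smooth; no constant depends on ε, which tends to 0 at the end. -/

namespace DegElliptic

/-! ### Sobolev inequality for smooth functions from doubling and Poincaré. -/

/-- The structural hypotheses on the measure `m` in the open set `Ω`. -/
structure DoublingPoincare {n : ℕ} (Ω : Set (EuclideanSpace ℝ (Fin n)))
    (m : Measure (EuclideanSpace ℝ (Fin n))) (C₄ C₆ : ℝ) : Prop where
  sfinite : SFinite m
  one_le : 1 ≤ C₄
  pos_C₆ : 0 < C₆
  doubling : ∀ X ∈ Ω, ∀ r : ℝ, 0 < r →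
    m (ball X (2 * r)) ≤ ENNReal.ofReal C₄ * m (ball X r)
  pos : ∀ X ∈ Ω, ∀ r : ℝ, 0 < r → 0 < m (ball X r)
  lt_top : ∀ X ∈ Ω, ∀ r : ℝ, 0 < r → m (ball X r) < ⊤
  poincare : WeakPoincare Ω m C₆

variable {n : ℕ} {Ω : Set (EuclideanSpace ℝ (Fin n))} {m : Measure (EuclideanSpace ℝ (Fin n))}
  {C₄ C₆ : ℝ}

theorem continuous_gradient {f : EuclideanSpace ℝ (Fin n) → ℝ} (hf : ContDiff ℝ ∞ f) :
    Continuous (gradient f) :=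
  (InnerProductSpace.toDual ℝ (EuclideanSpace ℝ (Fin n))).symm.continuous.comp
    (hf.continuous_fderiv (by simp))

theorem integrableOn_ball_of_continuous {F : Type*} [NormedAddCommGroup F]
    {g : EuclideanSpace ℝ (Fin n) → F} (hg : Continuous g) (x : EuclideanSpace ℝ (Fin n)) (s : ℝ)
    (hm : m (ball x s) < ⊤) : IntegrableOn g (ball x s) m := by
  obtain ⟨C, hC⟩ := (isCompact_closedBall x s).exists_bound_of_continuousOn hg.continuousOn
  refine Measure.integrableOn_of_bounded (M := C) hm.ne ?_ ?_
  · exact (hg.aestronglyMeasurable)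
  · exact (ae_restrict_iff' measurableSet_ball).2
      (ae_of_all _ fun X hX => hC X (ball_subset_closedBall hX))

theorem enorm_average_sub_le {f : EuclideanSpace ℝ (Fin n) → ℝ} {B : Set (EuclideanSpace ℝ (Fin n))}
    (hf : IntegrableOn f B m) (h0 : m B ≠ 0) (ht : m B ≠ ⊤) (c : ℝ) :
    ‖(⨍ X in B, f X ∂m) - c‖ₑ ≤ (m B)⁻¹ * ∫⁻ X in B, ‖f X - c‖ₑ ∂m := by
  have hfin : IsFiniteMeasure (m.restrict B) := ⟨by simpa using ht.lt_top⟩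
  have hpos : 0 < m.real B := ENNReal.toReal_pos h0 ht
  have h1 : (⨍ X in B, f X ∂m) - c = (m.real B)⁻¹ • ∫ X in B, (f X - c) ∂m := by
    rw [setAverage_eq, integral_sub hf (integrable_const c)]
    simp only [integral_const, smul_eq_mul, measureReal_restrict_apply_univ]
    field_simp
  rw [h1, enorm_smul]
  gcongr
  · rw [Real.enorm_eq_ofReal (by positivity), ENNReal.ofReal_inv_of_pos hpos, Measure.real,
      ENNReal.ofReal_toReal ht]
  · exact enorm_integral_le_lintegral_enorm _

/-- The Poincaré inequality rewritten with lower integrals, so that later estimates need no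
integrability side conditions. -/
theorem lintegral_sub_average_le (H : DoublingPoincare Ω m C₄ C₆)
    {f : EuclideanSpace ℝ (Fin n) → ℝ} (hf : ContDiff ℝ ∞ f) {x : EuclideanSpace ℝ (Fin n)} {s : ℝ}
    (hs : 0 < s) (hx : ball x (2 * s) ⊆ Ω) :
    (m (ball x s))⁻¹ * ∫⁻ X in ball x s, ‖f X - ⨍ Y in ball x s, f Y ∂m‖ₑ ∂m ≤
      ENNReal.ofReal (C₆ * s) *
        ((m (ball x s))⁻¹ * ∫⁻ X in ball x s, ‖gradient f X‖ₑ ^ 2 ∂m) ^ (1 / 2 : ℝ) := by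
  have hxΩ : x ∈ Ω := hx (mem_ball_self (by positivity))
  have h0 := (H.pos x hxΩ s hs)
  have ht := (H.lt_top x hxΩ s hs)
  have hpos : 0 < m.real (ball x s) := ENNReal.toReal_pos h0.ne' ht.ne
  have hM : (m (ball x s))⁻¹ = ENNReal.ofReal ((m.real (ball x s))⁻¹) := by
    rw [ENNReal.ofReal_inv_of_pos hpos, Measure.real, ENNReal.ofReal_toReal ht.ne]
  have key : ∀ g : EuclideanSpace ℝ (Fin n) → ℝ, Continuous g → (∀ X, 0 ≤ g X) →
      ENNReal.ofReal (⨍ X in ball x s, g X ∂m) =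
        (m (ball x s))⁻¹ * ∫⁻ X in ball x s, ENNReal.ofReal (g X) ∂m := by
    intro g hg hg0
    rw [setAverage_eq, smul_eq_mul, ENNReal.ofReal_mul (by positivity), hM,
      ofReal_integral_eq_lintegral_ofReal (integrableOn_ball_of_continuous hg x s ht)
        (ae_of_all _ hg0)]
  have h1 := ENNReal.ofReal_le_ofReal (H.poincare x s hs hx f hf)
  rw [key _ (by have := hf.continuous; fun_prop) (fun X => abs_nonneg _),
    ENNReal.ofReal_mul (by have := H.pos_C₆; positivity), Real.sqrt_eq_rpow,
    ← ENNReal.ofReal_rpow_of_nonneg ?_ (by norm_num),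
    key _ (by have := continuous_gradient hf; fun_prop) (fun X => by positivity)] at h1
  · convert h1 using 6 with X
    · rw [← Real.norm_eq_abs, ofReal_norm]
    · rw [ENNReal.ofReal_pow (norm_nonneg _), ofReal_norm]
  · rw [setAverage_eq]
    exact smul_nonneg (by positivity) (integral_nonneg fun X => by positivity)

theorem DoublingPoincare.measure_ball_le (H : DoublingPoincare Ω m C₄ C₆)
    {x : EuclideanSpace ℝ (Fin n)} (hx : x ∈ Ω) {R : ℝ} (hR : 0 < R) (j : ℕ) :
    m (ball x R) ≤ ENNReal.ofReal C₄ ^ j * m (ball x (R / 2 ^ j)) := by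
  induction j with
  | zero => simp
  | succ k ih =>
    refine ih.trans ?_
    rw [pow_succ, mul_assoc]
    gcongr
    have := H.doubling x hx (R / 2 ^ (k + 1)) (by positivity)
    rwa [show 2 * (R / 2 ^ (k + 1)) = R / 2 ^ k by field_simp; ring] at this

theorem inv_measure_le {a b c : ℝ≥0∞} (hc0 : c ≠ 0) (hc : c ≠ ⊤) (h : a ≤ c * b) :
    b⁻¹ ≤ c * a⁻¹ := by
  rw [← ENNReal.inv_le_inv] at h
  rw [ENNReal.mul_inv (Or.inl hc0) (Or.inl hc)] at h
  calc b⁻¹ = c * (c⁻¹ * b⁻¹) := by rw [← mul_assoc, ENNReal.mul_inv_cancel hc0 hc, one_mul]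
    _ ≤ c * a⁻¹ := by gcongr

theorem DoublingPoincare.ofReal_ne_zero (H : DoublingPoincare Ω m C₄ C₆) :
    ENNReal.ofReal C₄ ≠ 0 := by
  have := H.one_le
  simp; linarith

/-- Since x lies in `ball y R`, the ball about y is contained in `ball x (2 * R)`; one doubling
recentres and j more shrink the radius. -/
theorem DoublingPoincare.inv_measure_ball_le (H : DoublingPoincare Ω m C₄ C₆)
    {x y : EuclideanSpace ℝ (Fin n)} {R : ℝ} (hR : 0 < R) (hx : x ∈ Ω) (hxy : x ∈ ball y R)
    (j : ℕ) :
    (m (ball x (R / 2 ^ j)))⁻¹ ≤ ENNReal.ofReal C₄ ^ (j + 1) * (m (ball y R))⁻¹ := by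
  refine inv_measure_le (pow_ne_zero _ H.ofReal_ne_zero) (by finiteness) ?_
  rw [pow_succ', mul_assoc]
  calc m (ball y R) ≤ m (ball x (2 * R)) :=
        measure_mono (ball_subset_ball' (by rw [mem_ball, dist_comm] at hxy; linarith))
    _ ≤ _ := H.doubling x hx R hR
    _ ≤ _ := by gcongr; exact H.measure_ball_le hx hR j

theorem tendsto_average_ball (H : DoublingPoincare Ω m C₄ C₆)
    {f : EuclideanSpace ℝ (Fin n) → ℝ} (hf : Continuous f) {x : EuclideanSpace ℝ (Fin n)}
    (hx : x ∈ Ω) {R : ℝ} (hR : 0 < R) :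
    Tendsto (fun j : ℕ => ⨍ X in ball x (R / 2 ^ j), f X ∂m) atTop (𝓝 (f x)) := by
  rw [EMetric.tendsto_atTop]
  intro ε hε
  obtain ⟨ε', hε'0, hε'⟩ := exists_between hε
  obtain ⟨δ, hδ, hδ'⟩ := EMetric.continuous_iff.1 hf x ε' hε'0
  have hlim : Tendsto (fun j : ℕ => R / 2 ^ j) atTop (𝓝 0) := by
    have := (tendsto_pow_atTop_nhds_zero_of_lt_one (r := (1 / 2 : ℝ)) (by norm_num)
      (by norm_num)).const_mul R
    simpa [div_eq_mul_inv] using this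
  have hδev : ∀ᶠ j : ℕ in atTop, ENNReal.ofReal (R / 2 ^ j) < δ := by
    have := (ENNReal.tendsto_ofReal hlim)
    rw [ENNReal.ofReal_zero] at this
    exact this.eventually_lt_const hδ
  obtain ⟨N, hN⟩ := eventually_atTop.1 hδev
  refine ⟨N, fun j hj => lt_of_le_of_lt ?_ hε'⟩
  have hs : 0 < R / 2 ^ j := by positivity
  have h0 := (H.pos x hx _ hs).ne'
  have ht := (H.lt_top x hx _ hs)
  rw [edist_eq_enorm_sub]
  refine (enorm_average_sub_le (integrableOn_ball_of_continuous hf x _ ht) h0 ht.ne _).trans ?_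
  calc _ ≤ (m (ball x (R / 2 ^ j)))⁻¹ * ∫⁻ X in ball x (R / 2 ^ j), ε' ∂m := by
        gcongr 1
        refine setLIntegral_mono' measurableSet_ball fun X hX => ?_
        rw [← edist_eq_enorm_sub]
        refine (hδ' X ?_).le
        refine lt_of_le_of_lt ?_ (hN j hj)
        rw [edist_dist]
        exact ENNReal.ofReal_le_ofReal (mem_ball.1 hX).le
    _ = ε' := by
        rw [setLIntegral_const, mul_comm, mul_assoc, ENNReal.mul_inv_cancel h0 ht.ne, mul_one]

/-- The averages over `ball x (R / 2 ^ j)` tend to f x, and two consecutive ones differ by at most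
`C₄` times the mean oscillation on the larger ball, which Poincaré controls. Summing the telescope
gives the bound. -/
theorem enorm_le_average_add_tsum (H : DoublingPoincare Ω m C₄ C₆)
    {f : EuclideanSpace ℝ (Fin n) → ℝ} (hf : ContDiff ℝ ∞ f) {x : EuclideanSpace ℝ (Fin n)}
    {R : ℝ} (hR : 0 < R) (hx : ball x (2 * R) ⊆ Ω) :
    ‖f x‖ₑ ≤ (m (ball x R))⁻¹ * ∫⁻ X in ball x R, ‖f X‖ₑ ∂m +
      ∑' j : ℕ, ENNReal.ofReal C₄ * (ENNReal.ofReal (C₆ * (R / 2 ^ j)) *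
        ((m (ball x (R / 2 ^ j)))⁻¹ *
          ∫⁻ X in ball x (R / 2 ^ j), ‖gradient f X‖ₑ ^ 2 ∂m) ^ (1 / 2 : ℝ)) := by
  have hxΩ : x ∈ Ω := hx (mem_ball_self (by positivity))
  have hint : ∀ s : ℝ, 0 < s → IntegrableOn f (ball x s) m := fun s hs =>
    integrableOn_ball_of_continuous hf.continuous x s (H.lt_top x hxΩ s hs)
  set a : ℕ → ℝ := fun j => ⨍ X in ball x (R / 2 ^ j), f X ∂m with ha
  have hsucc : ∀ j : ℕ, R / 2 ^ j = 2 * (R / 2 ^ (j + 1)) := fun j => by field_simp; ring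
  have hstep : ∀ j : ℕ, edist (a j) (a j.succ) ≤
      ENNReal.ofReal C₄ * (ENNReal.ofReal (C₆ * (R / 2 ^ j)) *
        ((m (ball x (R / 2 ^ j)))⁻¹ *
          ∫⁻ X in ball x (R / 2 ^ j), ‖gradient f X‖ₑ ^ 2 ∂m) ^ (1 / 2 : ℝ)) := by
    intro j
    have hs : 0 < R / 2 ^ (j + 1) := by positivity
    have hs' : 0 < R / 2 ^ j := by positivity
    have hle : R / 2 ^ j ≤ R := div_le_self hR.le (one_le_pow₀ (by norm_num))
    rw [edist_comm, edist_eq_enorm_sub]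
    refine (enorm_average_sub_le (hint _ hs) (H.pos x hxΩ _ hs).ne'
      (H.lt_top x hxΩ _ hs).ne _).trans ?_
    refine le_trans ?_ (mul_le_mul_right (lintegral_sub_average_le H hf hs'
      ((ball_subset_ball (by linarith)).trans hx)) (ENNReal.ofReal C₄))
    rw [← mul_assoc]
    gcongr
    · refine inv_measure_le H.ofReal_ne_zero (by finiteness) ?_
      have := H.doubling x hxΩ _ hs
      rwa [← hsucc] at this
    · norm_num
    · omega
  have h1 := edist_le_tsum_of_edist_le_of_tendsto₀ _ hstep (tendsto_average_ball H hf.continuous hxΩ hR)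
  have h2 : ‖a 0‖ₑ ≤ (m (ball x R))⁻¹ * ∫⁻ X in ball x R, ‖f X‖ₑ ∂m := by
    have := enorm_average_sub_le (hint R hR) (H.pos x hxΩ _ hR).ne' (H.lt_top x hxΩ _ hR).ne 0
    simpa [ha] using this
  calc ‖f x‖ₑ = edist (f x) 0 := by simp
    _ ≤ edist (a 0) 0 + edist (a 0) (f x) := by
        rw [add_comm, edist_comm (a 0) (f x)]; exact edist_triangle _ _ _
    _ ≤ _ := by
        gcongr
        simpa using h2

/-- The balls of radius s are the sections of one open subset of the product space. -/
theorem measurable_measure_ball [SFinite m] (s : ℝ) : Measurable fun z => m (ball z s) := by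
  have hS : MeasurableSet {p : EuclideanSpace ℝ (Fin n) × EuclideanSpace ℝ (Fin n) |
      dist p.2 p.1 < s} := measurableSet_lt (by fun_prop) (by fun_prop)
  exact measurable_measure_prodMk_left (ν := m) hS

theorem measurable_lintegral_ball [SFinite m] {h : EuclideanSpace ℝ (Fin n) → ℝ≥0∞}
    (hh : Measurable h) (s : ℝ) : Measurable fun x => ∫⁻ z in ball x s, h z ∂m := by
  have hS : MeasurableSet {p : EuclideanSpace ℝ (Fin n) × EuclideanSpace ℝ (Fin n) |
      dist p.2 p.1 < s} := measurableSet_lt (by fun_prop) (by fun_prop)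
  have h1 := Measurable.lintegral_prod_right' (ν := m)
    ((hh.comp (measurable_snd (α := EuclideanSpace ℝ (Fin n)))).indicator hS)
  convert h1 using 2 with x
  rw [← lintegral_indicator measurableSet_ball]
  rfl

/-- Tonelli. For z in `ball x s`, doubling lets 1/m(B(x,s)) be replaced by `C₄`/m(B(z,s)), after
which x enters only through the condition dist z x < s, and integrating in x cancels the measure of
the ball. -/
theorem lintegral_average_le (H : DoublingPoincare Ω m C₄ C₆)
    {h : EuclideanSpace ℝ (Fin n) → ℝ≥0∞} (hh : Measurable h) {y : EuclideanSpace ℝ (Fin n)}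
    {R s : ℝ} (hs : 0 < s) (hsR : s ≤ R) (hy : ball y (2 * R) ⊆ Ω) :
    ∫⁻ x in ball y R, (m (ball x s))⁻¹ * ∫⁻ z in ball x s, h z ∂m ∂m ≤
      ENNReal.ofReal C₄ * ∫⁻ z in ball y (2 * R), h z ∂m := by
  have := H.sfinite
  have hR : 0 < R := hs.trans_le hsR
  have hmeas := measurable_measure_ball (m := m) s
  set k : EuclideanSpace ℝ (Fin n) → EuclideanSpace ℝ (Fin n) → ℝ≥0∞ :=
    fun x z => {p : EuclideanSpace ℝ (Fin n) × EuclideanSpace ℝ (Fin n) |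
        dist p.2 p.1 < s}.indicator (fun p => (m (ball p.2 s))⁻¹ * h p.2) (x, z) with hk
  have hkm : Measurable (Function.uncurry k) := by
    refine Measurable.indicator ?_ (measurableSet_lt (by fun_prop) (by fun_prop))
    exact ((hmeas.comp measurable_snd).inv).mul (hh.comp measurable_snd)
  calc _ ≤ ∫⁻ x in ball y R, ENNReal.ofReal C₄ * ∫⁻ z in ball y (2 * R), k x z ∂m ∂m := by
        refine setLIntegral_mono' measurableSet_ball fun x hx => ?_
        have hsub : ball x s ⊆ ball y (2 * R) := ball_subset_ball' (by rw [mem_ball] at hx; linarith)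
        rw [← lintegral_const_mul _ (by fun_prop), ← lintegral_const_mul _ (by fun_prop)]
        calc _ ≤ ∫⁻ z in ball x s, ENNReal.ofReal C₄ * k x z ∂m := by
              refine setLIntegral_mono' measurableSet_ball fun z hz => ?_
              have : k x z = (m (ball z s))⁻¹ * h z := by
                simp only [hk]
                rw [Set.indicator_of_mem]
                exact hz
              rw [this, ← mul_assoc]
              gcongr
              refine inv_measure_le H.ofReal_ne_zero (by finiteness) ?_
              refine le_trans (measure_mono (ball_subset_ball' ?_))
                (H.doubling x (hy (ball_subset_ball (by linarith) hx)) s hs)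
              rw [mem_ball] at hz; linarith
          _ ≤ _ := lintegral_mono_set hsub
    _ = ENNReal.ofReal C₄ * ∫⁻ z in ball y (2 * R), ∫⁻ x in ball y R, k x z ∂m ∂m := by
        rw [lintegral_const_mul _ (by exact Measurable.lintegral_prod_right' hkm),
          lintegral_lintegral_swap hkm.aemeasurable]
    _ ≤ _ := by
        gcongr 1
        refine setLIntegral_mono' measurableSet_ball fun z hz => ?_
        calc _ ≤ ∫⁻ x, k x z ∂m := setLIntegral_le_lintegral _ _
          _ = ∫⁻ x in ball z s, (m (ball z s))⁻¹ * h z ∂m := by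
              rw [← lintegral_indicator measurableSet_ball]
              congr 1 with x
              by_cases hd : dist z x < s
              · rw [Set.indicator_of_mem (by rwa [mem_ball, dist_comm])]
                exact Set.indicator_of_mem (by exact hd) _
              · rw [Set.indicator_of_notMem (by rwa [mem_ball, dist_comm])]
                exact Set.indicator_of_notMem (by exact hd) _
          _ ≤ h z := by
              rw [setLIntegral_const, mul_comm, ← mul_assoc]
              calc _ ≤ 1 * h z := by gcongr; exact ENNReal.mul_inv_le_one _
                _ = h z := one_mul _

/-- Interpolation: κ - 1 of the κ factors are bounded by the supremum of the averages, which costs j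
+ 1 doublings, and the last one is integrated with `lintegral_average_le`. The growth in j is only
the power κ - 1 of a geometric sequence, hence slow when κ is near 1. -/
theorem lintegral_average_rpow_le (H : DoublingPoincare Ω m C₄ C₆)
    {h : EuclideanSpace ℝ (Fin n) → ℝ≥0∞} (hh : Measurable h) {y : EuclideanSpace ℝ (Fin n)}
    {R : ℝ} (hR : 0 < R) (hy : ball y (2 * R) ⊆ Ω) {κ : ℝ} (hκ : 1 ≤ κ) (j : ℕ) :
    ∫⁻ x in ball y R, ((m (ball x (R / 2 ^ j)))⁻¹ * ∫⁻ z in ball x (R / 2 ^ j), h z ∂m) ^ κ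
        ∂((m (ball y R))⁻¹ • m) ≤
      (ENNReal.ofReal C₄ ^ (j + 1)) ^ (κ - 1) * ENNReal.ofReal C₄ *
        (∫⁻ z in ball y (2 * R), h z ∂((m (ball y R))⁻¹ • m)) ^ κ := by
  have hyΩ : y ∈ Ω := hy (mem_ball_self (by positivity))
  set M := m (ball y R) with hM
  set I := ∫⁻ z in ball y (2 * R), h z ∂m with hI
  have hs : 0 < R / 2 ^ j := by positivity
  have hle : R / 2 ^ j ≤ R := div_le_self hR.le (one_le_pow₀ (by norm_num))
  set G : EuclideanSpace ℝ (Fin n) → ℝ≥0∞ :=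
    fun x => (m (ball x (R / 2 ^ j)))⁻¹ * ∫⁻ z in ball x (R / 2 ^ j), h z ∂m with hG
  have hsup : ∀ x ∈ ball y R, G x ≤ ENNReal.ofReal C₄ ^ (j + 1) * (M⁻¹ * I) := by
    intro x hx
    rw [← mul_assoc]
    refine mul_le_mul' (H.inv_measure_ball_le hR (hy (ball_subset_ball (by linarith) hx)) hx j)
      (lintegral_mono_set (ball_subset_ball' ?_))
    rw [mem_ball] at hx; linarith
  have hsplit : ∀ t : ℝ≥0∞, t ^ κ = t ^ (κ - 1) * t := by
    intro t
    conv_rhs => rw [← ENNReal.rpow_one t, ← ENNReal.rpow_mul,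
      ← ENNReal.rpow_add_of_nonneg _ _ (by simpa using hκ) (by norm_num)]
    simp
  rw [Measure.restrict_smul, lintegral_smul_measure, Measure.restrict_smul,
    lintegral_smul_measure, smul_eq_mul, smul_eq_mul]
  set A : ℝ≥0∞ := ENNReal.ofReal C₄ ^ (j + 1) with hA
  calc M⁻¹ * ∫⁻ x in ball y R, G x ^ κ ∂m
      ≤ M⁻¹ * ∫⁻ x in ball y R, (A * (M⁻¹ * I)) ^ (κ - 1) * G x ∂m := by
        gcongr 1
        refine setLIntegral_mono' measurableSet_ball fun x hx => ?_
        rw [hsplit]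
        gcongr
        exact hsup x hx
    _ ≤ M⁻¹ * ((A * (M⁻¹ * I)) ^ (κ - 1) * (ENNReal.ofReal C₄ * I)) := by
        -- Pulling a constant out of a non-measurable integrand needs it finite. If it is infinite
        -- then I ≠ 0, because at I = 0 it would be 0, or 1 when κ = 1; so the right side is
        -- infinite too.
        by_cases htop : (A * (M⁻¹ * I)) ^ (κ - 1) = ⊤
        · rw [htop]
          have hI0 : I ≠ 0 := by
            intro h0
            rw [h0, mul_zero, mul_zero] at htop
            rcases hκ.eq_or_lt with h1 | h1
            · simp [← h1] at htop
            · rw [ENNReal.zero_rpow_of_pos (by linarith)] at htop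
              simp at htop
          rw [ENNReal.top_mul (by simp [H.ofReal_ne_zero, hI0] : ENNReal.ofReal C₄ * I ≠ 0)]
          gcongr
          exact le_top
        · rw [lintegral_const_mul' _ _ htop]
          gcongr 2
          exact lintegral_average_le H hh hs hle hy
    _ = _ := by
        rw [hsplit (M⁻¹ * I), ENNReal.mul_rpow_of_nonneg _ _ (by linarith : (0:ℝ) ≤ κ - 1)]
        ring

/-- The factor 2^(-j) is split in two halves: one sums to a geometric series, the other joins the
square root of `g j`, and each resulting term is bounded by the whole κ-sum. -/
theorem tsum_sqrt_mul_le (κ : ℝ) (hκ : 1 ≤ κ) (a b : ℝ≥0∞) (g : ℕ → ℝ≥0∞) :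
    ∑' j : ℕ, a * (b * 2⁻¹ ^ j * g j ^ (1 / 2 : ℝ)) ≤
      a * b * (∑' j : ℕ, ((2⁻¹ : ℝ≥0∞) ^ (1 / 2 : ℝ)) ^ j) *
        (∑' j : ℕ, (2⁻¹ ^ j * g j) ^ κ) ^ (1 / (2 * κ)) := by
  set S := ∑' j : ℕ, (2⁻¹ ^ j * g j) ^ κ with hS
  have h1 : ∀ j, (2⁻¹ ^ j * g j) ^ (1 / 2 : ℝ) ≤ S ^ (1 / (2 * κ)) := by
    intro j
    have : (2⁻¹ ^ j * g j) ^ (1 / 2 : ℝ) = ((2⁻¹ ^ j * g j) ^ κ) ^ (1 / (2 * κ)) := by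
      rw [← ENNReal.rpow_mul]
      congr 1
      field_simp
    rw [this]
    exact ENNReal.rpow_le_rpow (ENNReal.le_tsum j) (by positivity)
  calc _ ≤ ∑' j : ℕ, (a * b) * (((2⁻¹ : ℝ≥0∞) ^ (1 / 2 : ℝ)) ^ j * S ^ (1 / (2 * κ))) := by
        refine ENNReal.tsum_le_tsum fun j => ?_
        have h2 : (2⁻¹ : ℝ≥0∞) ^ j = ((2⁻¹ : ℝ≥0∞) ^ (1 / 2 : ℝ)) ^ j * (2⁻¹ ^ j) ^ (1 / 2 : ℝ) := by
          rw [← ENNReal.rpow_natCast, ← ENNReal.rpow_natCast, ← ENNReal.rpow_mul,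
            ← ENNReal.rpow_mul, ← ENNReal.rpow_add_of_nonneg _ _ (by positivity) (by positivity)]
          congr 1
          ring
        calc a * (b * 2⁻¹ ^ j * g j ^ (1 / 2 : ℝ))
            = (a * b) * (((2⁻¹ : ℝ≥0∞) ^ (1 / 2 : ℝ)) ^ j *
                (2⁻¹ ^ j * g j) ^ (1 / 2 : ℝ)) := by
              rw [ENNReal.mul_rpow_of_nonneg _ _ (by norm_num)]
              conv_lhs => rw [h2]
              ring
          _ ≤ _ := by gcongr; exact h1 j
    _ = _ := by
        rw [ENNReal.tsum_mul_left, ENNReal.tsum_mul_right]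
        ring

theorem tsum_sqrt_half_ne_top : ∑' j : ℕ, ((2⁻¹ : ℝ≥0∞) ^ (1 / 2 : ℝ)) ^ j ≠ ⊤ := by
  rw [ENNReal.tsum_geometric, ENNReal.inv_ne_top]
  exact (tsub_pos_of_lt (ENNReal.rpow_lt_one (by norm_num) (by norm_num))).ne'

/-- Sobolev inequality for smooth functions. -/
theorem sobolev_smooth (C₄ C₆ κ : ℝ) (hκ : 1 ≤ κ)
    (hκ' : ENNReal.ofReal C₄ ^ (κ - 1) ≤ 2 ^ (1 / 2 : ℝ)) :
    ∃ K : ℝ≥0∞, K ≠ ⊤ ∧ ∀ (Ω : Set (EuclideanSpace ℝ (Fin n)))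
      (m : Measure (EuclideanSpace ℝ (Fin n))), DoublingPoincare Ω m C₄ C₆ →
      ∀ (y : EuclideanSpace ℝ (Fin n)) (R : ℝ), 0 < R → ball y (4 * R) ⊆ Ω →
      ∀ f : EuclideanSpace ℝ (Fin n) → ℝ, ContDiff ℝ ∞ f →
        ∫⁻ X in ball y R, ‖f X‖ₑ ^ (2 * κ) ∂((m (ball y R))⁻¹ • m) ≤
          K * (ENNReal.ofReal R ^ 2 *
              ∫⁻ X in ball y (2 * R), ‖gradient f X‖ₑ ^ 2 ∂((m (ball y R))⁻¹ • m) +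
            (∫⁻ X in ball y (2 * R), ‖f X‖ₑ ∂((m (ball y R))⁻¹ • m)) ^ 2) ^ κ := by
  set c := ENNReal.ofReal C₄ with hc
  set c₀ : ℝ≥0∞ := ∑' j : ℕ, ((2⁻¹ : ℝ≥0∞) ^ (1 / 2 : ℝ)) ^ j with hc₀
  have hc₀t : c₀ ≠ ⊤ := tsum_sqrt_half_ne_top
  have hκ0 : 0 ≤ κ - 1 := by linarith
  have hκp : 0 < κ := by linarith
  have h2κ : 0 ≤ 2 * κ := by linarith
  refine ⟨2 ^ (2 * κ - 1) * (c ^ (2 * κ) + (c * ENNReal.ofReal C₆ * c₀) ^ (2 * κ) *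
    (c * c ^ (κ - 1) * c₀)), ?_, ?_⟩
  · have : (2 : ℝ≥0∞) ^ (2 * κ - 1) ≠ ⊤ := by
      exact ENNReal.rpow_ne_top_of_nonneg (by linarith) (by simp)
    finiteness
  intro Ω m H y R hR hy f hf
  have := H.sfinite
  have hyΩ : y ∈ Ω := hy (mem_ball_self (by positivity))
  set ν := (m (ball y R))⁻¹ • m with hν
  set F := ∫⁻ X in ball y (2 * R), ‖f X‖ₑ ∂ν with hF
  set I := ∫⁻ X in ball y (2 * R), ‖gradient f X‖ₑ ^ 2 ∂ν with hI
  have hν1 : ν (ball y R) ≤ 1 := by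
    rw [hν, Measure.smul_apply, smul_eq_mul]
    exact ENNReal.inv_mul_le_one _
  have hmeas : Measurable fun X => ‖gradient f X‖ₑ ^ 2 :=
    (continuous_gradient hf).measurable.enorm.pow_const 2
  set G : ℕ → EuclideanSpace ℝ (Fin n) → ℝ≥0∞ := fun j x => (m (ball x (R / 2 ^ j)))⁻¹ *
          ∫⁻ X in ball x (R / 2 ^ j), ‖gradient f X‖ₑ ^ 2 ∂m with hG
  have hGm : ∀ j, Measurable (G j) := fun j =>
    (measurable_measure_ball _).inv.mul (measurable_lintegral_ball hmeas _)
  -- The κ-th powers are summed rather than maximised over j, so that S can be integrated term by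
  -- term.
  set S : EuclideanSpace ℝ (Fin n) → ℝ≥0∞ := fun x => ∑' j : ℕ, (2⁻¹ ^ j * G j x) ^ κ with hS
  set r := ENNReal.ofReal R with hr
  have hpt : ∀ x ∈ ball y R, ‖f x‖ₑ ^ (2 * κ) ≤ 2 ^ (2 * κ - 1) *
      ((c * F) ^ (2 * κ) + (c * (ENNReal.ofReal C₆ * r) * c₀) ^ (2 * κ) * S x) := by
    intro x hx
    have hxd := mem_ball.1 hx
    have hxΩ : x ∈ Ω := hy (ball_subset_ball (by linarith) hx)
    have h1 := enorm_le_average_add_tsum H hf hR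
      ((ball_subset_ball' (by linarith)).trans hy : ball x (2 * R) ⊆ Ω)
    have h2 : (m (ball x R))⁻¹ * ∫⁻ X in ball x R, ‖f X‖ₑ ∂m ≤ c * F := by
      rw [hF, hν, Measure.restrict_smul, lintegral_smul_measure, smul_eq_mul, ← mul_assoc]
      refine mul_le_mul' ?_ (lintegral_mono_set (ball_subset_ball' (by linarith)))
      simpa using H.inv_measure_ball_le hR hxΩ hx 0
    have h3 : ∑' j : ℕ, c * (ENNReal.ofReal (C₆ * (R / 2 ^ j)) * G j x ^ (1 / 2 : ℝ)) ≤
        c * (ENNReal.ofReal C₆ * r) * c₀ * S x ^ (1 / (2 * κ)) := by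
      refine le_trans (le_of_eq ?_) (tsum_sqrt_mul_le κ hκ c (ENNReal.ofReal C₆ * r)
        fun j => G j x)
      congr 1 with j
      congr 2
      rw [ENNReal.ofReal_mul H.pos_C₆.le, div_eq_mul_inv, ENNReal.ofReal_mul hR.le, ← mul_assoc]
      congr 1
      rw [← inv_pow, ENNReal.ofReal_pow (by norm_num), ENNReal.ofReal_inv_of_pos (by norm_num)]
      simp
    calc ‖f x‖ₑ ^ (2 * κ) ≤ (c * F +
          c * (ENNReal.ofReal C₆ * r) * c₀ * S x ^ (1 / (2 * κ))) ^ (2 * κ) := by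
          gcongr
          exact h1.trans (add_le_add h2 h3)
      _ ≤ _ := ENNReal.rpow_add_le_mul_rpow_add_rpow _ _ (by linarith)
      _ = _ := by
          rw [ENNReal.mul_rpow_of_nonneg _ (S x ^ _) h2κ, ← ENNReal.rpow_mul,
            one_div_mul_cancel (by positivity), ENNReal.rpow_one]
  have hSint : ∫⁻ x in ball y R, S x ∂ν ≤ c * c ^ (κ - 1) * c₀ * I ^ κ := by
    simp only [hS]
    rw [lintegral_tsum fun j => (((hGm j).const_mul _).pow_const _).aemeasurable]
    rw [hc₀, ← ENNReal.tsum_mul_left, ← ENNReal.tsum_mul_right]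
    refine ENNReal.tsum_le_tsum fun j => ?_
    calc ∫⁻ x in ball y R, (2⁻¹ ^ j * G j x) ^ κ ∂ν
        = (2⁻¹ ^ j) ^ κ * ∫⁻ x in ball y R, (G j x) ^ κ ∂ν := by
          rw [← lintegral_const_mul _ ((hGm j).pow_const _)]
          congr 1 with x
          rw [ENNReal.mul_rpow_of_nonneg _ _ hκp.le]
      _ ≤ (2⁻¹ ^ j) ^ κ * ((c ^ (j + 1)) ^ (κ - 1) * c * I ^ κ) := by
          gcongr
          exact lintegral_average_rpow_le H hmeas hR
            ((ball_subset_ball (by linarith)).trans hy) hκ j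
      _ = c * c ^ (κ - 1) * ((2⁻¹ ^ κ) * c ^ (κ - 1)) ^ j * I ^ κ := by
          have : ∀ (a : ℝ≥0∞) (k : ℕ) (t : ℝ), (a ^ k) ^ t = (a ^ t) ^ k := by
            intro a k t
            rw [← ENNReal.rpow_natCast, ← ENNReal.rpow_mul, mul_comm, ENNReal.rpow_mul,
              ENNReal.rpow_natCast]
          rw [this, this, mul_pow, pow_succ (c ^ (κ - 1))]
          ring
      _ ≤ _ := by
          gcongr
          -- This is where the smallness of κ - 1 enters: the gain 2^(-κ) beats the doubling loss
          -- c^(κ - 1) ≤ 2^(1/2), leaving a ratio 2^(-1/2) < 1.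
          calc (2⁻¹ : ℝ≥0∞) ^ κ * c ^ (κ - 1) ≤ 2⁻¹ ^ (1 : ℝ) * 2 ^ (1 / 2 : ℝ) := by
                refine mul_le_mul' (ENNReal.rpow_le_rpow_of_exponent_ge (by simp) hκ) hκ'
            _ = 2⁻¹ ^ (1 / 2 : ℝ) := by
                rw [ENNReal.inv_rpow, ENNReal.inv_rpow, ← ENNReal.rpow_neg, ← ENNReal.rpow_neg,
                  ← ENNReal.rpow_add _ _ (by simp) (by simp)]
                norm_num
  set T := r ^ 2 * I + F ^ 2 with hT
  have hsq : ∀ t : ℝ≥0∞, t ^ (2 * κ) = (t ^ 2) ^ κ := fun t => by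
    rw [ENNReal.rpow_mul, ENNReal.rpow_two]
  calc ∫⁻ X in ball y R, ‖f X‖ₑ ^ (2 * κ) ∂ν
      ≤ ∫⁻ X in ball y R, 2 ^ (2 * κ - 1) *
      ((c * F) ^ (2 * κ) + (c * (ENNReal.ofReal C₆ * r) * c₀) ^ (2 * κ) * S X) ∂ν :=
        setLIntegral_mono' measurableSet_ball hpt
    _ = 2 ^ (2 * κ - 1) * ((c * F) ^ (2 * κ) * ν (ball y R) +
        (c * (ENNReal.ofReal C₆ * r) * c₀) ^ (2 * κ) * ∫⁻ X in ball y R, S X ∂ν) := by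
        have hSm : Measurable S :=
          Measurable.tsum fun j => ((hGm j).const_mul _).pow_const _
        rw [lintegral_const_mul _ (by fun_prop), lintegral_add_left (by fun_prop),
          setLIntegral_const, lintegral_const_mul _ hSm]
    _ ≤ 2 ^ (2 * κ - 1) * ((c * F) ^ (2 * κ) * 1 +
        (c * (ENNReal.ofReal C₆ * r) * c₀) ^ (2 * κ) * (c * c ^ (κ - 1) * c₀ * I ^ κ)) := by
        gcongr
    _ = 2 ^ (2 * κ - 1) * (c ^ (2 * κ) * (F ^ 2) ^ κ + (c * ENNReal.ofReal C₆ * c₀) ^ (2 * κ) *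
          (c * c ^ (κ - 1) * c₀) * (r ^ 2 * I) ^ κ) := by
        rw [show c * (ENNReal.ofReal C₆ * r) * c₀ = (c * ENNReal.ofReal C₆ * c₀) * r by ring,
          ENNReal.mul_rpow_of_nonneg _ F h2κ, ENNReal.mul_rpow_of_nonneg _ r h2κ,
          ENNReal.mul_rpow_of_nonneg _ I hκp.le, hsq F, hsq r]
        ring
    _ ≤ 2 ^ (2 * κ - 1) * (c ^ (2 * κ) * T ^ κ + (c * ENNReal.ofReal C₆ * c₀) ^ (2 * κ) *
          (c * c ^ (κ - 1) * c₀) * T ^ κ) := by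
        gcongr
        · exact le_add_self
        · exact le_self_add
    _ = _ := by ring

end DegElliptic

/-! ### Limits of smooth functions: chain rule, cut-offs, Sobolev and Poincaré. -/

namespace DegElliptic

variable {n : ℕ} {Ω : Set (EuclideanSpace ℝ (Fin n))} {m μ : Measure (EuclideanSpace ℝ (Fin n))}
  {C₄ C₆ : ℝ}

theorem gradient_comp {Φ : ℝ → ℝ} {f : EuclideanSpace ℝ (Fin n) → ℝ} (hΦ : ContDiff ℝ ∞ Φ)
    (hf : ContDiff ℝ ∞ f) (X : EuclideanSpace ℝ (Fin n)) :
    gradient (fun Y => Φ (f Y)) X = deriv Φ (f X) • gradient f X := by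
  apply HasGradientAt.gradient
  rw [hasGradientAt_iff_hasFDerivAt]
  have h1 := ((hf.differentiable (by simp)) X).hasGradientAt.hasFDerivAt
  have h2 := ((hΦ.differentiable (by simp)) (f X)).hasDerivAt
  refine (h2.comp_hasFDerivAt X h1).congr_fderiv ?_
  ext v
  simp

theorem gradient_mul {η f : EuclideanSpace ℝ (Fin n) → ℝ} (hη : ContDiff ℝ ∞ η)
    (hf : ContDiff ℝ ∞ f) (X : EuclideanSpace ℝ (Fin n)) :
    gradient (fun Y => η Y * f Y) X = η X • gradient f X + f X • gradient η X := by
  apply HasGradientAt.gradient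
  rw [hasGradientAt_iff_hasFDerivAt]
  have h1 := ((hf.differentiable (by simp)) X).hasGradientAt.hasFDerivAt
  have h2 := ((hη.differentiable (by simp)) X).hasGradientAt.hasFDerivAt
  refine (h2.mul h1).congr_fderiv ?_
  ext v
  simp

theorem eLpNorm_two_sq {α F : Type*} [MeasurableSpace α] [NormedAddCommGroup F] {ρ : Measure α}
    (f : α → F) : eLpNorm f 2 ρ ^ 2 = ∫⁻ X, ‖f X‖ₑ ^ 2 ∂ρ := by
  have := eLpNorm_nnreal_pow_eq_lintegral (f := f) (μ := ρ) (p := 2) (by norm_num)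
  simpa using this

theorem tendsto_eLpNorm_two_iff {α F : Type*} [MeasurableSpace α] [NormedAddCommGroup F]
    {ρ : Measure α} (f : ℕ → α → F) :
    Tendsto (fun i => eLpNorm (f i) 2 ρ) atTop (𝓝 0) ↔
      Tendsto (fun i => ∫⁻ X, ‖f i X‖ₑ ^ 2 ∂ρ) atTop (𝓝 0) := by
  simp_rw [← eLpNorm_two_sq]
  constructor
  · intro h
    simpa [Function.comp_def] using (ENNReal.continuous_pow 2).tendsto 0 |>.comp h
  · intro h
    have h2 := (ENNReal.continuous_rpow_const (y := (1 / 2 : ℝ))).tendsto 0 |>.comp h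
    rw [ENNReal.zero_rpow_of_pos (by norm_num)] at h2
    convert h2 using 2 with i
    simp only [Function.comp_apply]
    rw [← ENNReal.rpow_two, ← ENNReal.rpow_mul]
    norm_num

theorem tendsto_eLpNorm_of_tendsto_sub {α F : Type*} [MeasurableSpace α] [NormedAddCommGroup F]
    {ρ : Measure α} {p : ℝ≥0∞} (hp : 1 ≤ p) {f : ℕ → α → F} {g : α → F}
    (hf : ∀ i, AEStronglyMeasurable (f i) ρ) (hg : MemLp g p ρ)
    (h : Tendsto (fun i => eLpNorm (f i - g) p ρ) atTop (𝓝 0)) :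
    Tendsto (fun i => eLpNorm (f i) p ρ) atTop (𝓝 (eLpNorm g p ρ)) := by
  refine tendsto_of_tendsto_of_tendsto_of_le_of_le
    (g := fun i => eLpNorm g p ρ - eLpNorm (f i - g) p ρ)
    (h := fun i => eLpNorm g p ρ + eLpNorm (f i - g) p ρ) ?_ ?_ ?_ ?_
  · simpa using ENNReal.Tendsto.sub tendsto_const_nhds h (Or.inl hg.2.ne)
  · simpa using h.const_add (eLpNorm g p ρ)
  · intro i
    rw [tsub_le_iff_right]
    calc eLpNorm g p ρ = eLpNorm (f i - (f i - g)) p ρ := by congr 1; abel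
      _ ≤ _ := eLpNorm_sub_le (hf i) ((hf i).sub hg.1) hp
  · intro i
    calc eLpNorm (f i) p ρ = eLpNorm (g + (f i - g)) p ρ := by congr 1; abel
      _ ≤ _ := eLpNorm_add_le hg.1 ((hf i).sub hg.1) hp

/-- `f` is a limit of smooth functions in `L¹(μ)` and almost everywhere, with gradients converging
to `g` in `L²(μ)`. -/
structure ApproxPair (μ : Measure (EuclideanSpace ℝ (Fin n))) (f : EuclideanSpace ℝ (Fin n) → ℝ)
    (g : EuclideanSpace ℝ (Fin n) → EuclideanSpace ℝ (Fin n)) : Prop where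
  integrable : Integrable f μ
  memLp : MemLp g 2 μ
  approx : ∃ φ : ℕ → EuclideanSpace ℝ (Fin n) → ℝ, (∀ i, ContDiff ℝ ∞ (φ i)) ∧
    (∀ᵐ X ∂μ, Tendsto (fun i => φ i X) atTop (𝓝 (f X))) ∧
    Tendsto (fun i => eLpNorm (φ i - f) 1 μ) atTop (𝓝 0) ∧
    Tendsto (fun i => eLpNorm (gradient (φ i) - g) 2 μ) atTop (𝓝 0)

/-- Convergence in L¹ gives almost everywhere convergence along a subsequence, so the latter need
not be checked. -/
theorem ApproxPair.of_tendsto {f : EuclideanSpace ℝ (Fin n) → ℝ}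
    {g : EuclideanSpace ℝ (Fin n) → EuclideanSpace ℝ (Fin n)}
    (hf : Integrable f μ) (hg : MemLp g 2 μ) {φ : ℕ → EuclideanSpace ℝ (Fin n) → ℝ}
    (hφ : ∀ i, ContDiff ℝ ∞ (φ i)) (h1 : Tendsto (fun i => eLpNorm (φ i - f) 1 μ) atTop (𝓝 0))
    (h2 : Tendsto (fun i => eLpNorm (gradient (φ i) - g) 2 μ) atTop (𝓝 0)) :
    ApproxPair μ f g := by
  obtain ⟨ns, hns, hae⟩ := (tendstoInMeasure_of_tendsto_eLpNorm one_ne_zero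
    (fun i => (hφ i).continuous.aestronglyMeasurable) hf.aestronglyMeasurable h1).exists_seq_tendsto_ae
  exact ⟨hf, hg, fun i => φ (ns i), fun i => hφ _, hae, h1.comp hns.tendsto_atTop,
    h2.comp hns.tendsto_atTop⟩

/-- Dominated convergence with the majorant (2K)²|g|². -/
theorem tendsto_eLpNorm_two_smul_sub {α F : Type*} [MeasurableSpace α] [NormedAddCommGroup F]
    [NormedSpace ℝ F] {ρ : Measure α} {a : ℕ → α → ℝ} {b : α → ℝ} {g : α → F} {K : ℝ}
    (ha : ∀ i, AEStronglyMeasurable (a i) ρ) (hb : AEStronglyMeasurable b ρ)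
    (haK : ∀ i X, |a i X| ≤ K) (hbK : ∀ᵐ X ∂ρ, |b X| ≤ K)
    (h : ∀ᵐ X ∂ρ, Tendsto (fun i => a i X) atTop (𝓝 (b X))) (hg : MemLp g 2 ρ) :
    Tendsto (fun i => eLpNorm (fun X => (a i X - b X) • g X) 2 ρ) atTop (𝓝 0) := by
  rw [tendsto_eLpNorm_two_iff]
  have h0 : (0 : ℝ≥0∞) = ∫⁻ X, 0 ∂ρ := by simp
  rw [h0]
  refine tendsto_lintegral_of_dominated_convergence'
    (fun X => ENNReal.ofReal (2 * K) ^ 2 * ‖g X‖ₑ ^ 2) ?_ ?_ ?_ ?_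
  · intro i
    exact ((((ha i).sub hb).smul hg.1).enorm).pow_const 2
  · intro i
    filter_upwards [hbK] with X hX
    rw [enorm_smul, mul_pow]
    gcongr
    rw [← ofReal_norm]
    refine ENNReal.ofReal_le_ofReal ?_
    rw [Real.norm_eq_abs]
    calc _ ≤ |a i X| + |b X| := abs_sub _ _
      _ ≤ 2 * K := by linarith [haK i X]
  · rw [lintegral_const_mul' _ _ (by finiteness), ← eLpNorm_two_sq]
    have := hg.2.ne
    finiteness
  · filter_upwards [h] with X hX
    have h1 : Tendsto (fun i => (a i X - b X) • g X) atTop (𝓝 0) := by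
      simpa using (hX.sub_const (b X)).smul_const (g X)
    simpa [Function.comp_def] using ((ENNReal.continuous_pow 2).tendsto _).comp (h1.enorm)

theorem memLp_bounded_smul {α F : Type*} [MeasurableSpace α] [NormedAddCommGroup F]
    [NormedSpace ℝ F] {ρ : Measure α} {b : α → ℝ} {g : α → F} {K : ℝ} {p : ℝ≥0∞}
    (hb : AEStronglyMeasurable b ρ) (hbK : ∀ᵐ X ∂ρ, |b X| ≤ K) (hg : MemLp g p ρ) :
    MemLp (fun X => b X • g X) p ρ := by
  refine (hg.const_smul K).mono (hb.smul hg.1) ?_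
  filter_upwards [hbK] with X hX
  simp only [Pi.smul_apply, norm_smul, Real.norm_eq_abs]
  refine mul_le_mul_of_nonneg_right ?_ (norm_nonneg _)
  exact hX.trans (le_abs_self K)

theorem eLpNorm_bounded_smul_le {α F : Type*} [MeasurableSpace α] [NormedAddCommGroup F]
    [NormedSpace ℝ F] {ρ : Measure α} {b : α → ℝ} {g : α → F} {K : ℝ} {p : ℝ≥0∞}
    (hbK : ∀ X, |b X| ≤ K) :
    eLpNorm (fun X => b X • g X) p ρ ≤ ENNReal.ofReal K * eLpNorm g p ρ := by
  refine eLpNorm_le_mul_eLpNorm_of_ae_le_mul (ae_of_all _ fun X => ?_) p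
  rw [norm_smul, Real.norm_eq_abs]
  gcongr
  exact hbK X

/-- Write Φ'(φᵢ)∇φᵢ - Φ'(f)g as Φ'(φᵢ)(∇φᵢ - g) + (Φ'(φᵢ) - Φ'(f))g. The first term is small because
Φ' is bounded, the second by dominated convergence; this is why almost everywhere convergence is
part of `ApproxPair`. -/
theorem tendsto_gradient_comp {f : EuclideanSpace ℝ (Fin n) → ℝ}
    {g : EuclideanSpace ℝ (Fin n) → EuclideanSpace ℝ (Fin n)} (hfm : AEStronglyMeasurable f μ)
    (hg : MemLp g 2 μ) {φ : ℕ → EuclideanSpace ℝ (Fin n) → ℝ} (hφ : ∀ i, ContDiff ℝ ∞ (φ i))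
    (hae : ∀ᵐ X ∂μ, Tendsto (fun i => φ i X) atTop (𝓝 (f X)))
    (h2 : Tendsto (fun i => eLpNorm (gradient (φ i) - g) 2 μ) atTop (𝓝 0))
    {Φ : ℝ → ℝ} (hΦ : ContDiff ℝ ∞ Φ) {K : ℝ} (hK : ∀ t, |deriv Φ t| ≤ K) :
    Tendsto (fun i => eLpNorm (gradient (fun X => Φ (φ i X)) - fun X => deriv Φ (f X) • g X) 2 μ)
      atTop (𝓝 0) := by
  have hd : Continuous (deriv Φ) := hΦ.continuous_deriv (by simp)
  have h3 := tendsto_eLpNorm_two_smul_sub (a := fun i X => deriv Φ (φ i X))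
    (b := fun X => deriv Φ (f X)) (K := K)
    (fun i => (hd.comp (hφ i).continuous).aestronglyMeasurable)
    (hd.comp_aestronglyMeasurable hfm) (fun i X => hK _) (ae_of_all _ fun X => hK _)
    (by filter_upwards [hae] with X hX; exact (hd.tendsto _).comp hX) hg
  have h0 : Tendsto (fun i => ENNReal.ofReal K * eLpNorm (gradient (φ i) - g) 2 μ +
      eLpNorm (fun X => (deriv Φ (φ i X) - deriv Φ (f X)) • g X) 2 μ) atTop (𝓝 0) := by
    simpa using (ENNReal.Tendsto.const_mul h2
      (Or.inr (by simp : ENNReal.ofReal K ≠ ⊤))).add h3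
  refine tendsto_of_tendsto_of_tendsto_of_le_of_le tendsto_const_nhds h0 (fun i => zero_le) ?_
  intro i
  have heq : gradient (fun X => Φ (φ i X)) - (fun X => deriv Φ (f X) • g X) =
      (fun X => deriv Φ (φ i X) • (gradient (φ i) - g) X) +
        fun X => (deriv Φ (φ i X) - deriv Φ (f X)) • g X := by
    ext1 X
    simp only [Pi.sub_apply, Pi.add_apply, gradient_comp hΦ (hφ i)]
    module
  dsimp only
  rw [heq]
  refine (eLpNorm_add_le ?_ ?_ (by norm_num)).trans ?_
  · exact ((hd.comp (hφ i).continuous).aestronglyMeasurable).smul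
      ((continuous_gradient (hφ i)).aestronglyMeasurable.sub hg.1)
  · exact (((hd.comp (hφ i).continuous).aestronglyMeasurable).sub
      (hd.comp_aestronglyMeasurable hfm)).smul hg.1
  · refine add_le_add ?_ le_rfl
    exact eLpNorm_bounded_smul_le fun X => hK _

theorem abs_sub_le_of_abs_deriv_le {Φ : ℝ → ℝ} (hΦ : ContDiff ℝ ∞ Φ) {K : ℝ}
    (hK : ∀ t, |deriv Φ t| ≤ K) (s t : ℝ) : |Φ s - Φ t| ≤ K * |s - t| := by
  have := Convex.norm_image_sub_le_of_norm_deriv_le (f := Φ) (s := Set.univ) (C := K)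
    (fun x _ => (hΦ.differentiable (by simp)) x) (fun x _ => hK x) convex_univ
    (Set.mem_univ t) (Set.mem_univ s)
  simpa using this

theorem tendsto_eLpNorm_one_comp {f : EuclideanSpace ℝ (Fin n) → ℝ}
    {φ : ℕ → EuclideanSpace ℝ (Fin n) → ℝ}
    (h1 : Tendsto (fun i => eLpNorm (φ i - f) 1 μ) atTop (𝓝 0))
    {Φ : ℝ → ℝ} (hΦ : ContDiff ℝ ∞ Φ) {K : ℝ} (hK : ∀ t, |deriv Φ t| ≤ K) :
    Tendsto (fun i => eLpNorm ((fun X => Φ (φ i X)) - fun X => Φ (f X)) 1 μ) atTop (𝓝 0) := by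
  have h0 : Tendsto (fun i => ENNReal.ofReal K * eLpNorm (φ i - f) 1 μ) atTop (𝓝 0) := by
    simpa using ENNReal.Tendsto.const_mul h1 (Or.inr (by simp : ENNReal.ofReal K ≠ ⊤))
  refine tendsto_of_tendsto_of_tendsto_of_le_of_le tendsto_const_nhds h0 (fun i => zero_le) ?_
  intro i
  exact eLpNorm_le_mul_eLpNorm_of_ae_le_mul
    (ae_of_all _ fun X => abs_sub_le_of_abs_deriv_le hΦ hK _ _) 1

theorem ApproxPair.comp [IsFiniteMeasure μ] {f : EuclideanSpace ℝ (Fin n) → ℝ}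
    {g : EuclideanSpace ℝ (Fin n) → EuclideanSpace ℝ (Fin n)} (H : ApproxPair μ f g)
    {Φ : ℝ → ℝ} (hΦ : ContDiff ℝ ∞ Φ) {K : ℝ} (hK : ∀ t, |deriv Φ t| ≤ K) :
    ApproxPair μ (fun X => Φ (f X)) (fun X => deriv Φ (f X) • g X) := by
  obtain ⟨φ, hφ, hae, h1, h2⟩ := H.approx
  have hd : Continuous (deriv Φ) := hΦ.continuous_deriv (by simp)
  have hfm := H.integrable.aestronglyMeasurable
  have hint : Integrable (fun X => Φ (f X)) μ := by
    refine ((H.integrable.norm.const_mul K).add (integrable_const |Φ 0|)).mono'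
      (hΦ.continuous.comp_aestronglyMeasurable hfm) (ae_of_all _ fun X => ?_)
    have := abs_sub_le_of_abs_deriv_le hΦ hK (f X) 0
    rw [sub_zero] at this
    calc ‖Φ (f X)‖ = |(Φ (f X) - Φ 0) + Φ 0| := by simp
      _ ≤ _ := (abs_add_le _ _).trans (add_le_add this le_rfl)
  refine ⟨hint, memLp_bounded_smul (hd.comp_aestronglyMeasurable hfm) (ae_of_all _ fun X => hK _)
    H.memLp, fun i X => Φ (φ i X), fun i => hΦ.comp (hφ i), ?_,
    tendsto_eLpNorm_one_comp h1 hΦ hK, tendsto_gradient_comp hfm H.memLp hφ hae h2 hΦ hK⟩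
  filter_upwards [hae] with X hX
  exact (hΦ.continuous.tendsto _).comp hX

theorem hasCompactSupport_gradient {η : EuclideanSpace ℝ (Fin n) → ℝ} (hc : HasCompactSupport η) :
    HasCompactSupport (gradient η) := by
  have h := hc.fderiv (𝕜 := ℝ)
  refine h.comp_left (g := (InnerProductSpace.toDual ℝ (EuclideanSpace ℝ (Fin n))).symm) (by simp)

/-- Besides the product rule, the approximants are supported in the support of η. They are therefore
genuine test functions, which makes ηΦ(f) admissible in the weak equation. -/
theorem ApproxPair.cutoff [IsFiniteMeasure μ] {f : EuclideanSpace ℝ (Fin n) → ℝ}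
    {g : EuclideanSpace ℝ (Fin n) → EuclideanSpace ℝ (Fin n)} (H : ApproxPair μ f g)
    {Φ : ℝ → ℝ} (hΦ : ContDiff ℝ ∞ Φ) {K : ℝ} (hK : ∀ t, |Φ t| ≤ K) (hK' : ∀ t, |deriv Φ t| ≤ K)
    {η : EuclideanSpace ℝ (Fin n) → ℝ} (hη : ContDiff ℝ ∞ η) (hc : HasCompactSupport η) :
    MemLp (fun X => η X * Φ (f X)) 1 μ ∧
    MemLp (fun X => (η X * deriv Φ (f X)) • g X + Φ (f X) • gradient η X) 2 μ ∧
    ∃ φ : ℕ → EuclideanSpace ℝ (Fin n) → ℝ, (∀ i, ContDiff ℝ ∞ (φ i)) ∧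
      (∀ i, tsupport (φ i) ⊆ tsupport η) ∧
      Tendsto (fun i => eLpNorm (φ i - fun X => η X * Φ (f X)) 1 μ) atTop (𝓝 0) ∧
      Tendsto (fun i => eLpNorm (gradient (φ i) - fun X => (η X * deriv Φ (f X)) • g X +
        Φ (f X) • gradient η X) 2 μ) atTop (𝓝 0) := by
  obtain ⟨φ, hφ, hae, h1, h2⟩ := H.approx
  have hfm := H.integrable.aestronglyMeasurable
  have H' := H.comp hΦ hK'
  obtain ⟨L, hL⟩ := hc.exists_bound_of_continuous hη.continuous
  simp only [Real.norm_eq_abs] at hL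
  have hgη : MemLp (gradient η) 2 μ :=
    (continuous_gradient hη).memLp_of_hasCompactSupport (hasCompactSupport_gradient hc)
  have hηm : AEStronglyMeasurable η μ := hη.continuous.aestronglyMeasurable
  have hΦm : AEStronglyMeasurable (fun X => Φ (f X)) μ :=
    hΦ.continuous.comp_aestronglyMeasurable hfm
  refine ⟨?_, ?_, fun i X => η X * Φ (φ i X), fun i => hη.mul (hΦ.comp (hφ i)),
    fun i => tsupport_mul_subset_left, ?_, ?_⟩
  · exact memLp_bounded_smul hηm (ae_of_all _ hL) (memLp_one_iff_integrable.2 H'.integrable)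
  · refine MemLp.add ?_ (memLp_bounded_smul hΦm (ae_of_all _ fun X => hK _) hgη)
    simp_rw [mul_smul]
    exact memLp_bounded_smul hηm (ae_of_all _ hL) H'.memLp
  · have h0 := ENNReal.Tendsto.const_mul (tendsto_eLpNorm_one_comp h1 hΦ hK')
      (Or.inr (by simp : ENNReal.ofReal L ≠ ⊤))
    rw [mul_zero] at h0
    refine tendsto_of_tendsto_of_tendsto_of_le_of_le tendsto_const_nhds h0 (fun i => zero_le) ?_
    intro i
    have heq : ((fun X => η X * Φ (φ i X)) - fun X => η X * Φ (f X)) =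
        fun X => η X • ((fun X => Φ (φ i X)) - fun X => Φ (f X)) X := by
      ext1 X
      simp only [Pi.sub_apply, smul_eq_mul]
      ring
    dsimp only
    rw [heq]
    exact eLpNorm_bounded_smul_le hL
  · have h3 := tendsto_eLpNorm_two_smul_sub (a := fun i X => Φ (φ i X)) (b := fun X => Φ (f X))
      (fun i => (hΦ.continuous.comp (hφ i).continuous).aestronglyMeasurable) hΦm
      (fun i X => hK _) (ae_of_all _ fun X => hK _)
      (by filter_upwards [hae] with X hX; exact (hΦ.continuous.tendsto _).comp hX) hgη
    have h0 := (ENNReal.Tendsto.const_mul (tendsto_gradient_comp hfm H.memLp hφ hae h2 hΦ hK')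
      (Or.inr (by simp : ENNReal.ofReal L ≠ ⊤))).add h3
    rw [mul_zero, add_zero] at h0
    refine tendsto_of_tendsto_of_tendsto_of_le_of_le tendsto_const_nhds h0 (fun i => zero_le) ?_
    intro i
    have heq : gradient (fun X => η X * Φ (φ i X)) - (fun X => (η X * deriv Φ (f X)) • g X +
        Φ (f X) • gradient η X) =
        (fun X => η X • (gradient (fun Y => Φ (φ i Y)) - fun Y => deriv Φ (f Y) • g Y) X) +
          fun X => (Φ (φ i X) - Φ (f X)) • gradient η X := by
      ext1 X
      have hgm : gradient (fun X => η X * Φ (φ i X)) X =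
          η X • gradient (fun Y => Φ (φ i Y)) X + Φ (φ i X) • gradient η X :=
        gradient_mul hη (hΦ.comp (hφ i)) X
      simp only [Pi.sub_apply, Pi.add_apply, hgm]
      module
    dsimp only
    rw [heq]
    refine (eLpNorm_add_le ?_ ?_ (by norm_num)).trans ?_
    · exact hηm.smul ((continuous_gradient (hΦ.comp (hφ i))).aestronglyMeasurable.sub H'.memLp.1)
    · exact (((hΦ.continuous.comp (hφ i).continuous).aestronglyMeasurable).sub hΦm).smul hgη.1
    · refine add_le_add ?_ le_rfl
      exact eLpNorm_bounded_smul_le hL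

theorem ApproxPair.mul_comp [IsFiniteMeasure μ] {f : EuclideanSpace ℝ (Fin n) → ℝ}
    {g : EuclideanSpace ℝ (Fin n) → EuclideanSpace ℝ (Fin n)} (H : ApproxPair μ f g)
    {Φ : ℝ → ℝ} (hΦ : ContDiff ℝ ∞ Φ) {K : ℝ} (hK : ∀ t, |Φ t| ≤ K) (hK' : ∀ t, |deriv Φ t| ≤ K)
    {η : EuclideanSpace ℝ (Fin n) → ℝ} (hη : ContDiff ℝ ∞ η) (hc : HasCompactSupport η) :
    ApproxPair μ (fun X => η X * Φ (f X))
      (fun X => (η X * deriv Φ (f X)) • g X + Φ (f X) • gradient η X) := by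
  obtain ⟨h1, h2, φ, hφ, -, h3, h4⟩ := H.cutoff hΦ hK hK' hη hc
  exact .of_tendsto (memLp_one_iff_integrable.1 h1) h2 hφ h3 h4

theorem ApproxPair.mono {f : EuclideanSpace ℝ (Fin n) → ℝ}
    {g : EuclideanSpace ℝ (Fin n) → EuclideanSpace ℝ (Fin n)} {A B : Set (EuclideanSpace ℝ (Fin n))}
    (hAB : A ⊆ B) (H : ApproxPair (m.restrict B) f g) : ApproxPair (m.restrict A) f g := by
  have hle : m.restrict A ≤ m.restrict B := Measure.restrict_mono_set m hAB
  obtain ⟨φ, hφ, hae, h1, h2⟩ := H.approx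
  refine ⟨H.integrable.mono_measure hle, H.memLp.mono_measure hle, φ, hφ, ae_mono hle hae, ?_, ?_⟩
  · exact tendsto_of_tendsto_of_tendsto_of_le_of_le tendsto_const_nhds h1 (fun _ => zero_le)
      fun _ => eLpNorm_mono_measure _ hle
  · exact tendsto_of_tendsto_of_tendsto_of_le_of_le tendsto_const_nhds h2 (fun _ => zero_le)
      fun _ => eLpNorm_mono_measure _ hle

/-- The left side passes to the limit by Fatou, the right side by convergence of the L¹ and L²
norms. -/
theorem sobolev_approxPair {κ : ℝ} {K : ℝ≥0∞} (hK : K ≠ ⊤)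
    {y : EuclideanSpace ℝ (Fin n)} {R : ℝ} (hm : m (ball y R) ≠ 0)
    (hS : ∀ f : EuclideanSpace ℝ (Fin n) → ℝ, ContDiff ℝ ∞ f →
        ∫⁻ X in ball y R, ‖f X‖ₑ ^ (2 * κ) ∂((m (ball y R))⁻¹ • m) ≤
          K * (ENNReal.ofReal R ^ 2 *
              ∫⁻ X in ball y (2 * R), ‖gradient f X‖ₑ ^ 2 ∂((m (ball y R))⁻¹ • m) +
            (∫⁻ X in ball y (2 * R), ‖f X‖ₑ ∂((m (ball y R))⁻¹ • m)) ^ 2) ^ κ)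
    {f : EuclideanSpace ℝ (Fin n) → ℝ}
    {g : EuclideanSpace ℝ (Fin n) → EuclideanSpace ℝ (Fin n)}
    (hR : 0 < R) (H : ApproxPair (m.restrict (ball y (2 * R))) f g) :
    ∫⁻ X in ball y R, ‖f X‖ₑ ^ (2 * κ) ∂((m (ball y R))⁻¹ • m) ≤
      K * (ENNReal.ofReal R ^ 2 *
          ∫⁻ X in ball y (2 * R), ‖g X‖ₑ ^ 2 ∂((m (ball y R))⁻¹ • m) +
        (∫⁻ X in ball y (2 * R), ‖f X‖ₑ ∂((m (ball y R))⁻¹ • m)) ^ 2) ^ κ := by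
  obtain ⟨φ, hφ, hae, h1, h2⟩ := H.approx
  have hMt : (m (ball y R))⁻¹ ≠ ⊤ := ENNReal.inv_ne_top.2 hm
  have h1' := tendsto_eLpNorm_of_tendsto_sub le_rfl
    (fun i => (hφ i).continuous.aestronglyMeasurable)
    (memLp_one_iff_integrable.2 H.integrable) h1
  have h2' := tendsto_eLpNorm_of_tendsto_sub (by norm_num)
    (fun i => (continuous_gradient (hφ i)).aestronglyMeasurable) H.memLp h2
  simp only [Measure.restrict_smul, lintegral_smul_measure, smul_eq_mul] at hS ⊢
  simp_rw [← eLpNorm_one_eq_lintegral_enorm, ← eLpNorm_two_sq] at hS ⊢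
  set M := (m (ball y R))⁻¹ with hM
  have hae' : ∀ᵐ X ∂(m.restrict (ball y R)), Tendsto (fun i => φ i X) atTop (𝓝 (f X)) :=
    ae_mono (Measure.restrict_mono_set m (ball_subset_ball (by linarith))) hae
  have hlim : Tendsto (fun i => K * (ENNReal.ofReal R ^ 2 *
        (M * eLpNorm (gradient (φ i)) 2 (m.restrict (ball y (2 * R))) ^ 2) +
          (M * eLpNorm (φ i) 1 (m.restrict (ball y (2 * R)))) ^ 2) ^ κ) atTop
      (𝓝 (K * (ENNReal.ofReal R ^ 2 * (M * eLpNorm g 2 (m.restrict (ball y (2 * R))) ^ 2) +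
          (M * eLpNorm f 1 (m.restrict (ball y (2 * R)))) ^ 2) ^ κ)) := by
    refine ENNReal.Tendsto.const_mul (((ENNReal.continuous_rpow_const.tendsto _).comp
      (Tendsto.add ?_ ?_))) (Or.inr hK)
    · exact ENNReal.Tendsto.const_mul (ENNReal.Tendsto.const_mul
        (((ENNReal.continuous_pow 2).tendsto _).comp h2') (Or.inr hMt)) (Or.inr (by finiteness))
    · exact ((ENNReal.continuous_pow 2).tendsto _).comp
        (ENNReal.Tendsto.const_mul h1' (Or.inr hMt))
  calc M * ∫⁻ X in ball y R, ‖f X‖ₑ ^ (2 * κ) ∂m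
      = M * ∫⁻ X in ball y R, liminf (fun i => ‖φ i X‖ₑ ^ (2 * κ)) atTop ∂m := by
        congr 1
        refine lintegral_congr_ae ?_
        filter_upwards [hae'] with X hX
        exact (((ENNReal.continuous_rpow_const.tendsto _).comp hX.enorm).liminf_eq).symm
    _ ≤ M * liminf (fun i => ∫⁻ X in ball y R, ‖φ i X‖ₑ ^ (2 * κ) ∂m) atTop := by
        gcongr
        exact lintegral_liminf_le fun i => ((hφ i).continuous.measurable.enorm.pow_const _)
    _ = liminf (fun i => M * ∫⁻ X in ball y R, ‖φ i X‖ₑ ^ (2 * κ) ∂m) atTop := by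
        exact (ENNReal.liminf_const_mul_of_ne_top hMt).symm
    _ ≤ liminf (fun i => K * (ENNReal.ofReal R ^ 2 *
        (M * eLpNorm (gradient (φ i)) 2 (m.restrict (ball y (2 * R))) ^ 2) +
          (M * eLpNorm (φ i) 1 (m.restrict (ball y (2 * R)))) ^ 2) ^ κ) atTop :=
        liminf_le_liminf (Eventually.of_forall fun i => hS _ (hφ i))
    _ = _ := hlim.liminf_eq

theorem poincare_approxPair (H : DoublingPoincare Ω m C₄ C₆) {y : EuclideanSpace ℝ (Fin n)}
    {R : ℝ} (hR : 0 < R) (hy : ball y (2 * R) ⊆ Ω) {f : EuclideanSpace ℝ (Fin n) → ℝ}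
    {g : EuclideanSpace ℝ (Fin n) → EuclideanSpace ℝ (Fin n)}
    (hf : ApproxPair (m.restrict (ball y R)) f g) :
    ∃ c : ℝ, (m (ball y R))⁻¹ * ∫⁻ X in ball y R, ‖f X - c‖ₑ ∂m ≤
      ENNReal.ofReal (C₆ * R) *
        ((m (ball y R))⁻¹ * ∫⁻ X in ball y R, ‖g X‖ₑ ^ 2 ∂m) ^ (1 / 2 : ℝ) := by
  have hyΩ : y ∈ Ω := hy (mem_ball_self (by positivity))
  have hm0 := (H.pos y hyΩ R hR).ne'
  have hmt := (H.lt_top y hyΩ R hR).ne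
  obtain ⟨φ, hφ, -, h1, h2⟩ := hf.approx
  have h2' := tendsto_eLpNorm_of_tendsto_sub (by norm_num)
    (fun i => (continuous_gradient (hφ i)).aestronglyMeasurable) hf.memLp h2
  set M := (m (ball y R))⁻¹ with hM
  have hMt : M ≠ ⊤ := ENNReal.inv_ne_top.2 hm0
  set c := ⨍ X in ball y R, f X ∂m with hc
  refine ⟨c, ?_⟩
  -- The L¹ error counts twice: once for replacing f by φᵢ, once for replacing the average of φᵢ by
  -- that of f.
  have hlim : Tendsto (fun i => 2 * (M * eLpNorm (φ i - f) 1 (m.restrict (ball y R))) +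
      ENNReal.ofReal (C₆ * R) * (M * eLpNorm (gradient (φ i)) 2 (m.restrict (ball y R)) ^ 2) ^
        (1 / 2 : ℝ)) atTop (𝓝 (2 * (M * 0) + ENNReal.ofReal (C₆ * R) *
          (M * eLpNorm g 2 (m.restrict (ball y R)) ^ 2) ^ (1 / 2 : ℝ))) := by
    refine Tendsto.add (ENNReal.Tendsto.const_mul (ENNReal.Tendsto.const_mul h1 (Or.inr hMt))
      (Or.inr (by simp))) (ENNReal.Tendsto.const_mul
      ((ENNReal.continuous_rpow_const.tendsto _).comp ?_) (Or.inr (by simp)))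
    exact ENNReal.Tendsto.const_mul (((ENNReal.continuous_pow 2).tendsto _).comp h2') (Or.inr hMt)
  rw [mul_zero, mul_zero, zero_add] at hlim
  rw [← eLpNorm_two_sq]
  refine ge_of_tendsto' hlim fun i => ?_
  have hint : IntegrableOn (φ i) (ball y R) m :=
    integrableOn_ball_of_continuous (hφ i).continuous y R hmt.lt_top
  have h3 := lintegral_sub_average_le H (hφ i) hR hy
  set ci := ⨍ X in ball y R, φ i X ∂m with hci
  have h4 : ‖ci - c‖ₑ ≤ M * eLpNorm (φ i - f) 1 (m.restrict (ball y R)) := by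
    have h5 := enorm_average_sub_le (f := φ i - f) (hint.sub hf.integrable) hm0 hmt 0
    simp only [sub_zero] at h5
    rw [eLpNorm_one_eq_lintegral_enorm]
    convert h5 using 2
    rw [hci, hc, setAverage_eq, setAverage_eq, setAverage_eq, ← smul_sub,
      ← integral_sub hint hf.integrable]
    rfl
  rw [← eLpNorm_two_sq] at h3
  have hfm := hf.integrable.aestronglyMeasurable
  calc M * ∫⁻ X in ball y R, ‖f X - c‖ₑ ∂m
      ≤ M * ∫⁻ X in ball y R, (‖φ i X - f X‖ₑ + (‖φ i X - ci‖ₑ + ‖ci - c‖ₑ)) ∂m := by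
        gcongr with X
        calc ‖f X - c‖ₑ = ‖-(φ i X - f X) + ((φ i X - ci) + (ci - c))‖ₑ := by congr 1; ring
          _ ≤ _ := (enorm_add_le _ _).trans (by
              rw [enorm_neg]; gcongr; exact enorm_add_le _ _)
    _ = M * eLpNorm (φ i - f) 1 (m.restrict (ball y R)) +
        (M * ∫⁻ X in ball y R, ‖φ i X - ci‖ₑ ∂m + M * (‖ci - c‖ₑ * m (ball y R))) := by
        rw [lintegral_add_right _ (by have := (hφ i).continuous; fun_prop),
          lintegral_add_right _ (by fun_prop), setLIntegral_const,
          eLpNorm_one_eq_lintegral_enorm, mul_add, mul_add]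
        rfl
    _ ≤ M * eLpNorm (φ i - f) 1 (m.restrict (ball y R)) +
        (ENNReal.ofReal (C₆ * R) * (M * eLpNorm (gradient (φ i)) 2 (m.restrict (ball y R)) ^ 2) ^
        (1 / 2 : ℝ) + M * eLpNorm (φ i - f) 1 (m.restrict (ball y R))) := by
        refine add_le_add le_rfl (add_le_add h3 ?_)
        rw [mul_left_comm, ENNReal.inv_mul_cancel hm0 hmt, mul_one]
        exact h4
    _ = _ := by ring

end DegElliptic

namespace DegElliptic

/-! ### Smooth truncations on the line -/

theorem exists_bound_of_continuous_of_const {f : ℝ → ℝ} (hf : Continuous f) {a b : ℝ}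
    (h0 : ∀ s < 0, f s = a) (h1 : ∀ s, 1 < s → f s = b) : ∃ C, 0 < C ∧ ∀ s, |f s| ≤ C := by
  obtain ⟨C, hC⟩ := (isCompact_Icc (a := (0 : ℝ)) (b := 1)).exists_bound_of_continuousOn
    hf.continuousOn
  refine ⟨|a| + |b| + |C| + 1, by positivity, fun s => ?_⟩
  have ha := abs_nonneg a
  have hb := abs_nonneg b
  have hc := abs_nonneg C
  rcases lt_or_ge s 0 with h | h
  · rw [h0 s h]; linarith
  rcases lt_or_ge 1 s with h' | h'
  · rw [h1 s h']; linarith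
  · have := hC s ⟨h, h'⟩
    rw [Real.norm_eq_abs] at this
    linarith [le_abs_self C]

theorem deriv_smoothTransition_of_neg {s : ℝ} (hs : s < 0) :
    deriv Real.smoothTransition s = 0 := by
  have : Real.smoothTransition =ᶠ[𝓝 s] fun _ => 0 := by
    filter_upwards [Iio_mem_nhds hs] with t ht
    exact Real.smoothTransition.zero_of_nonpos (le_of_lt ht)
  rw [this.deriv_eq, deriv_const]

theorem exists_bound_deriv_smoothTransition :
    ∃ C, 0 < C ∧ ∀ s, |deriv Real.smoothTransition s| ≤ C := by
  refine exists_bound_of_continuous_of_const (a := 0) (b := 0)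
    ((Real.smoothTransition.contDiff (n := (⊤ : ℕ∞))).continuous_deriv (by simp))
    (fun s hs => deriv_smoothTransition_of_neg hs) fun s hs => ?_
  have : Real.smoothTransition =ᶠ[𝓝 s] fun _ => 1 := by
    filter_upwards [Ioi_mem_nhds hs] with t ht
    exact Real.smoothTransition.one_of_one_le (le_of_lt ht)
  rw [this.deriv_eq, deriv_const]

/-- A smooth nonnegative function on the line which is `0` on `(-∞, 0]` and the identity on
`[1, ∞)`. -/
noncomputable def smoothPos (s : ℝ) : ℝ := Real.smoothTransition s * s

theorem contDiff_smoothPos : ContDiff ℝ ∞ smoothPos :=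
  Real.smoothTransition.contDiff.mul contDiff_id

theorem smoothPos_nonneg (s : ℝ) : 0 ≤ smoothPos s := by
  rcases le_total s 0 with h | h
  · simp [smoothPos, Real.smoothTransition.zero_of_nonpos h]
  · exact mul_nonneg (Real.smoothTransition.nonneg s) h

theorem smoothPos_of_one_le {s : ℝ} (hs : 1 ≤ s) : smoothPos s = s := by
  simp [smoothPos, Real.smoothTransition.one_of_one_le hs]

theorem exists_bound_deriv_smoothPos : ∃ C, 0 < C ∧ ∀ s, |deriv smoothPos s| ≤ C := by
  refine exists_bound_of_continuous_of_const (a := 0) (b := 1)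
    (contDiff_smoothPos.continuous_deriv (by simp)) (fun s hs => ?_) fun s hs => ?_
  · have : smoothPos =ᶠ[𝓝 s] fun _ => 0 := by
      filter_upwards [Iio_mem_nhds hs] with t ht
      simp [smoothPos, Real.smoothTransition.zero_of_nonpos (le_of_lt ht)]
    rw [this.deriv_eq, deriv_const]
  · have : smoothPos =ᶠ[𝓝 s] id := by
      filter_upwards [Ioi_mem_nhds hs] with t ht
      exact smoothPos_of_one_le (le_of_lt ht)
    rw [this.deriv_eq, deriv_id]

/-- A function which is smooth on `(0, ∞)` agrees on `[ε, ∞)` with a smooth function on the line,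
and bounds on `[ε / 2, ∞)` for the function and its derivative are inherited. -/
theorem exists_smooth_extension {ε : ℝ} (hε : 0 < ε) {h : ℝ → ℝ}
    (hh : ContDiffOn ℝ ∞ h (Set.Ioi 0)) :
    ∃ H : ℝ → ℝ, ContDiff ℝ ∞ H ∧ (∀ K, (∀ t, ε / 2 ≤ t → |h t| ≤ K) → ∀ t, |H t| ≤ K) ∧
      (∀ K, (∀ t, ε / 2 ≤ t → |deriv h t| ≤ K) → ∃ K', ∀ t, |deriv H t| ≤ K') ∧
      ∀ t, ε ≤ t → H t = h t ∧ deriv H t = deriv h t := by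
  -- χ maps the line into [ε/2, ∞) and is the identity on [3ε/4, ∞). Stopping short of ε makes h ∘ χ
  -- agree with h near each t ≥ ε, hence to first order.
  set χ : ℝ → ℝ := fun t => ε / 2 + ε / 4 * smoothPos ((t - ε / 2) * (4 / ε)) with hχ
  have hχs : ContDiff ℝ ∞ χ := by
    refine contDiff_const.add (contDiff_const.mul (contDiff_smoothPos.comp ?_))
    fun_prop
  have hχge : ∀ t, ε / 2 ≤ χ t := fun t => by
    have := smoothPos_nonneg ((t - ε / 2) * (4 / ε))
    simp only [hχ]
    have : 0 ≤ ε / 4 * smoothPos ((t - ε / 2) * (4 / ε)) := by positivity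
    linarith
  have hχpos : ∀ t, 0 < χ t := fun t => lt_of_lt_of_le (by positivity) (hχge t)
  have hχid : ∀ t, 3 * ε / 4 ≤ t → χ t = t := fun t ht => by
    simp only [hχ]
    rw [smoothPos_of_one_le]
    · field_simp; ring
    · rw [← div_le_iff₀ (by positivity)]
      field_simp
      linarith
  have hdh : ∀ t, 0 < t → DifferentiableAt ℝ h t := fun t ht =>
    (hh.contDiffAt (Ioi_mem_nhds ht)).differentiableAt (by simp)
  obtain ⟨C, hC0, hC⟩ := exists_bound_deriv_smoothPos
  have hdχ : ∀ t, |deriv χ t| ≤ C := fun t => by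
    have h1 : HasDerivAt χ (ε / 4 * (deriv smoothPos ((t - ε / 2) * (4 / ε)) * (1 * (4 / ε)))) t := by
      refine HasDerivAt.const_add _ (HasDerivAt.const_mul _ ?_)
      exact HasDerivAt.comp t
        ((contDiff_smoothPos.differentiable (by simp)) _).hasDerivAt
        (((hasDerivAt_id t).sub_const _).mul_const _)
    rw [h1.deriv]
    convert hC ((t - ε / 2) * (4 / ε)) using 2
    field_simp
  refine ⟨fun t => h (χ t), ?_, fun K hK t => hK _ (hχge t), fun K hK => ⟨K * C, fun t => ?_⟩,
    fun t ht => ⟨congrArg h (hχid t (by linarith)), ?_⟩⟩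
  · rw [contDiff_iff_contDiffAt]
    exact fun t => ContDiffAt.comp t (hh.contDiffAt (Ioi_mem_nhds (hχpos t))) hχs.contDiffAt
  · have h1 : HasDerivAt (fun t => h (χ t)) (deriv h (χ t) * deriv χ t) t :=
      HasDerivAt.comp t (hdh _ (hχpos t)).hasDerivAt
        ((hχs.differentiable (by simp)) t).hasDerivAt
    rw [h1.deriv, abs_mul]
    exact mul_le_mul (hK _ (hχge t)) (hdχ t) (abs_nonneg _)
      ((abs_nonneg _).trans (hK _ (hχge t)))
  · refine Filter.EventuallyEq.deriv_eq ?_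
    filter_upwards [Ioi_mem_nhds (show 3 * ε / 4 < t by linarith)] with s hs
    rw [hχid s (le_of_lt hs)]

/-- A bounded increasing regularization of the power `t ^ a`. -/
noncomputable def truncPow (a c t : ℝ) : ℝ := (t ^ (-a) + c)⁻¹

theorem truncPow_zero {a t : ℝ} (ht : 0 < t) : truncPow a 0 t = t ^ a := by
  rw [truncPow, add_zero, Real.rpow_neg ht.le, inv_inv]

theorem truncPow_pos {a c t : ℝ} (hc : 0 ≤ c) (ht : 0 < t) : 0 < truncPow a c t := by
  have := Real.rpow_pos_of_pos ht (-a)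
  unfold truncPow
  positivity

theorem truncPow_le_rpow {a c t : ℝ} (hc : 0 ≤ c) (ht : 0 < t) : truncPow a c t ≤ t ^ a := by
  have := Real.rpow_pos_of_pos ht (-a)
  calc truncPow a c t ≤ (t ^ (-a))⁻¹ := by unfold truncPow; gcongr; linarith
    _ = t ^ a := by rw [Real.rpow_neg ht.le, inv_inv]

/-- The reason for this regularization: h = `truncPow a c` satisfies h²/h' = t^(a+1)/a whatever c
is. In the energy estimate this quotient is the weight in front of |∇η|², so the bound does not see
the truncation. -/
theorem hasDerivAt_truncPow {a c t : ℝ} (hc : 0 ≤ c) (ht : 0 < t) :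
    HasDerivAt (truncPow a c) (a * t ^ (-a - 1) * truncPow a c t ^ 2) t := by
  have := Real.rpow_pos_of_pos ht (-a)
  have h1 : HasDerivAt (fun s : ℝ => s ^ (-a) + c) (-a * t ^ (-a - 1)) t :=
    (Real.hasDerivAt_rpow_const (Or.inl ht.ne')).add_const c
  refine HasDerivAt.congr_deriv (f := truncPow a c) (h1.inv (by positivity)) ?_
  simp only [truncPow, inv_pow]
  ring

theorem contDiffOn_truncPow {a c : ℝ} (hc : 0 ≤ c) : ContDiffOn ℝ ∞ (truncPow a c) (Set.Ioi 0) := by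
  intro t ht
  have := Real.rpow_pos_of_pos ht (-a)
  refine ContDiffAt.contDiffWithinAt ?_
  refine ContDiffAt.inv ?_ (by positivity)
  exact (Real.contDiffAt_rpow_const_of_ne (ne_of_gt ht)).add contDiffAt_const

theorem tendsto_truncPow {a t : ℝ} (ht : 0 < t) :
    Tendsto (fun k : ℕ => truncPow a (1 / ((k : ℝ) + 1)) t) atTop (𝓝 (t ^ a)) := by
  have := Real.rpow_pos_of_pos ht (-a)
  rw [← truncPow_zero ht]
  refine Tendsto.inv₀ ?_ (by positivity)
  exact tendsto_one_div_add_atTop_nhds_zero_nat.const_add _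

/-- The parameters for which `truncPow a c` and its derivative are bounded away from `0`. -/
def TruncAdmissible (a c : ℝ) : Prop := (a < 0 ∧ c = 0) ∨ (0 < a ∧ 0 < c)

theorem TruncAdmissible.nonneg {a c : ℝ} (h : TruncAdmissible a c) : 0 ≤ c := by
  rcases h with h | h <;> linarith [h.2]

theorem exists_smooth_truncPow {a c ε : ℝ} (hac : TruncAdmissible a c) (hε : 0 < ε) :
    ∃ H : ℝ → ℝ, ∃ K : ℝ, ContDiff ℝ ∞ H ∧ (∀ t, |H t| ≤ K) ∧ (∀ t, |deriv H t| ≤ K) ∧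
      ∀ t, ε ≤ t → H t = truncPow a c t ∧
        deriv H t = a * t ^ (-a - 1) * truncPow a c t ^ 2 := by
  have hc := hac.nonneg
  obtain ⟨H, hH, hb, hd, heq⟩ := exists_smooth_extension hε (contDiffOn_truncPow (a := a) hc)
  have hτ : 0 < ε / 2 := by positivity
  have key : ∃ K, (∀ t, ε / 2 ≤ t → |truncPow a c t| ≤ K) ∧
      ∀ t, ε / 2 ≤ t → |deriv (truncPow a c) t| ≤ |a| * K := by
    rcases hac with ⟨ha, rfl⟩ | ⟨ha, hc0⟩
    -- One K has to serve the function and, up to the factor |a|, its derivative; hence a sum of the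
    -- two bounds.
    · refine ⟨(ε / 2) ^ a + (ε / 2) ^ (a - 1), fun t ht => ?_, fun t ht => ?_⟩
      · have ht0 := hτ.trans_le ht
        rw [truncPow_zero ht0, abs_of_pos (by positivity)]
        have := Real.rpow_le_rpow_of_nonpos hτ ht ha.le
        have : 0 < (ε / 2) ^ (a - 1) := by positivity
        linarith
      · have ht0 := hτ.trans_le ht
        rw [(hasDerivAt_truncPow le_rfl ht0).deriv, truncPow_zero ht0, abs_mul, abs_mul, mul_assoc]
        gcongr
        rw [← abs_mul, ← Real.rpow_natCast, ← Real.rpow_mul ht0.le, ← Real.rpow_add ht0,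
          abs_of_pos (by positivity)]
        have := Real.rpow_le_rpow_of_nonpos hτ ht (by linarith : a - 1 ≤ 0)
        have : 0 < (ε / 2) ^ a := by positivity
        have e : -a - 1 + a * (2 : ℕ) = a - 1 := by push_cast; ring
        rw [e]
        linarith
    · have hle : ∀ t, ε / 2 ≤ t → truncPow a c t ≤ c⁻¹ := fun t ht => by
        have ht0 := hτ.trans_le ht
        have := Real.rpow_pos_of_pos ht0 (-a)
        unfold truncPow
        gcongr
        linarith
      have hτp : 0 < (ε / 2) ^ (-a - 1) := by positivity
      refine ⟨c⁻¹ + (ε / 2) ^ (-a - 1) * (c⁻¹) ^ 2, fun t ht => ?_, fun t ht => ?_⟩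
      · have ht0 := hτ.trans_le ht
        rw [abs_of_pos (truncPow_pos hc ht0)]
        have : 0 < (ε / 2) ^ (-a - 1) * (c⁻¹) ^ 2 := by positivity
        linarith [hle t ht]
      · have ht0 := hτ.trans_le ht
        have hp := truncPow_pos (a := a) hc ht0
        rw [(hasDerivAt_truncPow hc ht0).deriv, mul_assoc, abs_mul]
        gcongr
        rw [abs_of_pos (by positivity)]
        have h1 := Real.rpow_le_rpow_of_nonpos hτ ht (by linarith : -a - 1 ≤ 0)
        have h2 := hle t ht
        have : 0 < c⁻¹ := by positivity
        calc t ^ (-a - 1) * truncPow a c t ^ 2 ≤ (ε / 2) ^ (-a - 1) * (c⁻¹) ^ 2 := by gcongr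
          _ ≤ _ := by linarith
  obtain ⟨K, hK1, hK2⟩ := key
  obtain ⟨K', hK'⟩ := hd _ hK2
  refine ⟨H, max K K', hH, fun t => (hb K hK1 t).trans (le_max_left _ _),
    fun t => (hK' t).trans (le_max_right _ _), fun t ht => ⟨(heq t ht).1, ?_⟩⟩
  rw [(heq t ht).2, (hasDerivAt_truncPow hc (hε.trans_le ht)).deriv]

theorem exists_smooth_log {ε : ℝ} (hε : 0 < ε) :
    ∃ H : ℝ → ℝ, ∃ K : ℝ, ContDiff ℝ ∞ H ∧ (∀ t, |deriv H t| ≤ K) ∧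
      ∀ t, ε ≤ t → H t = Real.log t ∧ deriv H t = t⁻¹ := by
  have hs : ContDiffOn ℝ ∞ Real.log (Set.Ioi 0) := fun t ht =>
    (Real.contDiffAt_log.2 (ne_of_gt ht)).contDiffWithinAt
  obtain ⟨H, hH, -, hd, heq⟩ := exists_smooth_extension hε hs
  obtain ⟨K, hK⟩ := hd (ε / 2)⁻¹ fun t ht => by
    have hτ : 0 < ε / 2 := by positivity
    have ht0 := hτ.trans_le ht
    rw [Real.deriv_log, abs_of_pos (by positivity)]
    gcongr
  refine ⟨H, K, hH, hK, fun t ht => ⟨(heq t ht).1, ?_⟩⟩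
  rw [(heq t ht).2, Real.deriv_log]

/-! ### Cut-off functions -/

/-- The profile is a smooth step in |X - y|², which unlike |X - y| is smooth at the centre. The
gradient vanishes on the bounding sphere as well, every zero of η being a minimum. -/
theorem exists_cutoff (n : ℕ) : ∃ L : ℝ, 0 < L ∧ ∀ (y : EuclideanSpace ℝ (Fin n)) (R σ' σ : ℝ),
    0 < R → 1 / 2 ≤ σ' → σ' < σ → ∃ η : EuclideanSpace ℝ (Fin n) → ℝ, ContDiff ℝ ∞ η ∧
      HasCompactSupport η ∧ tsupport η ⊆ closedBall y (σ * R) ∧ (∀ X, 0 ≤ η X) ∧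
      (∀ X, η X ≤ 1) ∧ (∀ X ∈ ball y (σ' * R), η X = 1) ∧ (∀ X, X ∉ ball y (σ * R) → η X = 0) ∧
      (∀ X, X ∉ ball y (σ * R) → gradient η X = 0) ∧
      ∀ X, ‖gradient η X‖ ≤ L / ((σ - σ') * R) := by
  obtain ⟨C, hC0, hC⟩ := exists_bound_deriv_smoothTransition
  refine ⟨2 * C, by positivity, fun y R σ' σ hR hσ' hσ => ?_⟩
  have hσ0 : 0 < σ := by linarith
  set D := (σ ^ 2 - σ' ^ 2) * R ^ 2 with hD
  have hDpos : 0 < D := by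
    have : 0 < σ ^ 2 - σ' ^ 2 := by nlinarith
    positivity
  set Φ : ℝ → ℝ := fun t => Real.smoothTransition ((σ ^ 2 * R ^ 2 - t) / D) with hΦ
  set f : EuclideanSpace ℝ (Fin n) → ℝ := fun X => ‖X - y‖ ^ 2 with hf
  have hΦs : ContDiff ℝ ∞ Φ := Real.smoothTransition.contDiff.comp (by fun_prop)
  have hfs : ContDiff ℝ ∞ f := (contDiff_id.sub contDiff_const).norm_sq ℝ
  have hgf : ∀ X, gradient f X = (2 : ℝ) • (X - y) := fun X => by
    apply HasGradientAt.gradient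
    rw [hasGradientAt_iff_hasFDerivAt]
    refine (((hasFDerivAt_id X).sub_const y).norm_sq).congr_fderiv ?_
    ext v
    simp
  have hdΦ : ∀ t, deriv Φ t = deriv Real.smoothTransition ((σ ^ 2 * R ^ 2 - t) / D) * (-1 / D) := by
    intro t
    have : HasDerivAt Φ (deriv Real.smoothTransition ((σ ^ 2 * R ^ 2 - t) / D) * (-1 / D)) t :=
      HasDerivAt.comp t
        ((Real.smoothTransition.contDiff (n := (⊤ : ℕ∞))).differentiable (by simp) _).hasDerivAt
        (((hasDerivAt_id t).const_sub _).div_const _)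
    exact this.deriv
  have hout : ∀ X, X ∉ ball y (σ * R) → Φ (f X) = 0 := fun X hX => by
    rw [mem_ball, dist_eq_norm, not_lt] at hX
    refine Real.smoothTransition.zero_of_nonpos (div_nonpos_of_nonpos_of_nonneg ?_ hDpos.le)
    have : (σ * R) ^ 2 ≤ ‖X - y‖ ^ 2 := by gcongr
    simp only [hf]
    nlinarith
  have hgr : ∀ X, gradient (fun X => Φ (f X)) X =
      (deriv Real.smoothTransition ((σ ^ 2 * R ^ 2 - f X) / D) * (-1 / D)) • (2 : ℝ) • (X - y) :=
    fun X => by rw [gradient_comp hΦs hfs, hgf, hdΦ]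
  have hout' : ∀ X, X ∉ ball y (σ * R) → gradient (fun X => Φ (f X)) X = 0 := fun X hX => by
    have hmin : IsLocalMin (fun X => Φ (f X)) X := by
      refine Filter.Eventually.of_forall fun Y => ?_
      simp only [hout X hX]
      exact Real.smoothTransition.nonneg _
    rw [gradient, hmin.fderiv_eq_zero, map_zero]
  have hts : tsupport (fun X => Φ (f X)) ⊆ closedBall y (σ * R) := by
    refine closure_minimal (fun X hX => ?_) isClosed_closedBall
    by_contra hX'
    exact hX (hout X fun h => hX' (ball_subset_closedBall h))
  refine ⟨fun X => Φ (f X), hΦs.comp hfs, HasCompactSupport.of_support_subset_isCompact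
    (isCompact_closedBall y (σ * R)) ((subset_tsupport _).trans hts), hts,
    fun X => Real.smoothTransition.nonneg _, fun X => Real.smoothTransition.le_one _,
    fun X hX => ?_, hout, hout', fun X => ?_⟩
  · rw [mem_ball, dist_eq_norm] at hX
    refine Real.smoothTransition.one_of_one_le ?_
    rw [one_le_div hDpos]
    have : ‖X - y‖ ^ 2 ≤ (σ' * R) ^ 2 := by gcongr
    simp only [hf]
    nlinarith
  · have hpos : 0 < (σ - σ') * R := mul_pos (by linarith) hR
    by_cases hX : X ∈ ball y (σ * R)
    · rw [hgr, norm_smul, norm_smul, Real.norm_eq_abs, Real.norm_eq_abs, abs_mul, abs_div,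
        abs_neg, abs_one, abs_of_pos hDpos, abs_two]
      rw [mem_ball, dist_eq_norm] at hX
      calc _ ≤ C * (1 / D) * (2 * (σ * R)) := by gcongr; exact hC _
        -- Factor σ² - σ'² = (σ - σ')(σ + σ') and use σ/(σ + σ') ≤ 1.
        _ ≤ 2 * C / ((σ - σ') * R) := by
            rw [le_div_iff₀ hpos, hD]
            have h1 : 0 < σ + σ' := by linarith
            have h2 : 0 < σ - σ' := by linarith
            have : C * (1 / ((σ ^ 2 - σ' ^ 2) * R ^ 2)) * (2 * (σ * R)) * ((σ - σ') * R) =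
                2 * C * (σ / (σ + σ')) := by
              rw [show σ ^ 2 - σ' ^ 2 = (σ - σ') * (σ + σ') by ring]
              field_simp
            rw [this]
            have : σ / (σ + σ') ≤ 1 := by rw [div_le_one h1]; linarith
            nlinarith
    · rw [hout' X hX, norm_zero]
      positivity

end DegElliptic

/-! ### Energy estimates for powers of a positive solution. -/

namespace DegElliptic

variable {n : ℕ} {Ω : Set (EuclideanSpace ℝ (Fin n))} {m μ : Measure (EuclideanSpace ℝ (Fin n))}
  {C₄ C₆ : ℝ}

theorem eLpNorm_inner_le {V g : EuclideanSpace ℝ (Fin n) → EuclideanSpace ℝ (Fin n)}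
    (hV : AEStronglyMeasurable V μ) (hg : AEStronglyMeasurable g μ) :
    eLpNorm (fun X => inner ℝ (V X) (g X)) 1 μ ≤ eLpNorm V 2 μ * eLpNorm g 2 μ := by
  have := eLpNorm_le_eLpNorm_mul_eLpNorm'_of_norm (p := 2) (q := 2) (r := 1) hV hg
    (fun a b => inner ℝ a b) 1
    (ae_of_all _ fun X => by simpa using norm_inner_le_norm (𝕜 := ℝ) (V X) (g X))
  simpa using this

theorem integrable_inner_of_memLp {V g : EuclideanSpace ℝ (Fin n) → EuclideanSpace ℝ (Fin n)}
    (hV : MemLp V 2 μ) (hg : MemLp g 2 μ) : Integrable (fun X => inner ℝ (V X) (g X)) μ := by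
  rw [← memLp_one_iff_integrable]
  exact ⟨hV.1.inner hg.1, (eLpNorm_inner_le hV.1 hg.1).trans_lt (ENNReal.mul_lt_top hV.2 hg.2)⟩

/-- A positive weak solution on `D`, in terms of the measure `μ`: `G` is the gradient of `u`,
and `V` is the flux `w⁻¹ A G`. -/
structure LocalSolution (μ : Measure (EuclideanSpace ℝ (Fin n)))
    (D : Set (EuclideanSpace ℝ (Fin n))) (Λ ε : ℝ) (u : EuclideanSpace ℝ (Fin n) → ℝ)
    (G V : EuclideanSpace ℝ (Fin n) → EuclideanSpace ℝ (Fin n)) : Prop where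
  pos_Λ : 0 < Λ
  pos_ε : 0 < ε
  pair : ApproxPair μ u G
  memLp : MemLp V 2 μ
  bounded : ∀ᵐ X ∂μ, ‖V X‖ ≤ Λ * ‖G X‖
  elliptic : ∀ᵐ X ∂μ, Λ⁻¹ * ‖G X‖ ^ 2 ≤ inner ℝ (V X) (G X)
  weak : ∀ φ, IsTestFunction D φ → ∫ X, inner ℝ (V X) (gradient φ X) ∂μ = 0
  le_u : ∀ᵐ X ∂μ, ε ≤ u X

variable {D : Set (EuclideanSpace ℝ (Fin n))} {Λ ε : ℝ} {u : EuclideanSpace ℝ (Fin n) → ℝ}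
    {G V : EuclideanSpace ℝ (Fin n) → EuclideanSpace ℝ (Fin n)}

/-- The weak equation holds for smooth approximants of ηH(u), and since V is in L² its pairing with
a gradient is continuous in L². -/
theorem LocalSolution.integral_comp_eq_zero [IsFiniteMeasure μ] (S : LocalSolution μ D Λ ε u G V)
    {H : ℝ → ℝ} (hH : ContDiff ℝ ∞ H) {K : ℝ} (hK : ∀ t, |H t| ≤ K) (hK' : ∀ t, |deriv H t| ≤ K)
    {η : EuclideanSpace ℝ (Fin n) → ℝ} (hη : IsTestFunction D η) :
    Integrable (fun X => inner ℝ (V X) ((η X * deriv H (u X)) • G X + H (u X) • gradient η X)) μ ∧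
    ∫ X, inner ℝ (V X) ((η X * deriv H (u X)) • G X + H (u X) • gradient η X) ∂μ = 0 := by
  obtain ⟨-, hg, φ, hφ, hsupp, -, h4⟩ := S.pair.cutoff hH hK hK' hη.contDiff hη.hasCompactSupport
  set g : EuclideanSpace ℝ (Fin n) → EuclideanSpace ℝ (Fin n) :=
    fun X => (η X * deriv H (u X)) • G X + H (u X) • gradient η X with hgdef
  have hint := integrable_inner_of_memLp S.memLp hg
  refine ⟨hint, ?_⟩
  have htest : ∀ i, IsTestFunction D (φ i) := fun i => ⟨hφ i,
    HasCompactSupport.of_support_subset_isCompact hη.hasCompactSupport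
      ((subset_tsupport _).trans (hsupp i)), (hsupp i).trans hη.tsupport_subset⟩
  have hgφ : ∀ i, MemLp (gradient (φ i)) 2 μ := fun i =>
    (continuous_gradient (hφ i)).memLp_of_hasCompactSupport
      (hasCompactSupport_gradient (htest i).hasCompactSupport)
  have hlim : Tendsto (fun i => eLpNorm V 2 μ * eLpNorm (gradient (φ i) - g) 2 μ) atTop (𝓝 0) := by
    simpa using ENNReal.Tendsto.const_mul h4 (Or.inr S.memLp.2.ne)
  have hle : ∀ i, ‖∫ X, inner ℝ (V X) (g X) ∂μ‖ₑ ≤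
      eLpNorm V 2 μ * eLpNorm (gradient (φ i) - g) 2 μ := by
    intro i
    have h5 : ∫ X, inner ℝ (V X) (g X) ∂μ =
        - ∫ X, inner ℝ (V X) ((gradient (φ i) - g) X) ∂μ := by
      simp only [Pi.sub_apply, inner_sub_right]
      rw [integral_sub (integrable_inner_of_memLp S.memLp (hgφ i)) hint, S.weak _ (htest i)]
      ring
    rw [h5, enorm_neg]
    refine (enorm_integral_le_lintegral_enorm _).trans ?_
    rw [← eLpNorm_one_eq_lintegral_enorm]
    exact eLpNorm_inner_le S.memLp.1 ((hgφ i).1.sub hg.1)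
  have := ge_of_tendsto' hlim hle
  simpa using this

theorem IsTestFunction.sq {η : EuclideanSpace ℝ (Fin n) → ℝ} (hη : IsTestFunction D η) :
    IsTestFunction D (fun X => η X * η X) :=
  ⟨hη.contDiff.mul hη.contDiff, hη.hasCompactSupport.mul_right,
    tsupport_mul_subset_left.trans hη.tsupport_subset⟩

/-- Test with η²h(u), where h = `truncPow a c`. By h' = a t^(-a-1) h² and u^(-a-1) u^(a+1) = 1,
Young's inequality absorbs the cross term into half of the elliptic term and leaves the weight
u^(a+1), free of c. This c-independence permits c → 0 afterwards. -/
theorem LocalSolution.energy_truncPow [IsFiniteMeasure μ] (S : LocalSolution μ D Λ ε u G V)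
    {a c : ℝ} (hac : TruncAdmissible a c)
    {η : EuclideanSpace ℝ (Fin n) → ℝ} (hη : IsTestFunction D η) :
    ∫⁻ X, ENNReal.ofReal (η X ^ 2 * (u X ^ (-a - 1) * truncPow a c (u X) ^ 2) * ‖G X‖ ^ 2) ∂μ ≤
      ENNReal.ofReal (4 * Λ ^ 4 / a ^ 2) *
        ∫⁻ X, ENNReal.ofReal (u X ^ (a + 1) * ‖gradient η X‖ ^ 2) ∂μ := by
  have ha : a ≠ 0 := by rcases hac with h | h <;> [exact h.1.ne; exact h.1.ne']
  have hΛ := S.pos_Λ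
  have hum := S.pair.integrable.aestronglyMeasurable
  by_cases htop : ∫⁻ X, ENNReal.ofReal (u X ^ (a + 1) * ‖gradient η X‖ ^ 2) ∂μ = ⊤
  · rw [htop, ENNReal.mul_top]
    · exact le_top
    · simp only [ne_eq, ENNReal.ofReal_eq_zero, not_le]
      positivity
  obtain ⟨H, K, hH, hK, hK', hHeq⟩ := exists_smooth_truncPow hac S.pos_ε
  obtain ⟨hI, hI0⟩ := S.integral_comp_eq_zero hH hK hK' hη.sq
  have hgη := (continuous_gradient hη.contDiff).aestronglyMeasurable (μ := μ)
  have hηm : AEStronglyMeasurable η μ := hη.contDiff.continuous.aestronglyMeasurable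
  set x2 : EuclideanSpace ℝ (Fin n) → ℝ :=
    fun X => η X ^ 2 * (u X ^ (-a - 1) * truncPow a c (u X) ^ 2) * ‖G X‖ ^ 2 with hx2
  set y2 : EuclideanSpace ℝ (Fin n) → ℝ := fun X => u X ^ (a + 1) * ‖gradient η X‖ ^ 2 with hy2
  have hy0 : ∀ᵐ X ∂μ, 0 ≤ y2 X := by
    filter_upwards [S.le_u] with X hX
    have := S.pos_ε.trans_le hX
    positivity
  have hx0 : ∀ᵐ X ∂μ, 0 ≤ x2 X := by
    filter_upwards [S.le_u] with X hX
    have := S.pos_ε.trans_le hX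
    positivity
  have hy : Integrable y2 μ := by
    refine ⟨?_, ?_⟩
    · exact ((hum.aemeasurable.pow_const _).mul (hgη.norm.aemeasurable.pow_const _)).aestronglyMeasurable
    · rw [hasFiniteIntegral_iff_ofReal hy0]
      exact lt_top_iff_ne_top.2 htop
  obtain ⟨L, hL⟩ := hη.hasCompactSupport.exists_bound_of_continuous hη.contDiff.continuous
  have hG2 : Integrable (fun X => ‖G X‖ ^ 2) μ := S.pair.memLp.integrable_norm_pow (by norm_num)
  have hx : Integrable x2 μ := by
    refine (hG2.const_mul (L ^ 2 * (|a|⁻¹ * K))).mono' ?_ ?_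
    · refine AEMeasurable.aestronglyMeasurable ?_
      refine ((hηm.aemeasurable.pow_const _).mul ((hum.aemeasurable.pow_const _).mul
        (AEMeasurable.pow_const ?_ _))).mul (S.pair.memLp.1.norm.aemeasurable.pow_const _)
      exact ((hum.aemeasurable.pow_const _).add_const _).inv
    · filter_upwards [S.le_u, hx0] with X hX hX0
      rw [Real.norm_eq_abs, abs_of_nonneg hX0]
      have hupos := S.pos_ε.trans_le hX
      simp only [hx2]
      have h1 : η X ^ 2 ≤ L ^ 2 := by
        have := hL X
        rw [Real.norm_eq_abs] at this
        exact sq_le_sq' (by linarith [neg_abs_le (η X)]) (by linarith [le_abs_self (η X)])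
      have h2 : u X ^ (-a - 1) * truncPow a c (u X) ^ 2 ≤ |a|⁻¹ * K := by
        have := hK' (u X)
        rw [(hHeq _ hX).2, mul_assoc, abs_mul, abs_of_nonneg
          (by positivity : 0 ≤ u X ^ (-a - 1) * truncPow a c (u X) ^ 2)] at this
        rwa [← div_eq_inv_mul, le_div_iff₀ (abs_pos.2 ha), mul_comm]
      gcongr
  -- Multiplying by a makes the elliptic term a²/Λ, positive for either sign of a. Young takes half
  -- of it and leaves 2Λ³ on the other side, whence the final ratio 4Λ⁴/a².
  have hkey : ∀ᵐ X ∂μ, a ^ 2 / (2 * Λ) * x2 X - 2 * Λ ^ 3 * y2 X ≤ a * inner ℝ (V X)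
      ((η X * η X * deriv H (u X)) • G X + H (u X) • gradient (fun X => η X * η X) X) := by
    filter_upwards [S.le_u, S.bounded, S.elliptic] with X hX hb he
    have hu := S.pos_ε.trans_le hX
    set t := u X with ht
    set h := truncPow a c t with hh
    have hhp : 0 < h := truncPow_pos hac.nonneg hu
    rw [gradient_mul hη.contDiff hη.contDiff, (hHeq _ hX).1, (hHeq _ hX).2, inner_add_right,
      inner_smul_right, inner_smul_right, inner_add_right, inner_smul_right]
    have hk : t ^ (-a - 1) * t ^ (a + 1) = 1 := by
      rw [← Real.rpow_add hu]; simp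
    have hk1 : 0 < t ^ (-a - 1) := by positivity
    have hk2 : 0 < t ^ (a + 1) := by positivity
    set k := t ^ (-a - 1) with hkdef
    set l := t ^ (a + 1) with hldef
    simp only [hx2, hy2, ← ht, ← hh, ← hkdef, ← hldef]
    have hcs : |inner ℝ (V X) (gradient η X)| ≤ Λ * ‖G X‖ * ‖gradient η X‖ :=
      (abs_real_inner_le_norm _ _).trans (by gcongr)
    set p := ‖G X‖ with hp
    set q := ‖gradient η X‖ with hq
    set I1 := inner ℝ (V X) (G X)
    set I2 := inner ℝ (V X) (gradient η X)
    have e1 : a ^ 2 * (η X ^ 2 * (k * h ^ 2)) * (Λ⁻¹ * p ^ 2) ≤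
        a ^ 2 * (η X ^ 2 * (k * h ^ 2)) * I1 := by gcongr
    have e2 : -(2 * (|a| * |η X|) * h * (Λ * p * q)) ≤ 2 * (a * η X) * h * I2 := by
      have : |2 * (a * η X) * h * I2| ≤ 2 * (|a| * |η X|) * h * (Λ * p * q) := by
        rw [abs_mul, abs_mul, abs_mul, abs_mul, abs_two, abs_of_pos hhp]
        gcongr
      linarith [neg_abs_le (2 * (a * η X) * h * I2)]
    have e3 : 2 * (|a| * |η X|) * h * (Λ * p * q) ≤
        a ^ 2 / (2 * Λ) * (η X ^ 2 * (k * h ^ 2) * p ^ 2) + 2 * Λ ^ 3 * (l * q ^ 2) := by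
      -- The cross term is the mixed product in a square whose two weights √k and √l multiply to 1.
      have hsk := Real.sq_sqrt hk1.le
      have hsl := Real.sq_sqrt hk2.le
      have hskl : √k * √l = 1 := by rw [← Real.sqrt_mul hk1.le, hk, Real.sqrt_one]
      have key := sq_nonneg (|a| * |η X| * √k * h * p - 2 * Λ ^ 2 * (√l * q))
      have e4 : (|a| * |η X| * √k * h * p - 2 * Λ ^ 2 * (√l * q)) ^ 2 =
          a ^ 2 * (η X ^ 2 * (√k ^ 2 * h ^ 2) * p ^ 2) -
            4 * Λ ^ 2 * (√k * √l) * (|a| * |η X|) * h * p * q + 4 * Λ ^ 4 * (√l ^ 2 * q ^ 2) := by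
        rw [← sq_abs a, ← sq_abs (η X)]; ring
      rw [e4, hsk, hsl, hskl] at key
      have : 0 ≤ (2 * Λ)⁻¹ := by positivity
      have := mul_nonneg this key
      have e5 : (2 * Λ)⁻¹ * (a ^ 2 * (η X ^ 2 * (k * h ^ 2) * p ^ 2) -
            4 * Λ ^ 2 * 1 * (|a| * |η X|) * h * p * q + 4 * Λ ^ 4 * (l * q ^ 2)) =
          a ^ 2 / (2 * Λ) * (η X ^ 2 * (k * h ^ 2) * p ^ 2) + 2 * Λ ^ 3 * (l * q ^ 2) -
            2 * (|a| * |η X|) * h * (Λ * p * q) := by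
        field_simp
        ring
      linarith
    have e6 : a ^ 2 * (η X ^ 2 * (k * h ^ 2)) * (Λ⁻¹ * p ^ 2) =
        2 * (a ^ 2 / (2 * Λ) * (η X ^ 2 * (k * h ^ 2) * p ^ 2)) := by
      field_simp
    have e7 : a * (η X * η X * (a * k * h ^ 2) * I1 + h * (η X * I2 + η X * I2)) =
        a ^ 2 * (η X ^ 2 * (k * h ^ 2)) * I1 + 2 * (a * η X) * h * I2 := by ring
    rw [e7]
    linarith
  have hfin := integral_mono_ae ((hx.const_mul _).sub (hy.const_mul _)) (hI.const_mul a) hkey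
  have e8 : ∫ X, (a ^ 2 / (2 * Λ) * x2 X - 2 * Λ ^ 3 * y2 X) ∂μ =
      a ^ 2 / (2 * Λ) * ∫ X, x2 X ∂μ - 2 * Λ ^ 3 * ∫ X, y2 X ∂μ := by
    rw [integral_sub (hx.const_mul _) (hy.const_mul _), integral_const_mul, integral_const_mul]
  have e9 : a ^ 2 / (2 * Λ) * ∫ X, x2 X ∂μ - 2 * Λ ^ 3 * ∫ X, y2 X ∂μ ≤ 0 := by
    rw [← e8]
    refine hfin.trans (le_of_eq ?_)
    rw [integral_const_mul, hI0, mul_zero]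
  have e10 : ∫ X, x2 X ∂μ ≤ 4 * Λ ^ 4 / a ^ 2 * ∫ X, y2 X ∂μ := by
    have ha2 : 0 < a ^ 2 := by positivity
    have h1 : a ^ 2 / (2 * Λ) * ∫ X, x2 X ∂μ ≤ 2 * Λ ^ 3 * ∫ X, y2 X ∂μ := by linarith
    rw [div_mul_eq_mul_div, div_le_iff₀ (by positivity)] at h1
    rw [div_mul_eq_mul_div, le_div_iff₀ ha2]
    linarith
  rw [← ofReal_integral_eq_lintegral_ofReal hx hx0, ← ofReal_integral_eq_lintegral_ofReal hy hy0,
    ← ENNReal.ofReal_mul (by positivity)]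
  exact ENNReal.ofReal_le_ofReal e10

/-- Caccioppoli inequality for powers of a positive solution. -/
theorem LocalSolution.caccioppoli [IsFiniteMeasure μ] (S : LocalSolution μ D Λ ε u G V)
    {p : ℝ} (hp : p ≠ 1) {η : EuclideanSpace ℝ (Fin n) → ℝ} (hη : IsTestFunction D η) :
    ∫⁻ X, ENNReal.ofReal (η X ^ 2 * u X ^ (p - 2) * ‖G X‖ ^ 2) ∂μ ≤
      ENNReal.ofReal (4 * Λ ^ 4 / (p - 1) ^ 2) *
        ∫⁻ X, ENNReal.ofReal (u X ^ p * ‖gradient η X‖ ^ 2) ∂μ := by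
  have hexp : ∀ t : ℝ, 0 < t → t ^ (-(p - 1) - 1) * (t ^ (p - 1)) ^ 2 = t ^ (p - 2) := by
    intro t ht
    rw [← Real.rpow_natCast, ← Real.rpow_mul ht.le, ← Real.rpow_add ht]
    congr 1
    push_cast
    ring
  have hum := S.pair.integrable.aestronglyMeasurable.aemeasurable
  rcases lt_or_gt_of_ne hp with h | h
  -- A negative power of u ≥ ε is already bounded, so no truncation is needed for p < 1. For p > 1
  -- the truncation is removed by Fatou along c = 1/(k + 1).
  · have := S.energy_truncPow (a := p - 1) (c := 0) (Or.inl ⟨by linarith, rfl⟩) hη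
    rw [sub_add_cancel] at this
    refine le_trans (le_of_eq (lintegral_congr_ae ?_)) this
    filter_upwards [S.le_u] with X hX
    have hu := S.pos_ε.trans_le hX
    rw [truncPow_zero hu, hexp _ hu]
  · have hk := fun k : ℕ => S.energy_truncPow (a := p - 1) (c := 1 / ((k : ℝ) + 1))
      (Or.inr ⟨by linarith, by positivity⟩) hη
    simp only [sub_add_cancel] at hk
    calc _ = ∫⁻ X, liminf (fun k : ℕ => ENNReal.ofReal (η X ^ 2 * (u X ^ (-(p - 1) - 1) *
          truncPow (p - 1) (1 / ((k : ℝ) + 1)) (u X) ^ 2) * ‖G X‖ ^ 2)) atTop ∂μ := by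
          refine lintegral_congr_ae ?_
          filter_upwards [S.le_u] with X hX
          have hu := S.pos_ε.trans_le hX
          rw [← hexp _ hu]
          refine (Tendsto.liminf_eq ?_).symm
          refine ENNReal.tendsto_ofReal (Tendsto.mul_const _ (Tendsto.const_mul _
            (Tendsto.const_mul _ ((tendsto_truncPow hu).pow 2))))
      _ ≤ liminf (fun k : ℕ => ∫⁻ X, ENNReal.ofReal (η X ^ 2 * (u X ^ (-(p - 1) - 1) *
          truncPow (p - 1) (1 / ((k : ℝ) + 1)) (u X) ^ 2) * ‖G X‖ ^ 2) ∂μ) atTop := by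
          refine lintegral_liminf_le' fun k => ?_
          refine ENNReal.measurable_ofReal.comp_aemeasurable ?_
          refine ((hη.contDiff.continuous.measurable.aemeasurable.pow_const _).mul
            ((hum.pow_const _).mul (AEMeasurable.pow_const ?_ _))).mul
            (S.pair.memLp.1.norm.aemeasurable.pow_const _)
          exact ((hum.pow_const _).add_const _).inv
      _ ≤ liminf (fun _ : ℕ => ENNReal.ofReal (4 * Λ ^ 4 / (p - 1) ^ 2) *
        ∫⁻ X, ENNReal.ofReal (u X ^ p * ‖gradient η X‖ ^ 2) ∂μ) atTop :=
          liminf_le_liminf (Eventually.of_forall hk)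
      _ = _ := by simp

end DegElliptic

/-! ### One Moser step: from the exponent p to κp. -/

namespace DegElliptic

variable {n : ℕ} {Ω : Set (EuclideanSpace ℝ (Fin n))} {m μ : Measure (EuclideanSpace ℝ (Fin n))}
  {C₄ C₆ : ℝ} {D : Set (EuclideanSpace ℝ (Fin n))} {Λ ε : ℝ} {u : EuclideanSpace ℝ (Fin n) → ℝ}
  {G V : EuclideanSpace ℝ (Fin n) → EuclideanSpace ℝ (Fin n)}

theorem sq_lintegral_enorm_le {α : Type*} [MeasurableSpace α] {ρ : Measure α} {f : α → ℝ}
    (hf : AEStronglyMeasurable f ρ) (h1 : ρ Set.univ ≤ 1) :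
    (∫⁻ X, ‖f X‖ₑ ∂ρ) ^ 2 ≤ ∫⁻ X, ‖f X‖ₑ ^ 2 ∂ρ := by
  rw [← eLpNorm_one_eq_lintegral_enorm, ← eLpNorm_two_sq]
  gcongr
  refine (eLpNorm_le_eLpNorm_mul_rpow_measure_univ (p := 1) (q := 2) (by norm_num) hf).trans ?_
  exact mul_le_of_le_one_right' (ENNReal.rpow_le_one h1 (by norm_num))

theorem ae_smul_restrict {P : EuclideanSpace ℝ (Fin n) → Prop}
    {A B : Set (EuclideanSpace ℝ (Fin n))} (hAB : A ⊆ B) (c : ℝ≥0∞)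
    (h : ∀ᵐ X ∂(m.restrict B), P X) : ∀ᵐ X ∂((c • m).restrict A), P X := by
  rw [Measure.restrict_smul]
  exact Measure.ae_smul_measure (ae_mono (Measure.restrict_mono_set m hAB) h) c

/-- The constant in the energy estimate for the power `u ^ (p / 2)`. -/
noncomputable def moserConst (Λ L p : ℝ) : ℝ :=
  (2 * Λ ^ 4 * (p ^ 2 / (p - 1) ^ 2) + 2) * L ^ 2 + 1

set_option maxHeartbeats 1000000 in
-- Sobolev is applied to η·`truncPow (p / 2) c`(u), whose gradient is controlled by Caccioppoli for
-- the exponent p. For p > 0 the truncation is needed because u^(p/2) itself is not known to be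
-- approximable; the resulting bound does not involve c.
theorem LocalSolution.moser_step_trunc {y : EuclideanSpace ℝ (Fin n)} {R : ℝ} (hR : 0 < R)
    (hm0 : m (ball y R) ≠ 0) (hmt : m (ball y (2 * R)) < ⊤)
    (S : LocalSolution (m.restrict (ball y (2 * R))) (ball y (2 * R)) Λ ε u G V)
    {κ : ℝ} {K : ℝ≥0∞} (hκ : 1 ≤ κ) (hK : K ≠ ⊤)
    (hS : ∀ f : EuclideanSpace ℝ (Fin n) → ℝ, ContDiff ℝ ∞ f →
        ∫⁻ X in ball y R, ‖f X‖ₑ ^ (2 * κ) ∂((m (ball y R))⁻¹ • m) ≤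
          K * (ENNReal.ofReal R ^ 2 *
              ∫⁻ X in ball y (2 * R), ‖gradient f X‖ₑ ^ 2 ∂((m (ball y R))⁻¹ • m) +
            (∫⁻ X in ball y (2 * R), ‖f X‖ₑ ∂((m (ball y R))⁻¹ • m)) ^ 2) ^ κ)
    {L σ' σ : ℝ} (hL : 0 < L) (hσ' : 1 / 2 ≤ σ') (hσ : σ' < σ) (hσ1 : σ ≤ 1)
    {η : EuclideanSpace ℝ (Fin n) → ℝ} (hη : ContDiff ℝ ∞ η) (hηc : HasCompactSupport η)
    (hηs : tsupport η ⊆ closedBall y (σ * R)) (hη0 : ∀ X, 0 ≤ η X) (hη1 : ∀ X, η X ≤ 1)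
    (hηin : ∀ X ∈ ball y (σ' * R), η X = 1) (hηout : ∀ X, X ∉ ball y (σ * R) → η X = 0)
    (hηout' : ∀ X, X ∉ ball y (σ * R) → gradient η X = 0)
    (hηL : ∀ X, ‖gradient η X‖ ≤ L / ((σ - σ') * R))
    {p c : ℝ} (hp1 : p ≠ 1) (hac : TruncAdmissible (p / 2) c) :
    ∫⁻ X in ball y (σ' * R), ENNReal.ofReal (truncPow (p / 2) c (u X) ^ (2 * κ))
        ∂((m (ball y R))⁻¹ • m) ≤
      K * (ENNReal.ofReal (moserConst Λ L p / (σ - σ') ^ 2) *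
        ∫⁻ X in ball y (σ * R), ENNReal.ofReal (u X ^ p) ∂((m (ball y R))⁻¹ • m)) ^ κ := by
  have hfin : IsFiniteMeasure (m.restrict (ball y (2 * R))) := ⟨by simpa using hmt⟩
  have hδ : 0 < σ - σ' := by linarith
  have hσR : σ * R ≤ R := by nlinarith
  have hσR' : σ' * R ≤ σ * R := by nlinarith
  set a := p / 2 with ha
  have hc := hac.nonneg
  obtain ⟨Φ, K₁, hΦ, hK₁, hK₁', hΦeq⟩ := exists_smooth_truncPow hac S.pos_ε
  have hηT : IsTestFunction (ball y (2 * R)) η := ⟨hη, hηc,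
    hηs.trans (closedBall_subset_ball (by linarith))⟩
  have hpair := S.pair.mul_comp hΦ hK₁ hK₁' hη hηc
  have hsob := sobolev_approxPair hK hm0 hS hR hpair
  set ν := (m (ball y R))⁻¹ • m with hν
  have hum := S.pair.integrable.aestronglyMeasurable.aemeasurable
  have hgη := (continuous_gradient hη).measurable
  have hrpow : ∀ t : ℝ, 0 < t → (t ^ a) ^ 2 = t ^ p := fun t ht => by
    rw [← Real.rpow_natCast, ← Real.rpow_mul ht.le, ha]
    congr 1
    push_cast
    ring
  -- integrals over the large ball against `m`
  set Y := ∫⁻ X in ball y (2 * R), ENNReal.ofReal (u X ^ p * ‖gradient η X‖ ^ 2) ∂m with hY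
  have hYle : Y ≤ ENNReal.ofReal ((L / ((σ - σ') * R)) ^ 2) *
      ∫⁻ X in ball y (σ * R), ENNReal.ofReal (u X ^ p) ∂m := by
    have hsub : ball y (σ * R) ⊆ ball y (2 * R) := ball_subset_ball (by linarith)
    calc Y ≤ ∫⁻ X in ball y (2 * R), (ball y (σ * R)).indicator (fun X =>
          ENNReal.ofReal ((L / ((σ - σ') * R)) ^ 2) * ENNReal.ofReal (u X ^ p)) X ∂m := by
          refine lintegral_mono_ae ?_
          filter_upwards [S.le_u] with X hX
          have hu := S.pos_ε.trans_le hX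
          by_cases hXσ : X ∈ ball y (σ * R)
          · rw [Set.indicator_of_mem hXσ, ← ENNReal.ofReal_mul (by positivity), mul_comm]
            refine ENNReal.ofReal_le_ofReal ?_
            gcongr
            exact hηL X
          · rw [hηout' X hXσ]
            simp
      _ = ∫⁻ X in ball y (σ * R), ENNReal.ofReal ((L / ((σ - σ') * R)) ^ 2) *
            ENNReal.ofReal (u X ^ p) ∂m := by
          rw [lintegral_indicator measurableSet_ball, Measure.restrict_restrict measurableSet_ball,
            Set.inter_eq_left.2 hsub]
      _ = _ := lintegral_const_mul' _ _ (by finiteness)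
  have hg : ∫⁻ X in ball y (2 * R), ‖(η X * deriv Φ (u X)) • G X + Φ (u X) • gradient η X‖ₑ ^ 2 ∂m ≤
      ENNReal.ofReal (2 * Λ ^ 4 * (p ^ 2 / (p - 1) ^ 2) + 2) * Y := by
    calc _ ≤ ∫⁻ X in ball y (2 * R), (ENNReal.ofReal (p ^ 2 / 2) *
          ENNReal.ofReal (η X ^ 2 * u X ^ (p - 2) * ‖G X‖ ^ 2) +
          ENNReal.ofReal 2 * ENNReal.ofReal (u X ^ p * ‖gradient η X‖ ^ 2)) ∂m := by
          refine lintegral_mono_ae ?_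
          filter_upwards [S.le_u] with X hX
          have hu := S.pos_ε.trans_le hX
          rw [← ENNReal.ofReal_mul (by positivity), ← ENNReal.ofReal_mul (by positivity),
            ← ENNReal.ofReal_add (by positivity) (by positivity), ← ofReal_norm,
            ← ENNReal.ofReal_pow (norm_nonneg _)]
          refine ENNReal.ofReal_le_ofReal ?_
          have hh := truncPow_le_rpow (a := a) hc hu
          have hh0 := truncPow_pos (a := a) hc hu
          rw [(hΦeq _ hX).1, (hΦeq _ hX).2]
          set t := u X
          set h := truncPow a c t
          -- With a = p/2 and h ≤ t^a, the truncated derivative is at most that of the pure power,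
          -- (p/2) t^(p/2 - 1), in absolute value.
          have e1 : (a * t ^ (-a - 1) * h ^ 2) ^ 2 ≤ p ^ 2 / 4 * t ^ (p - 2) := by
            have : t ^ (p - 2) = (t ^ (-a - 1) * (t ^ a) ^ 2) ^ 2 := by
              rw [hrpow t hu, ← Real.rpow_add hu, ← Real.rpow_natCast, ← Real.rpow_mul hu.le]
              congr 1
              push_cast
              rw [ha]
              ring
            rw [this]
            calc (a * t ^ (-a - 1) * h ^ 2) ^ 2 = p ^ 2 / 4 * (t ^ (-a - 1) * h ^ 2) ^ 2 := by
                  rw [ha]; ring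
              _ ≤ _ := by gcongr
          have e2 : h ^ 2 ≤ t ^ p := by rw [← hrpow t hu]; gcongr
          calc ‖(η X * (a * t ^ (-a - 1) * h ^ 2)) • G X + h • gradient η X‖ ^ 2
              ≤ (‖(η X * (a * t ^ (-a - 1) * h ^ 2)) • G X‖ + ‖h • gradient η X‖) ^ 2 := by
                gcongr; exact norm_add_le _ _
            _ ≤ 2 * (‖(η X * (a * t ^ (-a - 1) * h ^ 2)) • G X‖ ^ 2 + ‖h • gradient η X‖ ^ 2) :=
                add_sq_le
            _ = 2 * (η X ^ 2 * (a * t ^ (-a - 1) * h ^ 2) ^ 2 * ‖G X‖ ^ 2) +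
                2 * (h ^ 2 * ‖gradient η X‖ ^ 2) := by
                rw [norm_smul, norm_smul, mul_pow, mul_pow, Real.norm_eq_abs, Real.norm_eq_abs,
                  sq_abs, sq_abs]
                ring
            _ ≤ 2 * (η X ^ 2 * (p ^ 2 / 4 * t ^ (p - 2)) * ‖G X‖ ^ 2) +
                2 * (t ^ p * ‖gradient η X‖ ^ 2) := by gcongr
            _ = _ := by ring
      _ = ENNReal.ofReal (p ^ 2 / 2) * ∫⁻ X in ball y (2 * R),
            ENNReal.ofReal (η X ^ 2 * u X ^ (p - 2) * ‖G X‖ ^ 2) ∂m + ENNReal.ofReal 2 * Y := by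
          rw [lintegral_add_right', lintegral_const_mul' _ _ (by finiteness),
            lintegral_const_mul' _ _ (by finiteness)]
          exact ((((hum.pow_const _).mul (hgη.norm.aemeasurable.pow_const _))).ennreal_ofReal).const_mul _
      _ ≤ ENNReal.ofReal (p ^ 2 / 2) * (ENNReal.ofReal (4 * Λ ^ 4 / (p - 1) ^ 2) * Y) +
            ENNReal.ofReal 2 * Y := by
          gcongr
          exact S.caccioppoli hp1 hηT
      _ = _ := by
          rw [← mul_assoc, ← ENNReal.ofReal_mul (by positivity), ← add_mul,
            ← ENNReal.ofReal_add (by positivity) (by norm_num)]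
          congr 3
          ring
  set A := ∫⁻ X in ball y (σ * R), ENNReal.ofReal (u X ^ p) ∂ν with hA
  have hAm : A = (m (ball y R))⁻¹ * ∫⁻ X in ball y (σ * R), ENNReal.ofReal (u X ^ p) ∂m := by
    rw [hA, hν, Measure.restrict_smul, lintegral_smul_measure, smul_eq_mul]
  have hgν : ENNReal.ofReal R ^ 2 * ∫⁻ X in ball y (2 * R),
      ‖(η X * deriv Φ (u X)) • G X + Φ (u X) • gradient η X‖ₑ ^ 2 ∂ν ≤
      ENNReal.ofReal ((2 * Λ ^ 4 * (p ^ 2 / (p - 1) ^ 2) + 2) * L ^ 2 / (σ - σ') ^ 2) * A := by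
    rw [hν, Measure.restrict_smul, lintegral_smul_measure, smul_eq_mul, hAm]
    calc _ ≤ ENNReal.ofReal R ^ 2 * ((m (ball y R))⁻¹ *
          (ENNReal.ofReal (2 * Λ ^ 4 * (p ^ 2 / (p - 1) ^ 2) + 2) *
          (ENNReal.ofReal ((L / ((σ - σ') * R)) ^ 2) *
            ∫⁻ X in ball y (σ * R), ENNReal.ofReal (u X ^ p) ∂m))) := by
          gcongr
          exact hg.trans (by gcongr)
      _ = (ENNReal.ofReal R ^ 2 * (ENNReal.ofReal (2 * Λ ^ 4 * (p ^ 2 / (p - 1) ^ 2) + 2) *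
          ENNReal.ofReal ((L / ((σ - σ') * R)) ^ 2))) * ((m (ball y R))⁻¹ *
            ∫⁻ X in ball y (σ * R), ENNReal.ofReal (u X ^ p) ∂m) := by ring
      _ = _ := by
          rw [← ENNReal.ofReal_pow hR.le, ← ENNReal.ofReal_mul (by positivity),
            ← ENNReal.ofReal_mul (by positivity)]
          congr 2
          field_simp
  -- The L¹ term of Sobolev is handled by Cauchy–Schwarz, the normalized measure of the support
  -- being at most 1; the factor 1/(σ - σ')² ≥ 1 only puts it in the form of the gradient term.
  have hfν : (∫⁻ X in ball y (2 * R), ‖η X * Φ (u X)‖ₑ ∂ν) ^ 2 ≤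
      ENNReal.ofReal (1 / (σ - σ') ^ 2) * A := by
    have hsub : ball y (σ * R) ⊆ ball y (2 * R) := ball_subset_ball (by linarith)
    have h1 : ∫⁻ X in ball y (2 * R), ‖η X * Φ (u X)‖ₑ ∂ν =
        ∫⁻ X in ball y (σ * R), ‖η X * Φ (u X)‖ₑ ∂ν := by
      calc _ = ∫⁻ X in ball y (2 * R), (ball y (σ * R)).indicator
            (fun X => ‖η X * Φ (u X)‖ₑ) X ∂ν := by
            refine lintegral_congr fun X => ?_
            by_cases hXσ : X ∈ ball y (σ * R)
            · rw [Set.indicator_of_mem hXσ]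
            · rw [Set.indicator_of_notMem hXσ, hηout X hXσ]
              simp
        _ = _ := by
            rw [lintegral_indicator measurableSet_ball, Measure.restrict_restrict measurableSet_ball,
              Set.inter_eq_left.2 hsub]
    rw [h1]
    refine (sq_lintegral_enorm_le ?_ ?_).trans ?_
    · have h2 := (hpair.integrable.aestronglyMeasurable.mono_measure
        (Measure.restrict_mono_set m hsub)).smul_measure (m (ball y R))⁻¹
      rwa [← Measure.restrict_smul] at h2
    · rw [Measure.restrict_apply_univ, hν, Measure.smul_apply, smul_eq_mul]
      exact (mul_le_mul_right (measure_mono (ball_subset_ball hσR)) _).trans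
        (ENNReal.inv_mul_le_one _)
    · calc _ ≤ A := by
            refine lintegral_mono_ae (ae_smul_restrict hsub _ ?_)
            filter_upwards [S.le_u] with X hX
            have hu := S.pos_ε.trans_le hX
            have hh := truncPow_le_rpow (a := a) hc hu
            have hh0 := truncPow_pos (a := a) hc hu
            rw [(hΦeq _ hX).1, ← ofReal_norm, ← ENNReal.ofReal_pow (norm_nonneg _)]
            refine ENNReal.ofReal_le_ofReal ?_
            rw [Real.norm_eq_abs, sq_abs, mul_pow, ← hrpow _ hu]
            have h2 : η X ^ 2 ≤ 1 := pow_le_one₀ (hη0 X) (hη1 X)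
            have h3 : truncPow a c (u X) ^ 2 ≤ (u X ^ a) ^ 2 := by gcongr
            calc _ ≤ 1 * (u X ^ a) ^ 2 := by gcongr
              _ = _ := one_mul _
        _ = 1 * A := (one_mul _).symm
        _ ≤ _ := by
            gcongr
            rw [ENNReal.one_le_ofReal, le_div_iff₀ (by positivity)]
            nlinarith
  calc ∫⁻ X in ball y (σ' * R), ENNReal.ofReal (truncPow a c (u X) ^ (2 * κ)) ∂ν
      = ∫⁻ X in ball y (σ' * R), ‖η X * Φ (u X)‖ₑ ^ (2 * κ) ∂ν := by
        refine lintegral_congr_ae ?_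
        filter_upwards [ae_smul_restrict (ball_subset_ball (by linarith) :
          ball y (σ' * R) ⊆ ball y (2 * R)) _ S.le_u, ae_restrict_mem measurableSet_ball]
          with X hX hXσ
        have hu := S.pos_ε.trans_le hX
        have hh0 := truncPow_pos (a := a) hc hu
        rw [hηin X hXσ, one_mul, (hΦeq _ hX).1, Real.enorm_eq_ofReal hh0.le,
          ENNReal.ofReal_rpow_of_pos hh0]
    _ ≤ ∫⁻ X in ball y R, ‖η X * Φ (u X)‖ₑ ^ (2 * κ) ∂ν :=
        lintegral_mono_set (ball_subset_ball (by linarith))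
    _ ≤ _ := hsob
    _ ≤ K * (ENNReal.ofReal ((2 * Λ ^ 4 * (p ^ 2 / (p - 1) ^ 2) + 2) * L ^ 2 / (σ - σ') ^ 2) * A +
          ENNReal.ofReal (1 / (σ - σ') ^ 2) * A) ^ κ := by gcongr
    _ = _ := by
        rw [← add_mul, ← ENNReal.ofReal_add (by positivity) (by positivity), ← add_div, moserConst]

/-- For p < 0 the truncated step with c = 0 is already the claim; for p > 0 let c → 0 by Fatou. -/
theorem LocalSolution.moser_step {y : EuclideanSpace ℝ (Fin n)} {R : ℝ} (hR : 0 < R)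
    (hm0 : m (ball y R) ≠ 0) (hmt : m (ball y (2 * R)) < ⊤)
    (S : LocalSolution (m.restrict (ball y (2 * R))) (ball y (2 * R)) Λ ε u G V)
    {κ : ℝ} {K : ℝ≥0∞} (hκ : 1 ≤ κ) (hK : K ≠ ⊤)
    (hS : ∀ f : EuclideanSpace ℝ (Fin n) → ℝ, ContDiff ℝ ∞ f →
        ∫⁻ X in ball y R, ‖f X‖ₑ ^ (2 * κ) ∂((m (ball y R))⁻¹ • m) ≤
          K * (ENNReal.ofReal R ^ 2 *
              ∫⁻ X in ball y (2 * R), ‖gradient f X‖ₑ ^ 2 ∂((m (ball y R))⁻¹ • m) +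
            (∫⁻ X in ball y (2 * R), ‖f X‖ₑ ∂((m (ball y R))⁻¹ • m)) ^ 2) ^ κ)
    {L : ℝ} (hL : 0 < L) (hcut : ∀ (y : EuclideanSpace ℝ (Fin n)) (R σ' σ : ℝ),
      0 < R → 1 / 2 ≤ σ' → σ' < σ → ∃ η : EuclideanSpace ℝ (Fin n) → ℝ, ContDiff ℝ ∞ η ∧
      HasCompactSupport η ∧ tsupport η ⊆ closedBall y (σ * R) ∧ (∀ X, 0 ≤ η X) ∧
      (∀ X, η X ≤ 1) ∧ (∀ X ∈ ball y (σ' * R), η X = 1) ∧ (∀ X, X ∉ ball y (σ * R) → η X = 0) ∧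
      (∀ X, X ∉ ball y (σ * R) → gradient η X = 0) ∧
      ∀ X, ‖gradient η X‖ ≤ L / ((σ - σ') * R))
    {σ' σ : ℝ} (hσ' : 1 / 2 ≤ σ') (hσ : σ' < σ) (hσ1 : σ ≤ 1) {p : ℝ} (hp0 : p ≠ 0) (hp1 : p ≠ 1) :
    ∫⁻ X in ball y (σ' * R), ENNReal.ofReal (u X ^ (p * κ)) ∂((m (ball y R))⁻¹ • m) ≤
      K * (ENNReal.ofReal (moserConst Λ L p / (σ - σ') ^ 2) *
        ∫⁻ X in ball y (σ * R), ENNReal.ofReal (u X ^ p) ∂((m (ball y R))⁻¹ • m)) ^ κ := by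
  obtain ⟨η, h1, h2, h3, h4, h5, h6, h7, h8, h9⟩ := hcut y R σ' σ hR hσ' hσ
  have key := fun c (hac : TruncAdmissible (p / 2) c) => S.moser_step_trunc hR hm0 hmt hκ hK hS hL
    hσ' hσ hσ1 h1 h2 h3 h4 h5 h6 h7 h8 h9 hp1 hac
  have hσR : σ' * R ≤ 2 * R := by nlinarith
  have hexp : ∀ t : ℝ, 0 < t → (t ^ (p / 2)) ^ (2 * κ) = t ^ (p * κ) := fun t ht => by
    rw [← Real.rpow_mul ht.le]; congr 1; ring
  have hu := ae_smul_restrict (ball_subset_ball hσR : ball y (σ' * R) ⊆ ball y (2 * R))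
    (m (ball y R))⁻¹ S.le_u
  rcases lt_or_gt_of_ne hp0 with h | h
  · refine le_trans (le_of_eq (lintegral_congr_ae ?_)) (key 0 (Or.inl ⟨by linarith, rfl⟩))
    filter_upwards [hu] with X hX
    have hu := S.pos_ε.trans_le hX
    rw [truncPow_zero hu, hexp _ hu]
  · have hum : AEMeasurable u (((m (ball y R))⁻¹ • m).restrict (ball y (σ' * R))) := by
      rw [Measure.restrict_smul]
      exact ((S.pair.integrable.aestronglyMeasurable.aemeasurable).mono_measure
        (Measure.restrict_mono_set m (ball_subset_ball hσR))).smul_measure _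
    have hk := fun k : ℕ => key (1 / ((k : ℝ) + 1)) (Or.inr ⟨by linarith, by positivity⟩)
    set ν := (m (ball y R))⁻¹ • m with hν
    calc _ = ∫⁻ X in ball y (σ' * R), liminf (fun k : ℕ => ENNReal.ofReal
          (truncPow (p / 2) (1 / ((k : ℝ) + 1)) (u X) ^ (2 * κ))) atTop ∂ν := by
          refine lintegral_congr_ae ?_
          filter_upwards [hu] with X hX
          have hu := S.pos_ε.trans_le hX
          rw [← hexp _ hu]
          refine (Tendsto.liminf_eq ?_).symm
          exact ENNReal.tendsto_ofReal ((tendsto_truncPow hu).rpow_const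
            (Or.inr (by linarith)))
      _ ≤ liminf (fun k : ℕ => ∫⁻ X in ball y (σ' * R), ENNReal.ofReal
          (truncPow (p / 2) (1 / ((k : ℝ) + 1)) (u X) ^ (2 * κ)) ∂ν) atTop := by
          refine lintegral_liminf_le' fun k => ?_
          exact (((hum.pow_const _).add_const _).inv.pow_const _).ennreal_ofReal
      _ ≤ liminf (fun _ : ℕ => K * (ENNReal.ofReal (moserConst Λ L p / (σ - σ') ^ 2) *
        ∫⁻ X in ball y (σ * R), ENNReal.ofReal (u X ^ p) ∂ν) ^ κ) atTop :=
          liminf_le_liminf (Eventually.of_forall hk)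
      _ = _ := by simp

end DegElliptic

/-! ### Abstract Moser iteration and the choice of exponents. -/

namespace DegElliptic

/-- For each level l > B, Chebyshev bounds the measure of {f ≥ l} by (B/l)^(κ^k), which tends to 0
with k. No finiteness of the measure is needed. -/
theorem ae_le_of_lintegral_rpow_le {α : Type*} [MeasurableSpace α] {ρ : Measure α}
    {f : α → ℝ≥0∞} (hf : AEMeasurable f ρ) {B : ℝ≥0∞} {κ : ℝ} (hκ : 1 < κ)
    (h : ∀ k : ℕ, ∫⁻ X, f X ^ (κ ^ k) ∂ρ ≤ B ^ (κ ^ k)) : ∀ᵐ X ∂ρ, f X ≤ B := by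
  rcases eq_or_ne B ⊤ with rfl | hB
  · simp
  obtain ⟨l, -, hl, hlim⟩ := exists_seq_strictAnti_tendsto' hB.lt_top
  have hn : ∀ n, ∀ᵐ X ∂ρ, f X ≤ l n := by
    intro n
    have hl1 := (hl n).1
    have hl2 := (hl n).2.ne
    have hl0 : l n ≠ 0 := (zero_le.trans_lt hl1).ne'
    have hx : B / l n < 1 := by
      rw [ENNReal.div_lt_iff (Or.inl hl0) (Or.inl hl2), one_mul]
      exact hl1
    have hj : ∀ j : ℕ, ρ {X | l n ≤ f X} ≤ (B / l n) ^ j := by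
      intro j
      obtain ⟨k, hk⟩ := pow_unbounded_of_one_lt (j : ℝ) hκ
      have hκk : 0 < κ ^ k := by positivity
      have h1 := mul_meas_ge_le_lintegral₀ (hf.pow_const (κ ^ k)) (l n ^ (κ ^ k))
      have hset : {X | l n ^ (κ ^ k) ≤ f X ^ (κ ^ k)} = {X | l n ≤ f X} := by
        ext X
        exact ENNReal.rpow_le_rpow_iff hκk
      rw [hset] at h1
      have h2 := h1.trans (h k)
      calc ρ {X | l n ≤ f X} ≤ B ^ (κ ^ k) / l n ^ (κ ^ k) := by
            rw [ENNReal.le_div_iff_mul_le (Or.inl (by simp [hl0, hl2]))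
              (Or.inl (ENNReal.rpow_ne_top_of_nonneg hκk.le hl2)), mul_comm]
            exact h2
        _ = (B / l n) ^ (κ ^ k) := (ENNReal.div_rpow_of_nonneg _ _ hκk.le).symm
        _ ≤ (B / l n) ^ (j : ℝ) := ENNReal.rpow_le_rpow_of_exponent_ge hx.le hk.le
        _ = _ := ENNReal.rpow_natCast _ _
    have h0 : ρ {X | l n ≤ f X} = 0 :=
      le_antisymm (ge_of_tendsto' (ENNReal.tendsto_pow_atTop_nhds_zero_of_lt_one hx) hj) zero_le
    rw [measure_eq_zero_iff_ae_notMem] at h0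
    filter_upwards [h0] with X hX
    exact (not_le.1 hX).le
  filter_upwards [ae_all_iff.2 hn] with X hX
  exact ge_of_tendsto' hlim hX

/-- Along radii shrinking like 2^(-k) the integrals of f^(κ^k) obey A(k+1) ≤ (Q 4^k A(k))^κ.
Unwinding raises Q to Σ κ^(-j) and 4 to Σ j κ^(-j), both convergent. The constants precede the
measure space, sets and function, so they apply to all powers of u at once. -/
theorem moser_iteration {κ : ℝ} (hκ : 1 < κ) {K N : ℝ≥0∞} (hK : K ≠ ⊤) (hN : N ≠ ⊤) :
    ∃ (C : ℝ≥0∞) (γ : ℕ), C ≠ ⊤ ∧ ∀ {α : Type} [MeasurableSpace α] (ν : Measure α) (U : ℝ → Set α)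
      (f : α → ℝ≥0∞), (∀ σ' σ : ℝ, σ' ≤ σ → U σ' ⊆ U σ) → AEMeasurable f (ν.restrict (U 1)) →
      (∀ (k : ℕ) (σ' σ : ℝ), 1 / 2 ≤ σ' → σ' < σ → σ ≤ 1 →
        ∫⁻ X in U σ', f X ^ (κ ^ (k + 1)) ∂ν ≤
          K * (N * ENNReal.ofReal (1 / (σ - σ')) ^ 2 * ∫⁻ X in U σ, f X ^ (κ ^ k) ∂ν) ^ κ) →
      ∀ σ' σ : ℝ, 1 / 2 ≤ σ' → σ' < σ → σ ≤ 1 →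
        ∀ᵐ X ∂(ν.restrict (U σ')), f X ≤ C * ENNReal.ofReal (1 / (σ - σ')) ^ γ *
          ∫⁻ X in U σ, f X ∂ν := by
  have hκ0 : 0 < κ := by linarith
  have hgeo : Summable fun j : ℕ => (κ⁻¹) ^ j :=
    summable_geometric_of_lt_one (by positivity) (inv_lt_one_of_one_lt₀ hκ)
  have hgeo' : Summable fun j : ℕ => (j : ℝ) * (κ⁻¹) ^ j := by
    have := summable_pow_mul_geometric_of_norm_lt_one (R := ℝ) 1 (r := κ⁻¹)
      (by rw [Real.norm_eq_abs, abs_of_pos (by positivity)]; exact inv_lt_one_of_one_lt₀ hκ)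
    simpa using this
  set T := ∑' j : ℕ, (j : ℝ) * (κ⁻¹) ^ j with hT
  -- Rounding the exponent up to an integer gives a natural power of 1/(σ - σ'); enlarging it is
  -- allowed since Q ≥ 1, which the maxima with 1 below ensure.
  obtain ⟨S, hS⟩ := exists_nat_ge (∑' j : ℕ, (κ⁻¹) ^ j)
  set Q₀ : ℝ≥0∞ := max 1 K * max 1 N * 4 with hQ₀
  have hmK : max 1 K ≠ ⊤ := by simp [hK]
  have hmN : max 1 N ≠ ⊤ := by simp [hN]
  refine ⟨Q₀ ^ S * 4 ^ T, 2 * S, ?_, ?_⟩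
  · have : (4 : ℝ≥0∞) ^ T ≠ ⊤ := ENNReal.rpow_ne_top_of_nonneg
      (tsum_nonneg fun j => by positivity) (by simp)
    finiteness
  intro α _ ν U f hU hf hstep σ' σ hσ' hσ hσ1
  set δ := σ - σ' with hδ
  have hδ0 : 0 < δ := by linarith
  set Dd := ENNReal.ofReal (1 / δ) with hDd
  have hD1 : 1 ≤ Dd := by
    rw [hDd, ENNReal.one_le_ofReal, le_div_iff₀ hδ0]
    linarith
  set Q := Q₀ * Dd ^ 2 with hQ
  have hQ1 : 1 ≤ Q := by
    have : (1 : ℝ≥0∞) ≤ Q₀ := by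
      calc (1 : ℝ≥0∞) = 1 * 1 * 1 := by norm_num
        _ ≤ _ := by
          rw [hQ₀]
          gcongr
          · exact le_max_left _ _
          · exact le_max_left _ _
          · norm_num
    exact one_le_mul this (one_le_pow₀ hD1)
  set s : ℕ → ℝ := fun k => σ' + δ / 2 ^ k with hs
  set A : ℕ → ℝ≥0∞ := fun k => ∫⁻ X in U (s k), f X ^ (κ ^ k) ∂ν with hA
  have hA0 : A 0 = ∫⁻ X in U σ, f X ∂ν := by simp [hA, hs, hδ]
  have hrec : ∀ k, A (k + 1) ≤ (Q * 4 ^ k * A k) ^ κ := by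
    intro k
    have hp : (0 : ℝ) < δ / 2 ^ k := by positivity
    have e1 : s k - s (k + 1) = δ / (2 ^ k * 2) := by
      simp only [hs, pow_succ]
      field_simp
      ring
    have hlt : s (k + 1) < s k := by
      have : 0 < δ / (2 ^ k * 2) := by positivity
      linarith
    have hle : s k ≤ 1 := by
      have : δ / 2 ^ k ≤ δ := div_le_self hδ0.le (one_le_pow₀ (by norm_num))
      simp only [hs]
      linarith
    have h1 := hstep k (s (k + 1)) (s k)
      (by simp only [hs]; have : 0 < δ / 2 ^ (k + 1) := by positivity
          linarith) hlt hle
    refine h1.trans ?_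
    have hK' : K ≤ (max 1 K) ^ κ := by
      calc K ≤ max 1 K := le_max_right _ _
        _ = (max 1 K) ^ (1 : ℝ) := (ENNReal.rpow_one _).symm
        _ ≤ _ := ENNReal.rpow_le_rpow_of_exponent_le (le_max_left _ _) hκ.le
    -- Consecutive radii differ by δ/2^(k+1), whose inverse square gives the factors 4·4^k.
    have e2 : ENNReal.ofReal (1 / (s k - s (k + 1))) ^ 2 = 4 * 4 ^ k * Dd ^ 2 := by
      rw [e1, show 1 / (δ / (2 ^ k * 2)) = 2 ^ k * 2 * (1 / δ) by field_simp,
        ENNReal.ofReal_mul (by positivity), ENNReal.ofReal_mul (by positivity),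
        ENNReal.ofReal_pow (by norm_num), ← hDd]
      simp only [ENNReal.ofReal_ofNat]
      rw [mul_pow, mul_pow, ← pow_mul, mul_comm k 2, pow_mul]
      norm_num
      ring
    rw [e2]
    calc K * (N * (4 * 4 ^ k * Dd ^ 2) * A k) ^ κ
        ≤ (max 1 K) ^ κ * (max 1 N * (4 * 4 ^ k * Dd ^ 2) * A k) ^ κ := by
          gcongr
          exact le_max_right _ _
      _ = _ := by
          rw [← ENNReal.mul_rpow_of_nonneg _ _ hκ0.le, hQ, hQ₀]
          congr 1
          ring
  have hbound : ∀ k, A k ≤ (Q ^ (∑ j ∈ Finset.range k, (κ⁻¹) ^ j) *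
      4 ^ (∑ j ∈ Finset.range k, (j : ℝ) * (κ⁻¹) ^ j) * A 0) ^ (κ ^ k) := by
    intro k
    induction k with
    | zero => simp
    | succ k ih =>
      refine (hrec k).trans ?_
      have hκk : 0 < κ ^ k := by positivity
      have hroot : ∀ t : ℝ≥0∞, t = (t ^ ((κ⁻¹) ^ k)) ^ (κ ^ k) := fun t => by
        rw [← ENNReal.rpow_mul, ← mul_pow, inv_mul_cancel₀ hκ0.ne', one_pow, ENNReal.rpow_one]
      rw [pow_succ κ k, ENNReal.rpow_mul]
      gcongr
      rw [Finset.sum_range_succ, Finset.sum_range_succ,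
        ENNReal.rpow_add_of_nonneg _ _ (Finset.sum_nonneg fun j _ => by positivity) (by positivity),
        ENNReal.rpow_add_of_nonneg _ _ (Finset.sum_nonneg fun j _ => by positivity) (by positivity)]
      have h4 : (4 : ℝ≥0∞) ^ ((k : ℝ) * (κ⁻¹) ^ k) = (4 ^ k) ^ ((κ⁻¹) ^ k) := by
        rw [ENNReal.rpow_mul, ENNReal.rpow_natCast]
      rw [h4]
      calc Q * 4 ^ k * A k ≤ (Q ^ ((κ⁻¹) ^ k)) ^ (κ ^ k) * ((4 ^ k) ^ ((κ⁻¹) ^ k)) ^ (κ ^ k) *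
            (Q ^ (∑ j ∈ Finset.range k, (κ⁻¹) ^ j) *
              4 ^ (∑ j ∈ Finset.range k, (j : ℝ) * (κ⁻¹) ^ j) * A 0) ^ (κ ^ k) := by
            rw [← hroot Q, ← hroot (4 ^ k)]
            gcongr
        _ = _ := by
            rw [← ENNReal.mul_rpow_of_nonneg _ _ hκk.le, ← ENNReal.mul_rpow_of_nonneg _ _ hκk.le]
            congr 1
            ring
  have hfinal := ae_le_of_lintegral_rpow_le (ρ := ν.restrict (U σ')) (f := f)
    (hf.mono_measure (Measure.restrict_mono_set ν (hU _ _ (by linarith))))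
    (B := Q ^ (S : ℝ) * 4 ^ T * A 0) hκ (fun k => by
      calc ∫⁻ X in U σ', f X ^ (κ ^ k) ∂ν ≤ A k := by
            refine lintegral_mono_set (hU _ _ ?_)
            simp only [hs]
            have : 0 < δ / 2 ^ k := by positivity
            linarith
        _ ≤ _ := hbound k
        _ ≤ _ := by
            refine ENNReal.rpow_le_rpow (mul_le_mul' (mul_le_mul'
              (ENNReal.rpow_le_rpow_of_exponent_le hQ1 ?_)
              (ENNReal.rpow_le_rpow_of_exponent_le (by norm_num) ?_)) le_rfl) (by positivity)
            · exact (hgeo.sum_le_tsum _ fun j _ => by positivity).trans hS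
            · exact hgeo'.sum_le_tsum _ fun j _ => by positivity)
  filter_upwards [hfinal] with X hX
  refine hX.trans (le_of_eq ?_)
  rw [hA0, ENNReal.rpow_natCast, hQ, mul_pow, ← pow_mul]
  ring

/-- The Sobolev gain is taken as κ = θ² with θ - 1 small in terms of `C₄`. Having a square root of κ
at hand allows exponents that are odd powers of θ: multiplying by κ keeps them odd, so they never
meet 1. -/
theorem exists_sobolev_exponent {C₄ : ℝ} (h : 1 ≤ C₄) : ∃ θ : ℝ, 1 < θ ∧ θ ^ 2 ≤ 2 ∧
    ENNReal.ofReal C₄ ^ (θ ^ 2 - 1) ≤ 2 ^ (1 / 2 : ℝ) := by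
  obtain ⟨N, hN⟩ := pow_unbounded_of_one_lt C₄ (one_lt_two)
  have hN0 : N ≠ 0 := by
    rintro rfl
    simp at hN
    linarith
  have hN1 : (1 : ℝ) ≤ N := by exact_mod_cast Nat.one_le_iff_ne_zero.2 hN0
  have hN' : (1 : ℝ) / (2 * N) ≤ 1 := by
    rw [div_le_one (by positivity)]; linarith
  have hN'' : (0 : ℝ) < 1 / (2 * N) := by positivity
  -- As `C₄` < 2^N, the exponent θ² - 1 = 1/(2N) gives exactly the bound 2^(1/2).
  refine ⟨√(1 + 1 / (2 * N)), ?_, ?_, ?_⟩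
  · rw [Real.lt_sqrt (by norm_num)]; linarith
  · rw [Real.sq_sqrt (by positivity)]; linarith
  · rw [Real.sq_sqrt (by positivity), add_sub_cancel_left]
    calc ENNReal.ofReal C₄ ^ (1 / (2 * N) : ℝ) ≤ (2 ^ N) ^ (1 / (2 * N) : ℝ) := by
          gcongr
          rw [← ENNReal.ofReal_ofNat 2, ← ENNReal.ofReal_pow (by norm_num)]
          exact ENNReal.ofReal_le_ofReal hN.le
      _ = _ := by
          rw [← ENNReal.rpow_natCast, ← ENNReal.rpow_mul]
          congr 1
          field_simp

theorem moserConst_le {Λ L p b : ℝ} (h : p ^ 2 / (p - 1) ^ 2 ≤ b) :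
    moserConst Λ L p ≤ (2 * Λ ^ 4 * b + 2) * L ^ 2 + 1 := by
  unfold moserConst
  gcongr

theorem sq_div_sub_one_sq_le_of_neg {p : ℝ} (hp : p < 0) : p ^ 2 / (p - 1) ^ 2 ≤ 1 := by
  rw [div_le_one (by nlinarith)]
  nlinarith

/-- The Caccioppoli constant degenerates only at p = 1; staying a factor θ away keeps it bounded. -/
theorem sq_div_sub_one_sq_le {θ : ℝ} (hθ : 1 < θ) {p : ℝ} (hp : 0 < p)
    (h : p ≤ θ⁻¹ ∨ θ ≤ p) : p ≠ 1 ∧ p ^ 2 / (p - 1) ^ 2 ≤ (θ / (θ - 1)) ^ 2 := by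
  have hθ0 : 0 < θ := by linarith
  have hθ1 : 0 < θ - 1 := by linarith
  rcases h with h | h
  · have h1 : θ * p ≤ 1 := by
      calc θ * p ≤ θ * θ⁻¹ := by gcongr
        _ = 1 := mul_inv_cancel₀ hθ0.ne'
    have hp1 : p < 1 := by nlinarith
    refine ⟨hp1.ne, ?_⟩
    rw [← div_pow, ← sq_abs, abs_div, abs_of_pos hp, abs_of_neg (by linarith : p - 1 < 0)]
    have h2 : 0 < -(p - 1) := by linarith
    gcongr 1
    rw [div_le_div_iff₀ h2 hθ1]
    nlinarith
  · have hp1 : 1 < p := by linarith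
    refine ⟨hp1.ne', ?_⟩
    rw [← div_pow]
    have h2 : 0 < p - 1 := by linarith
    gcongr 1
    rw [div_le_div_iff₀ h2 hθ1]
    nlinarith

end DegElliptic

/-! ### The Bombieri–Giusti lemma. -/

namespace DegElliptic

/-- Inverse odd powers of θ form a geometric sequence of ratio θ^(-2) starting at θ⁻¹, so each
smaller s is within a factor θ² of one of them. -/
theorem exists_odd_pow_near {θ s : ℝ} (hθ : 1 < θ) (hs : 0 < s) (hsθ : s ≤ θ⁻¹) :
    ∃ N : ℕ, (θ ^ (2 * N + 1))⁻¹ ≤ s ∧ s ≤ θ ^ 2 * (θ ^ (2 * N + 1))⁻¹ := by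
  have hθ0 : 0 < θ := by linarith
  have h1 : 1 ≤ 1 / (s * θ) := by
    rw [le_div_iff₀ (by positivity), one_mul]
    calc s * θ ≤ θ⁻¹ * θ := by gcongr
      _ = 1 := inv_mul_cancel₀ hθ0.ne'
  obtain ⟨N, hN1, hN2⟩ := exists_nat_pow_near h1 (by nlinarith : 1 < θ ^ 2)
  refine ⟨N + 1, ?_, ?_⟩
  · rw [inv_le_comm₀ (by positivity) hs]
    rw [div_lt_iff₀ (by positivity)] at hN2
    rw [← one_div, div_le_iff₀ hs]
    calc 1 ≤ (θ ^ 2) ^ (N + 1) * (s * θ) := hN2.le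
      _ = _ := by rw [← pow_mul]; ring
  · rw [le_div_iff₀ (by positivity)] at hN1
    rw [← div_eq_mul_inv, le_div_iff₀ (by positivity)]
    calc s * θ ^ (2 * (N + 1) + 1) = θ ^ 2 * ((θ ^ 2) ^ N * (s * θ)) := by
          rw [← pow_mul]; ring
      _ ≤ θ ^ 2 * 1 := by gcongr
      _ = _ := mul_one _

section BombieriGiusti

variable {α : Type*} [MeasurableSpace α] {ν : Measure α} {U : ℝ → Set α} {ℓ : α → ℝ}
  {θ K C : ℝ} {γ : ℕ}

/-- If ℓ ≤ ψ on the larger set, splitting at ψ/2 and using the tail bound gives ∫ exp(pℓ) ≤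
exp(pψ/2) + exp(pψ)·2C/ψ. For p near (2/ψ) log(ψ/(2C)) both terms are at most exp(pψ/2), so the
supremum estimate gives ℓ ≤ ψ/2 + log(2Δ)/p on the smaller set. When ψ is large compared with Δ the
last term is at most ψ/4; otherwise ψ itself is below the additive constant. -/
theorem bombieri_giusti_step (hθ : 1 < θ) (hθ2 : θ ^ 2 ≤ 2) (hK : 1 ≤ K) (hC : 2 ≤ C)
    (hU : ∀ σ' σ : ℝ, σ' ≤ σ → U σ' ⊆ U σ) (hν : ν (U 1) ≤ 1) (hℓ : AEMeasurable ℓ (ν.restrict (U 1)))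
    (hsup : ∀ (N : ℕ) (σ' σ : ℝ), 1 / 2 ≤ σ' → σ' < σ → σ ≤ 1 →
      ∀ᵐ X ∂(ν.restrict (U σ')), ENNReal.ofReal (Real.exp ((θ ^ (2 * N + 1))⁻¹ * ℓ X)) ≤
        ENNReal.ofReal (K * (1 / (σ - σ')) ^ γ) *
          ∫⁻ X in U σ, ENNReal.ofReal (Real.exp ((θ ^ (2 * N + 1))⁻¹ * ℓ X)) ∂ν)
    (hlog : ∀ t : ℝ, 0 < t → ν.restrict (U 1) {X | t ≤ ℓ X} ≤ ENNReal.ofReal (C / t))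
    {σ' σ ψ : ℝ} (hσ' : 1 / 2 ≤ σ') (hσ : σ' < σ) (hσ1 : σ ≤ 1) (hψ : 0 < ψ)
    (h : ∀ᵐ X ∂(ν.restrict (U σ)), ℓ X ≤ ψ) :
    ∀ᵐ X ∂(ν.restrict (U σ')), ℓ X ≤
      3 / 4 * ψ + 2 * C * (2 * (K * (1 / (σ - σ')) ^ γ)) ^ 4 := by
  have hδ : 0 < σ - σ' := by linarith
  set Δ := K * (1 / (σ - σ')) ^ γ with hΔ
  have hΔ1 : 1 ≤ Δ := by
    refine one_le_mul_of_one_le_of_one_le hK (one_le_pow₀ ?_)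
    rw [le_div_iff₀ hδ]; linarith
  have hmono := ae_mono (Measure.restrict_mono_set ν (hU _ _ hσ.le)) h
  have hC0 : 0 < C := by linarith
  rcases le_or_gt ψ (2 * C * (2 * Δ) ^ 4) with hsmall | hbig
  · filter_upwards [hmono] with X hX
    linarith
  set L := Real.log (ψ / (2 * C)) with hL
  have hlogΔ : 0 < Real.log (2 * Δ) := Real.log_pos (by linarith)
  have hLbig : 4 * Real.log (2 * Δ) < L := by
    have : (2 * Δ) ^ 4 < ψ / (2 * C) := by rw [lt_div_iff₀ (by positivity)]; linarith
    have h2 := Real.log_lt_log (by positivity) this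
    rw [Real.log_pow] at h2
    exact_mod_cast h2
  have hL0 : 0 < L := by linarith
  have hθC : θ ≤ C := by nlinarith
  -- The ideal exponent is admissible: log x ≤ x gives the bound 1/C, and θ ≤ θ² ≤ 2 ≤ C.
  have hs1 : 2 * L / ψ ≤ θ⁻¹ := by
    have h1 : L ≤ ψ / (2 * C) := (Real.log_le_sub_one_of_pos (by positivity)).trans (by linarith)
    calc 2 * L / ψ ≤ 2 * (ψ / (2 * C)) / ψ := by gcongr
      _ = C⁻¹ := by field_simp
      _ ≤ θ⁻¹ := by gcongr
  obtain ⟨N, hN1, hN2⟩ := exists_odd_pow_near hθ (by positivity : 0 < 2 * L / ψ) hs1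
  have hsup' := hsup N σ' σ hσ' hσ hσ1
  set p := (θ ^ (2 * N + 1))⁻¹ with hp
  have hp0 : 0 < p := by positivity
  have hpL : p * ψ / 2 ≤ L := by
    rw [le_div_iff₀ hψ] at hN1
    linarith
  have hint : ∫⁻ X in U σ, ENNReal.ofReal (Real.exp (p * ℓ X)) ∂ν ≤
      ENNReal.ofReal (2 * Real.exp (p * ψ / 2)) := by
    set E : Set α := {X | ψ / 2 ≤ ℓ X} with hE
    have hEm : NullMeasurableSet E (ν.restrict (U σ)) :=
      nullMeasurableSet_le aemeasurable_const
        (hℓ.mono_measure (Measure.restrict_mono_set ν (hU _ _ hσ1)))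
    have hle : Measure.restrict ν (U σ) ≤ ν.restrict (U 1) := Measure.restrict_mono_set ν (hU _ _ hσ1)
    calc _ ≤ ∫⁻ X in U σ, (ENNReal.ofReal (Real.exp (p * ψ / 2)) +
          E.indicator (fun _ => ENNReal.ofReal (Real.exp (p * ψ))) X) ∂ν := by
          refine lintegral_mono_ae ?_
          filter_upwards [h] with X hX
          by_cases hXE : X ∈ E
          · rw [Set.indicator_of_mem hXE]
            refine le_trans (ENNReal.ofReal_le_ofReal ?_) le_add_self
            gcongr
          · rw [Set.indicator_of_notMem hXE, add_zero]
            refine ENNReal.ofReal_le_ofReal (Real.exp_le_exp.2 ?_)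
            have : ℓ X < ψ / 2 := not_le.1 hXE
            nlinarith
      _ = ENNReal.ofReal (Real.exp (p * ψ / 2)) * ν.restrict (U σ) Set.univ +
          ENNReal.ofReal (Real.exp (p * ψ)) * ν.restrict (U σ) E := by
          rw [lintegral_add_left measurable_const, lintegral_const, lintegral_indicator₀ hEm,
            setLIntegral_const]
      _ ≤ ENNReal.ofReal (Real.exp (p * ψ / 2)) * 1 +
          ENNReal.ofReal (Real.exp (p * ψ)) * ENNReal.ofReal (C / (ψ / 2)) := by
          gcongr
          · rw [Measure.restrict_apply_univ]
            exact (measure_mono (hU _ _ hσ1)).trans hν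
          · exact (hle E).trans (hlog _ (by positivity))
      _ = ENNReal.ofReal (Real.exp (p * ψ / 2) + Real.exp (p * ψ) * (C / (ψ / 2))) := by
          rw [mul_one, ← ENNReal.ofReal_mul (by positivity),
            ← ENNReal.ofReal_add (by positivity) (by positivity)]
      _ ≤ _ := by
          refine ENNReal.ofReal_le_ofReal ?_
          have h1 : Real.exp (p * ψ / 2) ≤ ψ / (2 * C) := by
            rw [← Real.le_log_iff_exp_le (by positivity)]
            exact hpL
          have h2 : Real.exp (p * ψ) = Real.exp (p * ψ / 2) * Real.exp (p * ψ / 2) := by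
            rw [← Real.exp_add]; congr 1; ring
          have h3 : Real.exp (p * ψ / 2) * (C / (ψ / 2)) ≤ 1 := by
            calc _ ≤ ψ / (2 * C) * (C / (ψ / 2)) := by gcongr
              _ = 1 := by field_simp
          have h4 := Real.exp_pos (p * ψ / 2)
          rw [h2, mul_assoc]
          nlinarith
  filter_upwards [hsup'] with X hX
  have h1 := hX.trans (mul_le_mul_right hint _)
  rw [← ENNReal.ofReal_mul (by positivity), ENNReal.ofReal_le_ofReal_iff (by positivity)] at h1
  have h2 : p * ℓ X ≤ Real.log (2 * Δ) + p * ψ / 2 := by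
    rw [← Real.exp_le_exp, Real.exp_add, Real.exp_log (by positivity)]
    linarith
  -- Rounding p down costs a factor θ² ≤ 2, so L ≤ pψ, while log(2Δ) < L/4.
  have h3 : Real.log (2 * Δ) ≤ p * (ψ / 4) := by
    have : 2 * L ≤ 2 * p * ψ := by
      rw [div_le_iff₀ hψ] at hN2
      calc 2 * L ≤ θ ^ 2 * p * ψ := hN2
        _ ≤ 2 * p * ψ := by gcongr
    linarith
  have h4 : ℓ X ≤ 3 / 4 * ψ := by
    have : p * ℓ X ≤ p * (3 / 4 * ψ) := by linarith
    exact le_of_mul_le_mul_left this hp0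
  have : 0 ≤ 2 * C * (2 * Δ) ^ 4 := by positivity
  linarith

theorem summable_geometric_mul_pow {c K C : ℝ} (γ : ℕ) (hK : 0 ≤ K) (hC : 0 ≤ C)
    (hc : 0 ≤ c) (hc1 : c < 1) :
    Summable fun j : ℕ => c ^ j *
      (2 * C * (2 * (K * (4 * ((j : ℝ) + 1) * ((j : ℝ) + 2)) ^ γ)) ^ 4) := by
  have h1 : ∀ k : ℕ, Summable fun j : ℕ => ((j : ℝ) + 2) ^ k * c ^ j := by
    intro k
    have h0 : Summable fun j : ℕ => ((j : ℝ) ^ k * c ^ j) :=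
      summable_pow_mul_geometric_of_norm_lt_one k (by rwa [Real.norm_eq_abs, abs_of_nonneg hc])
    rcases hc.eq_or_lt with h | h
    · refine summable_of_ne_finset_zero (s := {0}) fun j hj => ?_
      rw [← h, zero_pow (by simpa using hj), mul_zero]
    have h2 := (summable_nat_add_iff 2).2 h0
    have h3 := h2.mul_left ((c ^ 2)⁻¹)
    refine h3.congr fun j => ?_
    push_cast
    rw [pow_add]
    field_simp
  refine Summable.of_nonneg_of_le (fun j => by positivity) (fun j => ?_)
    ((h1 (2 * γ * 4)).mul_left (2 * C * (2 * (K * 4 ^ γ)) ^ 4))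
  calc c ^ j * (2 * C * (2 * (K * (4 * ((j : ℝ) + 1) * ((j : ℝ) + 2)) ^ γ)) ^ 4)
      ≤ c ^ j * (2 * C * (2 * (K * (4 * ((j : ℝ) + 2) * ((j : ℝ) + 2)) ^ γ)) ^ 4) := by
        gcongr
        norm_num
    _ = _ := by
        rw [show 4 * ((j : ℝ) + 2) * ((j : ℝ) + 2) = 4 * ((j : ℝ) + 2) ^ 2 by ring, mul_pow 4,
          ← pow_mul, pow_mul ((j : ℝ) + 2) (2 * γ) 4]
        ring

/-- The Bombieri–Giusti lemma. -/
theorem bombieri_giusti (hθ : 1 < θ) (hθ2 : θ ^ 2 ≤ 2) (hK : 1 ≤ K) (hC : 2 ≤ C) (γ : ℕ) :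
    ∃ A : ℝ, ∀ {α : Type} [MeasurableSpace α] (ν : Measure α) (U : ℝ → Set α) (ℓ : α → ℝ),
      (∀ σ' σ : ℝ, σ' ≤ σ → U σ' ⊆ U σ) → ν (U 1) ≤ 1 → AEMeasurable ℓ (ν.restrict (U 1)) →
      (∀ (N : ℕ) (σ' σ : ℝ), 1 / 2 ≤ σ' → σ' < σ → σ ≤ 1 →
        ∀ᵐ X ∂(ν.restrict (U σ')), ENNReal.ofReal (Real.exp ((θ ^ (2 * N + 1))⁻¹ * ℓ X)) ≤
          ENNReal.ofReal (K * (1 / (σ - σ')) ^ γ) *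
            ∫⁻ X in U σ, ENNReal.ofReal (Real.exp ((θ ^ (2 * N + 1))⁻¹ * ℓ X)) ∂ν) →
      (∀ t : ℝ, 0 < t → ν.restrict (U 1) {X | t ≤ ℓ X} ≤ ENNReal.ofReal (C / t)) →
      (∃ ψ₀, ∀ᵐ X ∂(ν.restrict (U (3 / 4))), ℓ X ≤ ψ₀) →
      ∀ᵐ X ∂(ν.restrict (U (1 / 2))), ℓ X ≤ A := by
  have hC0 : 0 < C := by linarith
  set E : ℕ → ℝ := fun j => 2 * C * (2 * (K * (4 * ((j : ℝ) + 1) * ((j : ℝ) + 2)) ^ γ)) ^ 4 with hE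
  have hsum : Summable fun j => (3 / 4 : ℝ) ^ j * E j :=
    summable_geometric_mul_pow γ (by linarith) hC0.le (by norm_num) (by norm_num)
  have hE0 : ∀ j, 0 < E j := fun j => by positivity
  refine ⟨∑' j, (3 / 4 : ℝ) ^ j * E j, ?_⟩
  rintro α _ ν U ℓ hU hν hℓ hsup hlog ⟨ψ₀, hψ₀⟩
  -- The radii increase from 1/2 to 3/4 with gaps 1/(4(j+1)(j+2)), so the errors grow polynomially
  -- and are summable against (3/4)^j.
  set s : ℕ → ℝ := fun j => 3 / 4 - 1 / (4 * ((j : ℝ) + 1)) with hs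
  -- Starting J steps further out, the a priori bound ψ₀ reaches the set of index i multiplied by
  -- (3/4)^J. Letting J → ∞ removes it, so ψ₀ matters only through its existence.
  have key : ∀ J i : ℕ, ∀ᵐ X ∂(ν.restrict (U (s i))),
      ℓ X ≤ (3 / 4 : ℝ) ^ J * max ψ₀ 1 + ∑ j ∈ Finset.range J, (3 / 4 : ℝ) ^ j * E (i + j) := by
    intro J
    induction J with
    | zero =>
      intro i
      have : s i ≤ 3 / 4 := by
        have : (0 : ℝ) ≤ 1 / (4 * ((i : ℝ) + 1)) := by positivity
        simp only [hs]; linarith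
      filter_upwards [ae_mono (Measure.restrict_mono_set ν (hU _ _ this)) hψ₀] with X hX
      simpa using Or.inl hX
    | succ J ih =>
      intro i
      have hi : (0 : ℝ) ≤ i := Nat.cast_nonneg i
      have hdiff : s (i + 1) - s i = 1 / (4 * ((i : ℝ) + 1) * ((i : ℝ) + 2)) := by
        simp only [hs]
        push_cast
        field_simp
        ring
      have hlt : s i < s (i + 1) := by
        have : 0 < 1 / (4 * ((i : ℝ) + 1) * ((i : ℝ) + 2)) := by positivity
        linarith
      have hge : 1 / 2 ≤ s i := by
        have : 1 / (4 * ((i : ℝ) + 1)) ≤ 1 / 4 := by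
          gcongr
          linarith
        simp only [hs]; linarith
      have hle : s (i + 1) ≤ 1 := by
        have : (0 : ℝ) ≤ 1 / (4 * (((i + 1 : ℕ) : ℝ) + 1)) := by positivity
        simp only [hs]; linarith
      have hpos : 0 < (3 / 4 : ℝ) ^ J * max ψ₀ 1 +
          ∑ j ∈ Finset.range J, (3 / 4 : ℝ) ^ j * E (i + 1 + j) := by
        have : 0 < max ψ₀ 1 := lt_max_of_lt_right one_pos
        have h2 : 0 ≤ ∑ j ∈ Finset.range J, (3 / 4 : ℝ) ^ j * E (i + 1 + j) :=
          Finset.sum_nonneg fun j _ => by have := hE0 (i + 1 + j); positivity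
        positivity
      have hst := bombieri_giusti_step hθ hθ2 hK hC hU hν hℓ hsup hlog hge hlt hle hpos (ih (i + 1))
      rw [hdiff, one_div_one_div] at hst
      filter_upwards [hst] with X hX
      refine hX.trans (le_of_eq ?_)
      rw [Finset.sum_range_succ', mul_add, Finset.mul_sum]
      simp only [pow_succ, add_zero, pow_zero, one_mul, hE]
      rw [add_assoc]
      congr 1
      · ring
      · congr 1
        refine Finset.sum_congr rfl fun j _ => ?_
        rw [show i + 1 + j = i + (j + 1) by ring]
        ring
  have h0 : s 0 = 1 / 2 := by simp only [hs]; norm_num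
  have hall := ae_all_iff.2 fun J => key J 0
  rw [h0] at hall
  filter_upwards [hall] with X hX
  have hlim : Tendsto (fun J : ℕ => (3 / 4 : ℝ) ^ J * max ψ₀ 1 +
      ∑ j ∈ Finset.range J, (3 / 4 : ℝ) ^ j * E (0 + j)) atTop
      (𝓝 (0 * max ψ₀ 1 + ∑' j, (3 / 4 : ℝ) ^ j * E j)) := by
    refine ((tendsto_pow_atTop_nhds_zero_of_lt_one (by norm_num) (by norm_num)).mul_const _).add ?_
    simp only [zero_add]
    exact hsum.hasSum.tendsto_sum_nat
  rw [zero_mul, zero_add] at hlim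
  exact ge_of_tendsto' hlim hX

end BombieriGiusti

end DegElliptic

/-! ### Supremum and logarithmic estimates; Harnack on small balls. -/

namespace DegElliptic

variable {n : ℕ}

/-- All iterates of p under multiplication by θ² are either negative or odd powers of θ, so the
Caccioppoli constants along the iteration share one bound. -/
theorem sobolev_exponent_ratio {θ p : ℝ} (hθ : 1 < θ)
    (hp : p < 0 ∨ ∃ N : ℕ, p = (θ ^ (2 * N + 1))⁻¹) (k : ℕ) :
    p * (θ ^ 2) ^ k ≠ 0 ∧ p * (θ ^ 2) ^ k ≠ 1 ∧
      (p * (θ ^ 2) ^ k) ^ 2 / (p * (θ ^ 2) ^ k - 1) ^ 2 ≤ max 1 ((θ / (θ - 1)) ^ 2) := by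
  have hθ0 : 0 < θ := by linarith
  have hpow : 0 < (θ ^ 2) ^ k := by positivity
  rcases hp with hp | ⟨N, rfl⟩
  · have h : p * (θ ^ 2) ^ k < 0 := mul_neg_of_neg_of_pos hp hpow
    exact ⟨h.ne, by linarith, (sq_div_sub_one_sq_le_of_neg h).trans (le_max_left _ _)⟩
  · have hpos : 0 < (θ ^ (2 * N + 1))⁻¹ * (θ ^ 2) ^ k := by positivity
    have h := sq_div_sub_one_sq_le hθ hpos (by
      rcases le_or_gt k N with hk | hk
      · left
        rw [← pow_mul, inv_mul_le_iff₀ (by positivity), pow_succ, mul_assoc,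
          mul_inv_cancel₀ hθ0.ne', mul_one]
        gcongr
        exact hθ.le
      · right
        rw [← pow_mul, le_inv_mul_iff₀ (by positivity), ← pow_succ]
        gcongr
        · exact hθ.le
        · omega)
    exact ⟨hpos.ne', h.1, h.2.trans (le_max_right _ _)⟩

/-- Moser iteration applied to f = u^p. The point is that K and γ do not depend on p; negative p
carry the information on the infimum. -/
theorem sup_estimate (n : ℕ) {C₄ C₆ Λ θ : ℝ} (hθ : 1 < θ)
    (hθC : ENNReal.ofReal C₄ ^ (θ ^ 2 - 1) ≤ 2 ^ (1 / 2 : ℝ)) :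
    ∃ K : ℝ, 1 ≤ K ∧ ∃ γ : ℕ, ∀ (Ω : Set (EuclideanSpace ℝ (Fin n)))
      (m : Measure (EuclideanSpace ℝ (Fin n))), DoublingPoincare Ω m C₄ C₆ →
      ∀ (y : EuclideanSpace ℝ (Fin n)) (R : ℝ), 0 < R → ball y (4 * R) ⊆ Ω →
      ∀ (ε : ℝ) (u : EuclideanSpace ℝ (Fin n) → ℝ)
        (G V : EuclideanSpace ℝ (Fin n) → EuclideanSpace ℝ (Fin n)),
        LocalSolution (m.restrict (ball y (2 * R))) (ball y (2 * R)) Λ ε u G V →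
      ∀ p : ℝ, (p < 0 ∨ ∃ N : ℕ, p = (θ ^ (2 * N + 1))⁻¹) →
      ∀ σ' σ : ℝ, 1 / 2 ≤ σ' → σ' < σ → σ ≤ 1 →
        ∀ᵐ X ∂(((m (ball y R))⁻¹ • m).restrict (ball y (σ' * R))),
          ENNReal.ofReal (u X ^ p) ≤ ENNReal.ofReal (K * (1 / (σ - σ')) ^ γ) *
            ∫⁻ X in ball y (σ * R), ENNReal.ofReal (u X ^ p) ∂((m (ball y R))⁻¹ • m) := by
  have hκ : 1 < θ ^ 2 := by nlinarith
  obtain ⟨L, hL, hcut⟩ := exists_cutoff n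
  obtain ⟨Ks, hKs, hsob⟩ := sobolev_smooth (n := n) C₄ C₆ (θ ^ 2) hκ.le hθC
  set b := max 1 ((θ / (θ - 1)) ^ 2) with hb
  have hb0 : 0 ≤ b := le_trans zero_le_one (le_max_left _ _)
  set N₀ : ℝ := (2 * Λ ^ 4 * b + 2) * L ^ 2 + 1 with hN₀
  have hN₀0 : 0 ≤ N₀ := by positivity
  obtain ⟨C, γ, hC, hiter⟩ := moser_iteration hκ hKs (ENNReal.ofReal_ne_top (r := N₀))
  refine ⟨max 1 C.toReal, le_max_left _ _, γ, ?_⟩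
  intro Ω m H y R hR hy ε u G V S p hp σ' σ hσ' hσ hσ1
  have hyΩ : y ∈ Ω := hy (mem_ball_self (by positivity))
  have hm0 := (H.pos y hyΩ R hR).ne'
  have hmt := H.lt_top y hyΩ (2 * R) (by positivity)
  have hum := S.pair.integrable.aestronglyMeasurable.aemeasurable
  set ν := (m (ball y R))⁻¹ • m with hν
  have hres := hiter ν (fun σ => ball y (σ * R)) (fun X => ENNReal.ofReal (u X ^ p))
    (fun a b hab => ball_subset_ball (by gcongr)) ?_ ?_ σ' σ hσ' hσ hσ1
  · have hδ : 0 < σ - σ' := by linarith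
    filter_upwards [hres] with X hX
    refine hX.trans ?_
    gcongr
    rw [ENNReal.ofReal_mul (by positivity), ENNReal.ofReal_pow (by positivity)]
    gcongr
    rw [← ENNReal.ofReal_toReal hC]
    exact ENNReal.ofReal_le_ofReal (by rw [ENNReal.toReal_ofReal ENNReal.toReal_nonneg]
                                       exact le_max_right _ _)
  · rw [hν, Measure.restrict_smul]
    refine AEMeasurable.smul_measure ?_ _
    exact ((hum.mono_measure (Measure.restrict_mono_set m
      (ball_subset_ball (by linarith)))).pow_const _).ennreal_ofReal
  · intro k s' s hs' hs hs1
    obtain ⟨h0, h1, hratio⟩ := sobolev_exponent_ratio hθ hp k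
    have hstep := S.moser_step hR hm0 hmt hκ.le hKs (hsob Ω m H y R hR hy) hL hcut hs' hs hs1 h0 h1
    have hconv : ∀ (k : ℕ) (t : ℝ), t ≤ 1 →
        ∫⁻ X in ball y (t * R), ENNReal.ofReal (u X ^ p) ^ ((θ ^ 2) ^ k) ∂ν =
        ∫⁻ X in ball y (t * R), ENNReal.ofReal (u X ^ (p * (θ ^ 2) ^ k)) ∂ν := by
      intro k t ht
      have htR : t * R ≤ 2 * R := by nlinarith
      refine lintegral_congr_ae ?_
      filter_upwards [ae_smul_restrict (ball_subset_ball htR) _ S.le_u] with X hX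
      have hu := S.pos_ε.trans_le hX
      rw [ENNReal.ofReal_rpow_of_pos (by positivity), ← Real.rpow_mul hu.le]
    have hδ : 0 < s - s' := by linarith
    rw [hconv _ _ (by linarith), hconv _ _ hs1, pow_succ, ← mul_assoc]
    refine hstep.trans ?_
    gcongr
    rw [← ENNReal.ofReal_pow (by positivity), ← ENNReal.ofReal_mul hN₀0]
    refine ENNReal.ofReal_le_ofReal ?_
    rw [one_div, inv_pow, ← div_eq_mul_inv]
    gcongr
    exact moserConst_le hratio

/-- Caccioppoli at p = 0 has right side ∫|∇η|² dm, so |∇ log u|² has mean at most a/R². Poincaré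
bounds the mean oscillation of log u by a constant and Chebyshev gives the tail. -/
theorem log_estimate (n : ℕ) {C₄ C₆ Λ : ℝ} :
    ∃ C : ℝ, 2 ≤ C ∧ ∀ (Ω : Set (EuclideanSpace ℝ (Fin n)))
      (m : Measure (EuclideanSpace ℝ (Fin n))), DoublingPoincare Ω m C₄ C₆ →
      ∀ (y : EuclideanSpace ℝ (Fin n)) (R : ℝ), 0 < R → ball y (4 * R) ⊆ Ω →
      ∀ (ε : ℝ) (u : EuclideanSpace ℝ (Fin n) → ℝ)
        (G V : EuclideanSpace ℝ (Fin n) → EuclideanSpace ℝ (Fin n)),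
        LocalSolution (m.restrict (ball y (2 * R))) (ball y (2 * R)) Λ ε u G V →
      ∃ c : ℝ, ∀ t : ℝ, 0 < t →
        ((m (ball y R))⁻¹ • m).restrict (ball y R) {X | t ≤ |Real.log (u X) - c|} ≤
          ENNReal.ofReal (C / t) := by
  obtain ⟨L, hL, hcut⟩ := exists_cutoff n
  set a := 4 * Λ ^ 4 * (2 * L) ^ 2 * C₄ with ha
  -- The lower bound 2 is what `bombieri_giusti` asks of its constant.
  refine ⟨max 2 (C₆ * √a), le_max_left _ _, ?_⟩
  intro Ω m H y R hR hy ε u G V S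
  have hyΩ : y ∈ Ω := hy (mem_ball_self (by positivity))
  have hm0 := (H.pos y hyΩ R hR).ne'
  have hmtR := (H.lt_top y hyΩ R hR).ne
  have hmt := H.lt_top y hyΩ (2 * R) (by positivity)
  have hC₄ := H.one_le
  have hC₆ := H.pos_C₆
  have ha0 : 0 ≤ a := by positivity
  have hfin : IsFiniteMeasure (m.restrict (ball y (2 * R))) := ⟨by simpa using hmt⟩
  obtain ⟨Φ, K, hΦ, hK, hΦeq⟩ := exists_smooth_log S.pos_ε
  have hsub : ball y R ⊆ ball y (2 * R) := ball_subset_ball (by linarith)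
  have hpair := (S.pair.comp hΦ hK).mono hsub
  obtain ⟨c, hc⟩ := poincare_approxPair H hR ((ball_subset_ball (by linarith)).trans hy) hpair
  refine ⟨c, fun t ht => ?_⟩
  -- A cut-off equal to 1 on `ball y R` and supported in the closed ball of radius 3R/2, still
  -- inside `ball y (2 * R)`; its gradient is at most 2L/R.
  obtain ⟨η, h1, h2, h3, h4, h5, h6, h7, h8, h9⟩ := hcut y R 1 (3 / 2) hR (by norm_num) (by norm_num)
  have hηT : IsTestFunction (ball y (2 * R)) η :=
    ⟨h1, h2, h3.trans (closedBall_subset_ball (by linarith))⟩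
  have hcac := S.caccioppoli (p := 0) (by norm_num) hηT
  have hle_u : ∀ᵐ X ∂(m.restrict (ball y R)), ε ≤ u X :=
    ae_mono (Measure.restrict_mono_set m hsub) S.le_u
  have hgrad : ∫⁻ X in ball y R, ‖deriv Φ (u X) • G X‖ₑ ^ 2 ∂m ≤
      ENNReal.ofReal (a / R ^ 2) * m (ball y R) := by
    calc _ ≤ ∫⁻ X in ball y R, ENNReal.ofReal (η X ^ 2 * u X ^ ((0 : ℝ) - 2) * ‖G X‖ ^ 2) ∂m := by
          refine lintegral_mono_ae ?_
          filter_upwards [hle_u, ae_restrict_mem measurableSet_ball] with X hX hXR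
          have hu := S.pos_ε.trans_le hX
          rw [(hΦeq _ hX).2, h6 X (by rwa [one_mul]), ← ofReal_norm,
            ← ENNReal.ofReal_pow (norm_nonneg _), norm_smul, mul_pow, Real.norm_eq_abs, sq_abs,
            zero_sub, Real.rpow_neg hu.le]
          refine ENNReal.ofReal_le_ofReal (le_of_eq ?_)
          norm_num
      _ ≤ ∫⁻ X in ball y (2 * R),
            ENNReal.ofReal (η X ^ 2 * u X ^ ((0 : ℝ) - 2) * ‖G X‖ ^ 2) ∂m :=
          lintegral_mono_set hsub
      _ ≤ _ := hcac
      _ ≤ ENNReal.ofReal (4 * Λ ^ 4 / (0 - 1) ^ 2) *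
            ∫⁻ X in ball y (2 * R), ENNReal.ofReal ((2 * L / R) ^ 2) ∂m := by
          gcongr with X
          rw [Real.rpow_zero, one_mul]
          have : L / ((3 / 2 - 1) * R) = 2 * L / R := by field_simp; norm_num
          rw [← this]
          gcongr
          exact h9 X
      _ ≤ ENNReal.ofReal (4 * Λ ^ 4 / (0 - 1) ^ 2) * (ENNReal.ofReal ((2 * L / R) ^ 2) *
            (ENNReal.ofReal C₄ * m (ball y R))) := by
          rw [setLIntegral_const]
          gcongr
          exact H.doubling y hyΩ R hR
      _ = _ := by
          rw [← mul_assoc, ← mul_assoc, ← ENNReal.ofReal_mul (by positivity),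
            ← ENNReal.ofReal_mul (by positivity)]
          congr 2
          rw [ha]
          field_simp
          norm_num
  have hmean : ∫⁻ X in ball y R, ‖Φ (u X) - c‖ₑ ∂((m (ball y R))⁻¹ • m) ≤
      ENNReal.ofReal (max 2 (C₆ * √a)) := by
    rw [Measure.restrict_smul, lintegral_smul_measure, smul_eq_mul]
    refine hc.trans ?_
    calc _ ≤ ENNReal.ofReal (C₆ * R) * (ENNReal.ofReal (a / R ^ 2)) ^ (1 / 2 : ℝ) := by
          gcongr
          calc _ ≤ (m (ball y R))⁻¹ * (ENNReal.ofReal (a / R ^ 2) * m (ball y R)) := by gcongr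
            _ = _ := by rw [mul_left_comm, ENNReal.inv_mul_cancel hm0 hmtR, mul_one]
      _ = ENNReal.ofReal (C₆ * √a) := by
          rw [ENNReal.ofReal_rpow_of_nonneg (by positivity) (by norm_num), ← Real.sqrt_eq_rpow,
            ← ENNReal.ofReal_mul (by positivity), Real.sqrt_div ha0, Real.sqrt_sq hR.le]
          congr 1
          field_simp
      _ ≤ _ := ENNReal.ofReal_le_ofReal (le_max_right _ _)
  set ν := (m (ball y R))⁻¹ • m with hν
  have hm : AEMeasurable (fun X => ‖Φ (u X) - c‖ₑ) (ν.restrict (ball y R)) := by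
    rw [hν, Measure.restrict_smul]
    exact (hpair.integrable.aestronglyMeasurable.aemeasurable.sub_const c).enorm.smul_measure _
  calc ν.restrict (ball y R) {X | t ≤ |Real.log (u X) - c|}
      ≤ ν.restrict (ball y R) {X | ENNReal.ofReal t ≤ ‖Φ (u X) - c‖ₑ} := by
        refine measure_mono_ae ?_
        filter_upwards [ae_smul_restrict hsub _ S.le_u] with X hX
        intro hXt
        change t ≤ |Real.log (u X) - c| at hXt
        change ENNReal.ofReal t ≤ ‖Φ (u X) - c‖ₑ
        rw [(hΦeq _ hX).1, ← ofReal_norm]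
        exact ENNReal.ofReal_le_ofReal hXt
    _ ≤ (∫⁻ X in ball y R, ‖Φ (u X) - c‖ₑ ∂ν) / ENNReal.ofReal t :=
        meas_ge_le_lintegral_div hm (by simpa using ht) (by simp)
    _ ≤ ENNReal.ofReal (max 2 (C₆ * √a)) / ENNReal.ofReal t := by gcongr
    _ = _ := (ENNReal.ofReal_div_of_pos ht).symm

/-- Harnack's inequality on a ball well inside of `Ω`, in logarithmic form. -/
theorem local_harnack (n : ℕ) {C₄ C₆ Λ : ℝ} (hC₄ : 1 ≤ C₄) :
    ∃ A : ℝ, ∀ (Ω : Set (EuclideanSpace ℝ (Fin n)))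
      (m : Measure (EuclideanSpace ℝ (Fin n))), DoublingPoincare Ω m C₄ C₆ →
      ∀ (y : EuclideanSpace ℝ (Fin n)) (R : ℝ), 0 < R → ball y (4 * R) ⊆ Ω →
      ∀ (ε : ℝ) (u : EuclideanSpace ℝ (Fin n) → ℝ)
        (G V : EuclideanSpace ℝ (Fin n) → EuclideanSpace ℝ (Fin n)),
        LocalSolution (m.restrict (ball y (2 * R))) (ball y (2 * R)) Λ ε u G V →
      ∃ c : ℝ, ∀ᵐ X ∂(m.restrict (ball y (R / 2))), |Real.log (u X) - c| ≤ A := by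
  obtain ⟨θ, hθ, hθ2, hθC⟩ := exists_sobolev_exponent hC₄
  obtain ⟨K, hK, γ, hsup⟩ := sup_estimate n (C₆ := C₆) (Λ := Λ) hθ hθC
  obtain ⟨C, hC, hlog⟩ := log_estimate n (C₄ := C₄) (C₆ := C₆) (Λ := Λ)
  obtain ⟨A, hA⟩ := bombieri_giusti hθ hθ2 hK hC γ
  refine ⟨A, fun Ω m H y R hR hy ε u G V S => ?_⟩
  obtain ⟨c, hc⟩ := hlog Ω m H y R hR hy ε u G V S
  have hsup' := hsup Ω m H y R hR hy ε u G V S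
  have hyΩ : y ∈ Ω := hy (mem_ball_self (by positivity))
  have hm0 := (H.pos y hyΩ R hR).ne'
  have hmt := (H.lt_top y hyΩ R hR).ne
  have hmt2 := H.lt_top y hyΩ (2 * R) (by positivity)
  have hfin : IsFiniteMeasure (m.restrict (ball y (2 * R))) := ⟨by simpa using hmt2⟩
  set ν := (m (ball y R))⁻¹ • m with hν
  have hU : ∀ σ' σ : ℝ, σ' ≤ σ → ball y (σ' * R) ⊆ ball y (σ * R) := fun a b hab =>
    ball_subset_ball (by gcongr)
  have hν1 : ν (ball y (1 * R)) ≤ 1 := by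
    rw [hν, one_mul, Measure.smul_apply, smul_eq_mul]
    exact ENNReal.inv_mul_le_one _
  have hum : AEMeasurable u (ν.restrict (ball y (1 * R))) := by
    rw [hν, Measure.restrict_smul]
    exact (S.pair.integrable.aestronglyMeasurable.aemeasurable.mono_measure
      (Measure.restrict_mono_set m (ball_subset_ball (by linarith)))).smul_measure _
  have hle : ∀ σ : ℝ, σ ≤ 1 → ∀ᵐ X ∂(ν.restrict (ball y (σ * R))), ε ≤ u X := fun σ hσ =>
    ae_smul_restrict (ball_subset_ball (by nlinarith)) _ S.le_u
  -- The supremum estimate for u^(sp), multiplied by exp(-spc), is the one for exp(p·s(log u - c)).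
  -- With s = 1 or s = -1 both signs of log u - c are covered.
  have hexp : ∀ s p : ℝ, (s * p < 0 ∨ ∃ N : ℕ, s * p = (θ ^ (2 * N + 1))⁻¹) →
      ∀ σ' σ : ℝ, 1 / 2 ≤ σ' → σ' < σ → σ ≤ 1 → ∀ᵐ X ∂(ν.restrict (ball y (σ' * R))),
        ENNReal.ofReal (Real.exp (p * (s * (Real.log (u X) - c)))) ≤
          ENNReal.ofReal (K * (1 / (σ - σ')) ^ γ) * ∫⁻ X in ball y (σ * R),
            ENNReal.ofReal (Real.exp (p * (s * (Real.log (u X) - c)))) ∂ν := by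
    intro s p hsp σ' σ hσ' hσ hσ1
    have hcv : ∀ X, ε ≤ u X → ENNReal.ofReal (Real.exp (p * (s * (Real.log (u X) - c)))) =
        ENNReal.ofReal (Real.exp (-(s * p * c))) * ENNReal.ofReal (u X ^ (s * p)) := by
      intro X hX
      have hu := S.pos_ε.trans_le hX
      rw [← ENNReal.ofReal_mul (Real.exp_pos _).le, Real.rpow_def_of_pos hu, ← Real.exp_add]
      congr 2
      ring
    have hint : ∫⁻ X in ball y (σ * R),
        ENNReal.ofReal (Real.exp (p * (s * (Real.log (u X) - c)))) ∂ν =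
        ENNReal.ofReal (Real.exp (-(s * p * c))) *
          ∫⁻ X in ball y (σ * R), ENNReal.ofReal (u X ^ (s * p)) ∂ν := by
      rw [← lintegral_const_mul' _ _ (by simp)]
      refine lintegral_congr_ae ?_
      filter_upwards [hle σ hσ1] with X hX using hcv X hX
    filter_upwards [hsup' (s * p) hsp σ' σ hσ' hσ hσ1, hle σ' (by linarith)] with X hX hXε
    rw [hcv X hXε, hint, mul_left_comm]
    gcongr
  have hlogm : AEMeasurable (fun X => Real.log (u X) - c) (ν.restrict (ball y (1 * R))) :=
    (Real.measurable_log.comp_aemeasurable hum).sub_const c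
  have hdist : ∀ s : ℝ, |s| = 1 → ∀ t : ℝ, 0 < t → ν.restrict (ball y (1 * R))
      {X | t ≤ s * (Real.log (u X) - c)} ≤ ENNReal.ofReal (C / t) := by
    intro s hs t ht
    refine le_trans (measure_mono fun X hX => ?_) ((one_mul R).symm ▸ hc t ht)
    change t ≤ s * (Real.log (u X) - c) at hX
    change t ≤ |Real.log (u X) - c|
    calc t ≤ |s * (Real.log (u X) - c)| := hX.trans (le_abs_self _)
      _ = _ := by rw [abs_mul, hs, one_mul]
  have hp0 : ∀ N : ℕ, 0 < (θ ^ (2 * N + 1))⁻¹ := fun N => by positivity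
  have hup := hA ν (fun σ => ball y (σ * R)) (fun X => 1 * (Real.log (u X) - c)) hU hν1
    (hlogm.const_mul 1)
    (fun N => hexp 1 _ (Or.inr ⟨N, one_mul _⟩)) (hdist 1 abs_one) (by
      -- The a priori upper bound comes from the supremum estimate for the single exponent p = θ⁻¹ ≤
      -- 1, with finite right side because u^p ≤ 1 + u and u is integrable. Its dependence on u is
      -- harmless.
      have hst := hexp 1 (θ ^ (2 * 0 + 1))⁻¹ (Or.inr ⟨0, one_mul _⟩) (3 / 4) 1 (by norm_num)
        (by norm_num) le_rfl
      set p := (θ ^ (2 * 0 + 1))⁻¹ with hp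
      have hp0 : 0 < p := hp0 0
      have hp1 : p ≤ 1 := inv_le_one_of_one_le₀ (one_le_pow₀ hθ.le)
      set I := ∫⁻ X in ball y (1 * R),
        ENNReal.ofReal (Real.exp (p * (1 * (Real.log (u X) - c)))) ∂ν with hI
      have hIt : I ≠ ⊤ := by
        have hui : Integrable (fun X => Real.exp (-(p * c)) * (1 + u X))
            (ν.restrict (ball y (1 * R))) := by
          rw [hν, Measure.restrict_smul]
          refine Integrable.smul_measure ?_ (ENNReal.inv_ne_top.2 hm0)
          exact (((integrable_const 1).add S.pair.integrable).const_mul _).mono_measure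
            (Measure.restrict_mono_set m (ball_subset_ball (by linarith)))
        refine ne_top_of_le_ne_top hui.lintegral_lt_top.ne (lintegral_mono_ae ?_)
        filter_upwards [hle 1 le_rfl] with X hX
        have hu := S.pos_ε.trans_le hX
        refine ENNReal.ofReal_le_ofReal ?_
        have : u X ^ p ≤ 1 + u X := by
          rcases le_total (u X) 1 with h | h
          · have := Real.rpow_le_one hu.le h hp0.le
            linarith
          · have := Real.rpow_le_rpow_of_exponent_le h hp1
            rw [Real.rpow_one] at this
            linarith
        calc Real.exp (p * (1 * (Real.log (u X) - c))) = Real.exp (-(p * c)) * u X ^ p := by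
              rw [Real.rpow_def_of_pos hu, ← Real.exp_add]
              congr 1
              ring
          _ ≤ _ := by gcongr
      set B := ENNReal.ofReal (K * (1 / (1 - 3 / 4)) ^ γ) * I with hB
      have hBt : B ≠ ⊤ := by finiteness
      refine ⟨B.toReal / p, ?_⟩
      filter_upwards [hst] with X hX
      rw [ENNReal.ofReal_le_iff_le_toReal hBt] at hX
      rw [le_div_iff₀ hp0]
      have := Real.add_one_le_exp (p * (1 * (Real.log (u X) - c)))
      linarith)
  have hdown := hA ν (fun σ => ball y (σ * R)) (fun X => -1 * (Real.log (u X) - c)) hU hν1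
    (hlogm.const_mul (-1))
    (fun N => hexp (-1) _ (Or.inl (by linarith [hp0 N]))) (hdist (-1) (by simp)) (by
      -- For the other sign the a priori bound is just u ≥ ε.
      refine ⟨c - Real.log ε, ?_⟩
      filter_upwards [hle (3 / 4) (by norm_num)] with X hX
      have := Real.log_le_log S.pos_ε hX
      linarith)
  have hM0 : (m (ball y R))⁻¹ ≠ 0 := ENNReal.inv_ne_zero.2 hmt
  refine ⟨c, ?_⟩
  have hboth : ∀ᵐ X ∂(ν.restrict (ball y (1 / 2 * R))), |Real.log (u X) - c| ≤ A := by
    filter_upwards [hup, hdown] with X h1 h2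
    rw [abs_le]
    constructor <;> linarith
  rw [hν, Measure.restrict_smul, one_div_mul_eq_div] at hboth
  rwa [Measure.ae_ennreal_smul_measure_iff hM0] at hboth

end DegElliptic

namespace DegElliptic

variable {n : ℕ} {Ω : Set (EuclideanSpace ℝ (Fin n))} {m : Measure (EuclideanSpace ℝ (Fin n))}

/-! ### The measure `w dX` -/

section Weight

variable {w : EuclideanSpace ℝ (Fin n) → ℝ} {C₄ C₆ C_A : ℝ}

theorem weightMeasure_absolutelyContinuous :
    weightMeasure Ω w ≪ volume.restrict Ω :=
  withDensity_absolutelyContinuous _ _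

theorem weightMeasure_inter (hΩ : IsOpen Ω) (B : Set (EuclideanSpace ℝ (Fin n))) :
    weightMeasure Ω w (B ∩ Ω) = weightMeasure Ω w B := by
  refine measure_congr ?_
  have h : ∀ᵐ X ∂(weightMeasure Ω w), X ∈ Ω :=
    weightMeasure_absolutelyContinuous.ae_le (ae_restrict_mem hΩ.measurableSet)
  filter_upwards [h] with X hX
  exact propext ⟨fun h => h.1, fun h => ⟨h, hX⟩⟩

theorem DoublingWeight.aemeasurable (hw : DoublingWeight Ω w C₄) :
    AEMeasurable w (volume.restrict Ω) :=
  hw.locallyIntegrable.aestronglyMeasurable.aemeasurable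

/-- Balls centred in `Ω` have positive mass since w > 0 almost everywhere on a nonempty open set.
Small ones have finite mass by local integrability, and doubling passes this to every radius. -/
theorem DoublingWeight.doublingPoincare (hΩ : IsOpen Ω) (hC₄ : 1 ≤ C₄) (hC₆ : 0 < C₆)
    (hw : DoublingWeight Ω w C₄) (hP : WeakPoincare Ω (weightMeasure Ω w) C₆) :
    DoublingPoincare Ω (weightMeasure Ω w) C₄ C₆ := by
  have hdoub : ∀ X ∈ Ω, ∀ r : ℝ, 0 < r → weightMeasure Ω w (ball X (2 * r)) ≤
      ENNReal.ofReal C₄ * weightMeasure Ω w (ball X r) := fun X hX r hr => by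
    simpa only [weightMeasure_inter hΩ] using hw.doubling X (subset_closure hX) r hr
  refine ⟨by unfold weightMeasure; infer_instance, hC₄, hC₆, hdoub, ?_, ?_, hP⟩
  · intro X hX r hr
    rw [pos_iff_ne_zero]
    intro h0
    rw [weightMeasure, withDensity_apply _ measurableSet_ball,
      lintegral_eq_zero_iff' (hw.aemeasurable.ennreal_ofReal.mono_measure
        Measure.restrict_le_self)] at h0
    have hpos : ∀ᵐ Y ∂((volume.restrict Ω).restrict (ball X r)), 0 < w Y :=
      ae_restrict_of_ae hw.pos
    have hfalse : ∀ᵐ Y ∂((volume.restrict Ω).restrict (ball X r)), False := by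
      filter_upwards [h0, hpos] with Y h1 h2
      simp only [Pi.zero_apply, ENNReal.ofReal_eq_zero] at h1
      linarith
    rw [Measure.restrict_restrict measurableSet_ball, ae_iff] at hfalse
    simp only [not_false_eq_true, Set.ofPred_true, Measure.restrict_apply_univ] at hfalse
    exact ((isOpen_ball.inter hΩ).measure_pos volume ⟨X, mem_ball_self hr, hX⟩).ne' hfalse
  · intro X hX r hr
    obtain ⟨ρ, hρ, hρΩ⟩ := Metric.isOpen_iff.1 hΩ X hX
    have hsub : closedBall X (ρ / 2) ⊆ Ω := (closedBall_subset_ball (by linarith)).trans hρΩ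
    have hint := hw.locallyIntegrable.integrableOn_compact_subset hsub (isCompact_closedBall _ _)
    have hsmall : weightMeasure Ω w (ball X (ρ / 2)) < ⊤ := by
      refine lt_of_le_of_lt (measure_mono ball_subset_closedBall) ?_
      rw [weightMeasure, withDensity_apply _ measurableSet_closedBall,
        Measure.restrict_restrict measurableSet_closedBall, Set.inter_eq_left.2 hsub]
      exact hint.lintegral_lt_top
    have hk : ∀ k : ℕ, weightMeasure Ω w (ball X (2 ^ k * (ρ / 2))) < ⊤ := by
      intro k
      induction k with
      | zero => simpa using hsmall
      | succ k ih =>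
        rw [pow_succ', mul_assoc]
        exact (hdoub X hX _ (by positivity)).trans_lt (ENNReal.mul_lt_top (by simp) ih)
    obtain ⟨k, hk'⟩ := pow_unbounded_of_one_lt (r / (ρ / 2)) one_lt_two
    refine lt_of_le_of_lt (measure_mono (ball_subset_ball ?_)) (hk k)
    rw [div_lt_iff₀ (by positivity)] at hk'
    exact hk'.le

/-- Rewrites the weak equation, stated with dX, as an integral against m of the flux w⁻¹A∇u, which
is bounded and elliptic without weights. -/
theorem setIntegral_weightMeasure (hw : DoublingWeight Ω w C₄) {B : Set (EuclideanSpace ℝ (Fin n))}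
    (hB : MeasurableSet B) (hBΩ : B ⊆ Ω) (g : EuclideanSpace ℝ (Fin n) → ℝ) :
    ∫ X in B, (w X)⁻¹ * g X ∂(weightMeasure Ω w) = ∫ X in B, g X := by
  have hm : (volume.restrict Ω).restrict B = volume.restrict B := by
    rw [Measure.restrict_restrict hB, Set.inter_eq_left.2 hBΩ]
  have hwB : AEMeasurable w (volume.restrict B) :=
    hw.aemeasurable.mono_measure (Measure.restrict_mono_set _ hBΩ)
  rw [weightMeasure, restrict_withDensity hB, hm,
    integral_withDensity_eq_integral_toReal_smul₀ hwB.ennreal_ofReal (by simp)]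
  refine integral_congr_ae ?_
  filter_upwards [ae_mono (Measure.restrict_mono_set volume hBΩ) hw.pos] with X hX
  rw [ENNReal.toReal_ofReal hX.le, smul_eq_mul, ← mul_assoc, mul_inv_cancel₀ hX.ne', one_mul]

end Weight

/-! ### From weak solutions to local solutions -/

section Solution

variable {w : EuclideanSpace ℝ (Fin n) → ℝ} {C₄ C₆ C_A : ℝ}
  {A : EuclideanSpace ℝ (Fin n) → Matrix (Fin n) (Fin n) ℝ}

/-- A bump equal to 1 on the ball of radius 2R and supported in the closed ball of radius 3R makes u
globally a member of W. The approximants converge in L¹ on balls whose double lies in `Ω`, hence the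
room of 4R. -/
theorem HasLocalWGradient.approxPair {E : Set (EuclideanSpace ℝ (Fin n))}
    {u : EuclideanSpace ℝ (Fin n) → ℝ} {G : EuclideanSpace ℝ (Fin n) → EuclideanSpace ℝ (Fin n)}
    (hG : HasLocalWGradient Ω m E u G) {y : EuclideanSpace ℝ (Fin n)} {R : ℝ} (hR : 0 < R)
    (hE : ball y (4 * R) ⊆ E) (hEΩ : E ⊆ Ω) :
    ApproxPair (m.restrict (ball y (2 * R))) u G := by
  set b : ContDiffBump y := ⟨2 * R, 3 * R, by positivity, by linarith⟩ with hb
  have hbT : IsTestFunction E b := ⟨b.contDiff, b.hasCompactSupport, by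
    rw [b.tsupport_eq]
    exact (closedBall_subset_ball (by simp only [hb]; linarith)).trans hE⟩
  have hb1 : ∀ X ∈ ball y (2 * R), b X = 1 := fun X hX =>
    b.one_of_mem_closedBall (ball_subset_closedBall hX)
  obtain ⟨v, hv, hvG⟩ := hG b hbT (ball y (2 * R)) isOpen_ball hb1
  obtain ⟨φ, hφ, -, h1, h2⟩ := hv.approx
  have h4 : ball y (4 * R) ⊆ Ω := hE.trans hEΩ
  have hsub : ball y (2 * R) ⊆ Ω := (ball_subset_ball (by linarith)).trans h4
  have hu : Integrable u (m.restrict (ball y (2 * R))) := by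
    have h5 := hv.locallyIntegrable.integrableOn_compact_subset
      ((closedBall_subset_ball (by linarith)).trans h4 : closedBall y (2 * R) ⊆ Ω)
      (isCompact_closedBall _ _)
    refine (h5.mono_set ball_subset_closedBall).congr ?_
    filter_upwards [ae_restrict_mem measurableSet_ball] with X hX
    rw [hb1 X hX, one_mul]
  have hle : m.restrict (ball y (2 * R)) ≤ m.restrict Ω := Measure.restrict_mono_set m hsub
  have hGm : MemLp G 2 (m.restrict (ball y (2 * R))) :=
    (hv.memLp.mono_measure hle).ae_eq hvG
  refine .of_tendsto hu hGm hφ ?_ ?_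
  · have h5 := h1 y (2 * R) (by positivity) (by rwa [← mul_assoc, show (2 : ℝ) * 2 = 4 by norm_num])
    refine h5.congr fun i => ?_
    rw [eLpNorm_one_eq_lintegral_enorm]
    refine lintegral_congr_ae ?_
    filter_upwards [ae_restrict_mem measurableSet_ball] with X hX
    rw [hb1 X hX, one_mul]
    rfl
  · rw [tendsto_eLpNorm_two_iff]
    refine tendsto_of_tendsto_of_tendsto_of_le_of_le tendsto_const_nhds h2 (fun i => zero_le)
      fun i => ?_
    refine le_trans (le_of_eq (lintegral_congr_ae ?_)) (lintegral_mono_set hsub)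
    filter_upwards [hvG] with X hX
    rw [Pi.sub_apply, hX]

theorem ApproxPair.add_const {μ : Measure (EuclideanSpace ℝ (Fin n))} [IsFiniteMeasure μ]
    {f : EuclideanSpace ℝ (Fin n) → ℝ} {g : EuclideanSpace ℝ (Fin n) → EuclideanSpace ℝ (Fin n)}
    (H : ApproxPair μ f g) (ε : ℝ) : ApproxPair μ (fun X => f X + ε) g := by
  have hd : ∀ t, deriv (fun s : ℝ => s + ε) t = 1 := fun t => by simp
  have := H.comp (Φ := fun s => s + ε) (K := 1) (by fun_prop) (fun t => by rw [hd, abs_one])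
  simpa only [hd, one_smul] using this

/-- The flux `w⁻¹ A G`. -/
noncomputable def flux (w : EuclideanSpace ℝ (Fin n) → ℝ)
    (A : EuclideanSpace ℝ (Fin n) → Matrix (Fin n) (Fin n) ℝ)
    (G : EuclideanSpace ℝ (Fin n) → EuclideanSpace ℝ (Fin n)) (X : EuclideanSpace ℝ (Fin n)) :
    EuclideanSpace ℝ (Fin n) :=
  (w X)⁻¹ • WithLp.toLp 2 (A X *ᵥ (G X).ofLp)

theorem inner_flux {G : EuclideanSpace ℝ (Fin n) → EuclideanSpace ℝ (Fin n)}
    (X ζ : EuclideanSpace ℝ (Fin n)) :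
    inner ℝ (flux w A G X) ζ = (w X)⁻¹ * ((A X *ᵥ (G X).ofLp) ⬝ᵥ ζ.ofLp) := by
  rw [flux, inner_smul_left, EuclideanSpace.inner_eq_star_dotProduct]
  simp [dotProduct_comm]

/-- Take ζ = Mξ in the bilinear bound. -/
theorem norm_toLp_mulVec_le {M : Matrix (Fin n) (Fin n) ℝ} {c : ℝ} (hc : 0 ≤ c)
    (h : ∀ ξ ζ : EuclideanSpace ℝ (Fin n), (M *ᵥ ξ.ofLp) ⬝ᵥ ζ.ofLp ≤ c * ‖ξ‖ * ‖ζ‖)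
    (ξ : EuclideanSpace ℝ (Fin n)) : ‖WithLp.toLp 2 (M *ᵥ ξ.ofLp)‖ ≤ c * ‖ξ‖ := by
  set ζ : EuclideanSpace ℝ (Fin n) := WithLp.toLp 2 (M *ᵥ ξ.ofLp) with hζ
  have h1 : (M *ᵥ ξ.ofLp) ⬝ᵥ ζ.ofLp = ‖ζ‖ ^ 2 := by
    rw [← real_inner_self_eq_norm_sq, EuclideanSpace.inner_eq_star_dotProduct]
    simp [hζ]
  have h2 := h ξ ζ
  rw [h1] at h2
  rcases (norm_nonneg ζ).eq_or_lt with h0 | h0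
  · rw [← h0]; positivity
  · nlinarith

/-- Adding ε changes neither the gradient nor the flux, so u + ε solves the same equation and is
bounded below by ε. -/
theorem LocalSolution.of_isWeakSolution (hw : DoublingWeight Ω w C₄)
    (H : DoublingPoincare Ω (weightMeasure Ω w) C₄ C₆) (hC_A : 0 < C_A)
    (hA : EllipticMatrix Ω w A C_A) {E : Set (EuclideanSpace ℝ (Fin n))} (hE : MeasurableSet E)
    (hEΩ : E ⊆ Ω) {u : EuclideanSpace ℝ (Fin n) → ℝ}
    {G : EuclideanSpace ℝ (Fin n) → EuclideanSpace ℝ (Fin n)}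
    (hG : HasLocalWGradient Ω (weightMeasure Ω w) E u G)
    (hweak : ∀ φ, IsTestFunction E φ →
      ∫ X in E, (A X *ᵥ (G X).ofLp) ⬝ᵥ (gradient φ X).ofLp = 0)
    (hu : ∀ᵐ X ∂((weightMeasure Ω w).restrict E), 0 ≤ u X)
    {y : EuclideanSpace ℝ (Fin n)} {R : ℝ} (hR : 0 < R) (hy : ball y (4 * R) ⊆ E)
    {ε : ℝ} (hε : 0 < ε) :
    LocalSolution ((weightMeasure Ω w).restrict (ball y (2 * R))) (ball y (2 * R)) C_A ε
      (fun X => u X + ε) G (flux w A G) := by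
  set m := weightMeasure Ω w with hm
  set B := ball y (2 * R) with hB
  have hBE : B ⊆ E := (ball_subset_ball (by linarith)).trans hy
  have hBΩ : B ⊆ Ω := hBE.trans hEΩ
  have hyΩ : y ∈ Ω := hBΩ (mem_ball_self (by positivity))
  have hfin : IsFiniteMeasure (m.restrict B) :=
    ⟨by simpa using H.lt_top y hyΩ (2 * R) (by positivity)⟩
  have hpair := hG.approxPair hR hy hEΩ
  have hac : m.restrict B ≪ volume.restrict Ω :=
    Measure.absolutelyContinuous_of_le Measure.restrict_le_self |>.trans
      weightMeasure_absolutelyContinuous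
  have hbound : ∀ᵐ X ∂(m.restrict B), ‖flux w A G X‖ ≤ C_A * ‖G X‖ := by
    filter_upwards [hac.ae_le hA.bounded, hac.ae_le hw.pos] with X hX hwX
    rw [flux, norm_smul, norm_inv, Real.norm_eq_abs, abs_of_pos hwX,
      inv_mul_le_iff₀ hwX]
    calc _ ≤ C_A * w X * ‖G X‖ := norm_toLp_mulVec_le (by positivity) hX _
      _ = _ := by ring
  have hGm := hpair.memLp.1.aemeasurable
  have hVm : AEStronglyMeasurable (flux w A G) (m.restrict B) := by
    refine AEMeasurable.aestronglyMeasurable ?_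
    refine ((hw.aemeasurable.mono_ac hac).inv).smul ?_
    refine (WithLp.measurable_toLp 2 (Fin n → ℝ)).comp_aemeasurable (aemeasurable_pi_lambda _ fun i => ?_)
    simp only [Matrix.mulVec, dotProduct]
    refine Finset.aemeasurable_fun_sum _ fun j _ => ?_
    refine ((hA.measurable i j).mono_ac hac).mul ?_
    exact (measurable_pi_apply j).comp_aemeasurable
      ((WithLp.measurable_ofLp 2 (Fin n → ℝ)).comp_aemeasurable hGm)
  refine ⟨hC_A, hε, hpair.add_const ε, ?_, hbound, ?_, ?_, ?_⟩
  · exact hpair.memLp.of_le_mul hVm hbound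
  · filter_upwards [hac.ae_le hA.elliptic, hac.ae_le hw.pos] with X hX hwX
    rw [inner_flux, le_inv_mul_iff₀ hwX]
    calc _ = C_A⁻¹ * w X * ‖G X‖ ^ 2 := by ring
      _ ≤ _ := hX _
  · intro φ hφ
    simp only [inner_flux]
    rw [hm, setIntegral_weightMeasure hw measurableSet_ball hBΩ,
      ← hweak φ ⟨hφ.contDiff, hφ.hasCompactSupport, hφ.tsupport_subset.trans hBE⟩]
    refine (setIntegral_eq_of_subset_of_forall_sdiff_eq_zero hE hBE fun X hX => ?_).symm
    have hXt : X ∉ tsupport φ := fun h => hX.2 (hφ.tsupport_subset h)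
    have h0 : gradient φ X = 0 := by
      rw [gradient, image_eq_zero_of_notMem_tsupport fun h => hXt (tsupport_fderiv_subset ℝ h),
        map_zero]
    rw [h0]
    simp
  · filter_upwards [ae_mono (Measure.restrict_mono_set m hBE) hu] with X hX
    linarith

end Solution

/-! ### Chains of balls -/

/-- The constant c may depend on ε, but it cancels between sup u ≤ exp(A + c) and exp(c - A) ≤ inf u
+ ε; then ε → 0 because A is fixed. -/
theorem essSup_le_mul_essInf_of_log {μ : Measure (EuclideanSpace ℝ (Fin n))}
    {u : EuclideanSpace ℝ (Fin n) → ℝ} {A : ℝ} (hu : ∀ᵐ X ∂μ, 0 ≤ u X)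
    (h : ∀ ε : ℝ, 0 < ε → ∃ c : ℝ, ∀ᵐ X ∂μ, |Real.log (u X + ε) - c| ≤ A) :
    essSup (fun X => ENNReal.ofReal (u X)) μ ≤
      ENNReal.ofReal (Real.exp (2 * A)) * essInf (fun X => ENNReal.ofReal (u X)) μ := by
  have key : ∀ ε : ℝ, 0 < ε → essSup (fun X => ENNReal.ofReal (u X)) μ ≤
      ENNReal.ofReal (Real.exp (2 * A)) *
        (essInf (fun X => ENNReal.ofReal (u X)) μ + ENNReal.ofReal ε) := by
    intro ε hε
    obtain ⟨c, hc⟩ := h ε hε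
    have h1 : essSup (fun X => ENNReal.ofReal (u X)) μ ≤ ENNReal.ofReal (Real.exp (A + c)) := by
      refine essSup_le_of_ae_le _ ?_
      filter_upwards [hu, hc] with X hX hXc
      refine ENNReal.ofReal_le_ofReal ?_
      have h2 : Real.log (u X + ε) ≤ A + c := by linarith [(abs_le.1 hXc).2]
      rw [Real.log_le_iff_le_exp (by linarith)] at h2
      linarith
    have h2 : ENNReal.ofReal (Real.exp (c - A)) - ENNReal.ofReal ε ≤
        essInf (fun X => ENNReal.ofReal (u X)) μ := by
      refine le_essInf_of_ae_le _ ?_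
      filter_upwards [hu, hc] with X hX hXc
      rw [tsub_le_iff_right, ← ENNReal.ofReal_add hX hε.le]
      refine ENNReal.ofReal_le_ofReal ?_
      rw [← Real.le_log_iff_exp_le (by linarith)]
      linarith [(abs_le.1 hXc).1]
    calc _ ≤ ENNReal.ofReal (Real.exp (A + c)) := h1
      _ = ENNReal.ofReal (Real.exp (2 * A)) * ENNReal.ofReal (Real.exp (c - A)) := by
          rw [← ENNReal.ofReal_mul (Real.exp_pos _).le, ← Real.exp_add]
          congr 2
          ring
      _ ≤ _ := by
          gcongr
          exact tsub_le_iff_right.1 h2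
  have hlim : Tendsto (fun k : ℕ => ENNReal.ofReal (Real.exp (2 * A)) *
      (essInf (fun X => ENNReal.ofReal (u X)) μ + ENNReal.ofReal (1 / ((k : ℝ) + 1)))) atTop
      (𝓝 (ENNReal.ofReal (Real.exp (2 * A)) *
        (essInf (fun X => ENNReal.ofReal (u X)) μ + ENNReal.ofReal 0))) :=
    ENNReal.Tendsto.const_mul
      ((ENNReal.tendsto_ofReal tendsto_one_div_add_atTop_nhds_zero_nat).const_add _)
      (Or.inr (by simp))
  rw [ENNReal.ofReal_zero, add_zero] at hlim
  exact ge_of_tendsto' hlim fun k => key _ (by positivity)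

/-- Compare both at one point of the overlap, which exists since the overlap is not null. -/
theorem essInf_restrict_le_essSup_restrict {f : EuclideanSpace ℝ (Fin n) → ℝ≥0∞}
    {P Q : Set (EuclideanSpace ℝ (Fin n))} (h : m (P ∩ Q) ≠ 0) :
    essInf f (m.restrict P) ≤ essSup f (m.restrict Q) := by
  have h1 : ∀ᵐ X ∂(m.restrict (P ∩ Q)), essInf f (m.restrict P) ≤ f X :=
    ae_mono (Measure.restrict_mono_set m Set.inter_subset_left) (ae_essInf_le (f := f))
  have h2 : ∀ᵐ X ∂(m.restrict (P ∩ Q)), f X ≤ essSup f (m.restrict Q) :=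
    ae_mono (Measure.restrict_mono_set m Set.inter_subset_right) (ENNReal.ae_le_essSup f)
  have : (ae (m.restrict (P ∩ Q))).NeBot := by
    rwa [ae_neBot, Ne, Measure.restrict_eq_zero]
  obtain ⟨X, hX1, hX2⟩ := (h1.and h2).exists
  exact hX1.trans hX2

/-- Being null is a local property in a second countable space. -/
theorem ae_restrict_of_forall_ball {P : EuclideanSpace ℝ (Fin n) → Prop}
    {s : Set (EuclideanSpace ℝ (Fin n))} (hs : MeasurableSet s) {ρ : ℝ} (hρ : 0 < ρ)
    (h : ∀ y ∈ s, ∀ᵐ X ∂(m.restrict (ball y ρ)), P X) : ∀ᵐ X ∂(m.restrict s), P X := by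
  rw [ae_restrict_iff' hs, ae_iff]
  refine measure_null_of_locally_null _ fun y hy => ?_
  have hys : y ∈ s := by
    by_contra hys
    exact hy fun h => absurd h hys
  refine ⟨ball y ρ ∩ {X | ¬(X ∈ s → P X)}, ?_, ?_⟩
  · exact Filter.inter_mem (mem_nhdsWithin_of_mem_nhds (ball_mem_nhds y hρ)) self_mem_nhdsWithin
  · have h1 := h y hys
    rw [ae_restrict_iff' measurableSet_ball, ae_iff] at h1
    refine measure_mono_null (fun X hX => ?_) h1
    exact fun h2 => hX.2 fun _ => h2 hX.1

/-- A Harnack inequality on all balls of radius `r / 8` with centers in `ball x r` propagates to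
`ball x r`. -/
theorem essSup_le_mul_essInf_of_chain {x : EuclideanSpace ℝ (Fin n)} {r : ℝ} (hr : 0 < r)
    {f : EuclideanSpace ℝ (Fin n) → ℝ≥0∞} {C : ℝ≥0∞} (hC0 : C ≠ 0) (hC : C ≠ ⊤)
    (hpos : ∀ y ∈ ball x r, ∀ s : ℝ, 0 < s → 0 < m (ball y s))
    (h : ∀ y ∈ ball x r, essSup f (m.restrict (ball y (r / 8))) ≤
      C * essInf f (m.restrict (ball y (r / 8)))) :
    essSup f (m.restrict (ball x r)) ≤ C ^ 33 * essInf f (m.restrict (ball x r)) := by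
  set S : EuclideanSpace ℝ (Fin n) → ℝ≥0∞ := fun y => essSup f (m.restrict (ball y (r / 8))) with hS
  set I : EuclideanSpace ℝ (Fin n) → ℝ≥0∞ := fun y => essInf f (m.restrict (ball y (r / 8))) with hI
  -- Balls of radius r/8 with centres at most r/16 apart both contain the ball of radius r/16 about
  -- the first centre, which has positive measure.
  have hover : ∀ y ∈ ball x r, ∀ z ∈ ball x r, dist y z ≤ r / 16 → S y ≤ C * S z := by
    intro y hy z hz hyz
    refine (h y hy).trans ?_
    gcongr
    refine essInf_restrict_le_essSup_restrict (ne_of_gt ?_)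
    refine (hpos y hy (r / 16) (by positivity)).trans_le (measure_mono fun X hX => ⟨?_, ?_⟩)
    · exact ball_subset_ball (by linarith) hX
    · exact ball_subset_ball' (by linarith) hX
  have hchain : ∀ y ∈ ball x r, S y ≤ C ^ 16 * S x ∧ S x ≤ C ^ 16 * S y := by
    intro y hy
    -- Sixteen equal steps along the segment from x to y, each of length below r/16.
    set p : ℕ → EuclideanSpace ℝ (Fin n) := fun k => x + ((k : ℝ) / 16) • (y - x) with hp
    have hyx : ‖y - x‖ < r := by rwa [← dist_eq_norm, ← mem_ball]
    have hmem : ∀ k : ℕ, k ≤ 16 → p k ∈ ball x r := by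
      intro k hk
      have hk' : (k : ℝ) ≤ 16 := by exact_mod_cast hk
      rw [mem_ball, dist_eq_norm, hp]
      simp only [add_sub_cancel_left, norm_smul, Real.norm_eq_abs]
      rw [abs_of_nonneg (by positivity)]
      have : (k : ℝ) / 16 ≤ 1 := by linarith
      nlinarith [norm_nonneg (y - x)]
    have hdist : ∀ k : ℕ, dist (p k) (p (k + 1)) ≤ r / 16 := by
      intro k
      rw [dist_comm, dist_eq_norm]
      have : p (k + 1) - p k = (1 / 16 : ℝ) • (y - x) := by
        simp only [hp]
        push_cast
        module
      rw [this, norm_smul, Real.norm_eq_abs, abs_of_pos (by norm_num)]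
      linarith
    have hind : ∀ k : ℕ, k ≤ 16 → S (p k) ≤ C ^ k * S (p 0) ∧ S (p 0) ≤ C ^ k * S (p k) := by
      intro k
      induction k with
      | zero => simp
      | succ k ih =>
        intro hk
        obtain ⟨h1, h2⟩ := ih (by omega)
        constructor
        · calc S (p (k + 1)) ≤ C * S (p k) := by
                refine hover _ (hmem _ hk) _ (hmem _ (by omega)) ?_
                rw [dist_comm]; exact hdist k
            _ ≤ C * (C ^ k * S (p 0)) := by gcongr
            _ = _ := by ring
        · calc S (p 0) ≤ C ^ k * S (p k) := h2
            _ ≤ C ^ k * (C * S (p (k + 1))) := by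
                gcongr
                exact hover _ (hmem _ (by omega)) _ (hmem _ hk) (hdist k)
            _ = _ := by ring
    have h0 : p 0 = x := by simp [hp]
    have h16 : p 16 = y := by simp [hp]
    have := hind 16 le_rfl
    rwa [h0, h16] at this
  have hup : ∀ᵐ X ∂(m.restrict (ball x r)), f X ≤ C ^ 16 * S x := by
    refine ae_restrict_of_forall_ball measurableSet_ball (by positivity : 0 < r / 8) fun y hy => ?_
    filter_upwards [ENNReal.ae_le_essSup f] with X hX
    exact hX.trans (hchain y hy).1
  have hlow : ∀ᵐ X ∂(m.restrict (ball x r)), (C ^ 17)⁻¹ * S x ≤ f X := by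
    refine ae_restrict_of_forall_ball measurableSet_ball (by positivity : 0 < r / 8) fun y hy => ?_
    filter_upwards [ae_essInf_le (f := f)] with X hX
    refine le_trans ?_ hX
    calc (C ^ 17)⁻¹ * S x ≤ (C ^ 17)⁻¹ * (C ^ 16 * (C * I y)) := by
          gcongr
          exact (hchain y hy).2.trans (by gcongr; exact h y hy)
      _ = (C ^ 17)⁻¹ * C ^ 17 * I y := by ring
      _ = I y := by
          rw [ENNReal.inv_mul_cancel (pow_ne_zero _ hC0) (by finiteness), one_mul]
  -- 33 = 16 + 17: sixteen links from any centre to x for the supremum; sixteen back and one local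
  -- Harnack inequality for the infimum.
  calc essSup f (m.restrict (ball x r)) ≤ C ^ 16 * S x := essSup_le_of_ae_le _ hup
    _ = C ^ 33 * ((C ^ 17)⁻¹ * S x) := by
        rw [show C ^ 33 = C ^ 16 * C ^ 17 by ring, mul_assoc, ← mul_assoc (C ^ 17),
          ENNReal.mul_inv_cancel (pow_ne_zero _ hC0) (by finiteness), one_mul]
    _ ≤ _ := by
        gcongr
        exact le_essInf_of_ae_le _ hlow

end DegElliptic

/-! ### Assembly. -/

theorem mainTheorem10 (n : ℕ) (C₄ C₆ C_A : ℝ) (hC₄ : 1 ≤ C₄) (hC₆ : 0 < C₆) (hC_A : 0 < C_A) :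
    ∃ C : ℝ, 0 < C ∧
      ∀ (Ω : Set (EuclideanSpace ℝ (Fin n))) (w : EuclideanSpace ℝ (Fin n) → ℝ)
        (A : EuclideanSpace ℝ (Fin n) → Matrix (Fin n) (Fin n) ℝ),
        IsOpen Ω →
        DegElliptic.DoublingWeight Ω w C₄ →
        DegElliptic.UniqueGradientLimits Ω (DegElliptic.weightMeasure Ω w) →
        DegElliptic.WeakPoincare Ω (DegElliptic.weightMeasure Ω w) C₆ →
        DegElliptic.EllipticMatrix Ω w A C_A →
        ∀ (x : EuclideanSpace ℝ (Fin n)) (r : ℝ), 0 < r → ball x (2 * r) ⊆ Ω →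
          ∀ u : EuclideanSpace ℝ (Fin n) → ℝ,
            DegElliptic.IsWeakSolution Ω w A (ball x (2 * r)) u →
            (∀ᵐ X ∂((DegElliptic.weightMeasure Ω w).restrict (ball x (2 * r))), 0 ≤ u X) →
            essSup (fun X => ENNReal.ofReal (u X))
                ((DegElliptic.weightMeasure Ω w).restrict (ball x r)) ≤
              ENNReal.ofReal C *
                essInf (fun X => ENNReal.ofReal (u X))
                  ((DegElliptic.weightMeasure Ω w).restrict (ball x r)) := by
  obtain ⟨A₀, hA₀⟩ := DegElliptic.local_harnack n (C₆ := C₆) (Λ := C_A) hC₄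
  refine ⟨Real.exp (2 * A₀) ^ 33, by positivity, ?_⟩
  intro Ω w A hΩ hw _ hP hA x r hr hx u hu hu0
  obtain ⟨G, hG, hweak⟩ := hu.weak_eq
  have H := hw.doublingPoincare hΩ hC₄ hC₆ hP
  rw [ENNReal.ofReal_pow (Real.exp_pos _).le]
  refine DegElliptic.essSup_le_mul_essInf_of_chain hr (by simp [Real.exp_pos]) (by simp)
    (fun y hy => H.pos y (hx (ball_subset_ball (by linarith) hy))) fun y hy => ?_
  -- With R = r/4, the ball of radius 4R about y in `ball x r` stays in `ball x (2 * r)`, and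
  -- `local_harnack` acts on radius R/2 = r/8, as the chain requires.
  have hyr : ball y (4 * (r / 4)) ⊆ ball x (2 * r) :=
    ball_subset_ball' (by rw [mem_ball] at hy; linarith)
  have hr4 : 0 < r / 4 := by positivity
  refine DegElliptic.essSup_le_mul_essInf_of_log ?_ fun ε hε => ?_
  · exact ae_mono (Measure.restrict_mono_set _
      ((ball_subset_ball (by linarith)).trans hyr)) hu0
  · have S := DegElliptic.LocalSolution.of_isWeakSolution hw H hC_A hA measurableSet_ball hx hG
      hweak hu0 hr4 hyr hε
    have := hA₀ Ω _ H y (r / 4) hr4 (hyr.trans hx) ε _ _ _ S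
    rwa [show r / 4 / 2 = r / 8 by ring] at this
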